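/- **Theorem (extension of pretilting bundles).** Let $k$ be a field, $X^0$ an algebraic variety over $k$ (an integral separated scheme of finite type), and $\{U_i=\operatorname{Spec} A_i^0\}_{i\in I}$ a finite covering of $X^0$ by affine open subsets, indexed by a poset $I$ in which any two elements have a minimum, with $U_i\cap U_j=U_{\min(i,j)}$. Let $(R,\mathfrak m)$ be a commutative Artin local $k$-algebra with $R/\mathfrak m=k$. An *NC scheme* $A=(A_i,\phi_{ij})$ over $I$ consists of unital associative, not necessarily commutative, algebras $A_i$ and homomorphisms $\phi_{ij}:A_j\to A_i$ $(i<j)$ with $\phi_{ij}\phi_{jk}=\phi_{ik}$, such that $\phi_{ij}$ is flat (that is, $-\otimes_{A_j}A_i$ is exact on right $A_j$-modules) and the multiplication map $A_i\otimes_{A_j}A_i\to A_i$ is bijective. A *quasi-coherent module* $M=(M_i,\psi_{ij})$ on $A$ consists of right $A_i$-modules $M_i$ and isomorphisms of right $A_i$-modules $\psi_{ij}:M_j\otimes_{A_j}A_i\cong M_i$ $(i<j)$ satisfying the cocycle condition; with the evident morphisms these form an abelian category $\mathrm{Qcoh}(A)$, in which $\operatorname{Hom}_A$, $\operatorname{End}_A$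 and $\operatorname{Ext}^p_A$ are taken. $M$ is *locally free of rank $r$* if every $M_i$ is a free right $A_i$-module of rank $r$. An *NC deformation* of $X^0$ over $R$ is an NC scheme $A$ over $I$ whose $A_i$ are flat $R$-algebras and whose $\phi_{ij}$ are $R$-homomorphisms, together with $k$-algebra isomorphisms $\alpha_i:R/\mathfrak m\otimes_RA_i\cong A^0_i$ compatible with the $\phi_{ij}$ and the restriction maps of $X^0$. Let $A$ be an NC deformation of $X^0$ over $R$, and let $F^0$ be a locally free sheaf of rank $r$ on $X^0$ whose restriction to every $U_i$ is free. Assume that $F^0$ is *pretilting*, i.e. $\operatorname{Ext}^p_{X^0}(F^0,F^0)=0$ for all $p>0$. Then there is a locally free right $A$-module $F$ of rank $r$ which satisfies the following conditions. 1. There is an isomorphism $\theta:R/\mathfrak m\otimes_RF\cong F^0$ (isomorphisms $R/\mathfrak m\otimes_RF_i\cong\Gamma(U_i,F^0)$, linear over the $\alpha_i$ and compatible with gluing and restriction), and this determines $F$ uniquely up to isomorphisms inducing the identity on $F^0$: if $F'$ is a locally free $A$-module with an isomorphism $\theta':R/\mathfrak m\otimes_RF'\cong F^0$, then there is an isomorphism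 $g:F\cong F'$ with $\theta'\circ(R/\mathfrak m\otimes g)=\theta$. 2. $\operatorname{End}_A(F)$ is a flat $R$-module, and there is a ring isomorphism $R/\mathfrak m\otimes_R\operatorname{End}_A(F)\cong\operatorname{End}_{X^0}(F^0)$, namely the one that sends $c\otimes h$ to the endomorphism of $F^0$ corresponding to $c\otimes h$ under $\theta$. 3. $\operatorname{Ext}^p_A(F,F)=0$ for all $p>0$. -/

import Mathlib

open CategoryTheory AlgebraicGeometry MulOpposite
open scoped TensorProduct

universe w v u

/-! ### Tensor products over rings that need not be commutative

A right module over a ring `S` is a module over `Sᵐᵒᵖ`: the element `m · s` is `op s • m`. -/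

namespace NC

/-- The subgroup of `M ⊗_ℤ T` generated by the elements `m s ⊗ t - m ⊗ φ(s) t`. -/
def balanced {S T : Type u} [Ring S] [Ring T] (φ : S →+* T)
    (M : Type v) [AddCommGroup M] [Module Sᵐᵒᵖ M] : AddSubgroup (M ⊗[ℤ] T) :=
  AddSubgroup.closure {x | ∃ (m : M) (s : S) (t : T),
    x = (op s • m) ⊗ₜ[ℤ] t - m ⊗ₜ[ℤ] (φ s * t)}

/-- The tensor product `M ⊗_S T` of a right `S`-module `M` with `T`, which is a left `S`-module
through the ring homomorphism `φ : S → T`. -/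
abbrev RightTensor {S T : Type u} [Ring S] [Ring T] (φ : S →+* T)
    (M : Type v) [AddCommGroup M] [Module Sᵐᵒᵖ M] : Type (max u v) :=
  (M ⊗[ℤ] T) ⧸ balanced φ M

namespace RightTensor

variable {S T : Type u} [Ring S] [Ring T] (φ : S →+* T)
  {M : Type v} [AddCommGroup M] [Module Sᵐᵒᵖ M]
  {N : Type v} [AddCommGroup N] [Module Sᵐᵒᵖ N]

/-- The pure tensor `m ⊗ t` in `M ⊗_S T`. -/
def tmul (m : M) (t : T) : RightTensor φ M := QuotientAddGroup.mk' (balanced φ M) (m ⊗ₜ[ℤ] t)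

theorem tmul_balanced (m : M) (s : S) (t : T) :
    tmul φ (op s • m) t = tmul φ m (φ s * t) := by
  refine QuotientAddGroup.eq_iff_sub_mem.2 (AddSubgroup.subset_closure ⟨m, s, t, rfl⟩)

theorem tmul_add (m : M) (t t' : T) : tmul φ m (t + t') = tmul φ m t + tmul φ m t' := by
  simp [tmul, TensorProduct.tmul_add]

theorem add_tmul (m m' : M) (t : T) : tmul φ (m + m') t = tmul φ m t + tmul φ m' t := by
  simp [tmul, TensorProduct.add_tmul]

theorem induction_on {P : RightTensor φ M → Prop} (x : RightTensor φ M)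
    (h0 : P 0) (ht : ∀ m t, P (tmul φ m t)) (ha : ∀ x y, P x → P y → P (x + y)) : P x := by
  obtain ⟨y, rfl⟩ := QuotientAddGroup.mk'_surjective (balanced φ M) x
  induction y using TensorProduct.induction_on with
  | zero => simpa using h0
  | tmul m t => exact ht m t
  | add a b h h' => rw [map_add]; exact ha _ _ h h'

/-- The additive map on `M ⊗_S T` given by a biadditive map that is balanced over `S`. -/
def lift {P : Type*} [AddCommGroup P] (f : M →+ T →+ P)
    (hf : ∀ m s t, f (op s • m) t = f m (φ s * t)) : RightTensor φ M →+ P :=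
  QuotientAddGroup.lift (balanced φ M) (TensorProduct.liftAddHom f (fun c m t => by
      rw [map_zsmul, map_zsmul]; rfl))
    (by
      rw [balanced, AddSubgroup.closure_le]
      rintro _ ⟨m, s, t, rfl⟩
      rw [SetLike.mem_coe, AddMonoidHom.mem_ker, map_sub, TensorProduct.liftAddHom_tmul,
        TensorProduct.liftAddHom_tmul, hf, sub_self])

@[simp]
theorem lift_tmul {P : Type*} [AddCommGroup P] (f : M →+ T →+ P)
    (hf : ∀ m s t, f (op s • m) t = f m (φ s * t)) (m : M) (t : T) :
    lift φ f hf (tmul φ m t) = f m t := rfl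

theorem hom_ext {P : Type*} [AddCommGroup P] {f g : RightTensor φ M →+ P}
    (h : ∀ m t, f (tmul φ m t) = g (tmul φ m t)) : f = g := by
  refine DFunLike.ext _ _ fun x => ?_
  induction x using RightTensor.induction_on φ with
  | h0 => simp
  | ht m t => exact h m t
  | ha x y hx hy => simp [hx, hy]

/-- `(m, t) ↦ m ⊗ t` as a biadditive map. -/
def mk₂ : M →+ T →+ RightTensor φ M :=
  AddMonoidHom.mk' (fun m => AddMonoidHom.mk' (fun t => tmul φ m t) (tmul_add φ m))
    (fun m m' => by ext t; exact add_tmul φ m m' t)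

/-- The map `f ⊗ 1 : M ⊗_S T → N ⊗_S T` induced by a homomorphism `f` of right `S`-modules. -/
def map (f : M →ₗ[Sᵐᵒᵖ] N) : RightTensor φ M →+ RightTensor φ N :=
  lift φ ((mk₂ φ).comp f.toAddMonoidHom) (fun m s t => by
    change tmul φ (f (op s • m)) t = tmul φ (f m) (φ s * t)
    rw [map_smul, tmul_balanced])

@[simp]
theorem map_tmul (f : M →ₗ[Sᵐᵒᵖ] N) (m : M) (t : T) :
    map φ f (tmul φ m t) = tmul φ (f m) t := by
  unfold map
  rw [lift_tmul]; rfl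

@[simp]
theorem tmul_zero (m : M) : tmul φ m 0 = 0 := (mk₂ φ m).map_zero

@[simp]
theorem zero_tmul (t : T) : tmul φ (0 : M) t = 0 := by
  simp [tmul]

theorem map_id (x : RightTensor φ M) : map φ (LinearMap.id : M →ₗ[Sᵐᵒᵖ] M) x = x := by
  have : map φ (LinearMap.id : M →ₗ[Sᵐᵒᵖ] M) = AddMonoidHom.id _ :=
    hom_ext φ fun m t => by simp
  rw [this]; rfl

theorem map_zero' (x : RightTensor φ M) : map φ (0 : M →ₗ[Sᵐᵒᵖ] N) x = 0 := by
  have : map φ (0 : M →ₗ[Sᵐᵒᵖ] N) = 0 := hom_ext φ fun m t => by simp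
  rw [this]; rfl

variable {Q : Type v} [AddCommGroup Q] [Module Sᵐᵒᵖ Q]

theorem map_map (f : M →ₗ[Sᵐᵒᵖ] N) (g : N →ₗ[Sᵐᵒᵖ] Q) (x : RightTensor φ M) :
    map φ g (map φ f x) = map φ (g.comp f) x := by
  have : (map φ g).comp (map φ f) = map φ (g.comp f) := hom_ext φ (by simp)
  exact DFunLike.congr_fun this x

theorem map_surjective (f : M →ₗ[Sᵐᵒᵖ] N) (hf : Function.Surjective f) :
    Function.Surjective (map φ f) := by
  intro y
  induction y using RightTensor.induction_on φ with
  | h0 => exact ⟨0, map_zero _⟩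
  | ht n t => obtain ⟨m, rfl⟩ := hf n; exact ⟨tmul φ m t, map_tmul φ f m t⟩
  | ha x y hx hy =>
    obtain ⟨a, rfl⟩ := hx
    obtain ⟨b, rfl⟩ := hy
    exact ⟨a + b, map_add _ _ _⟩

/-- Right exactness: the kernel of `M ⊗ T → N ⊗ T`, for `M → N` surjective with kernel `K`,
is the image of `K ⊗ T`. -/
theorem exact_of_surjective (f : M →ₗ[Sᵐᵒᵖ] N) (hf : Function.Surjective f)
    (x : RightTensor φ M) (hx : map φ f x = 0) :
    ∃ y : RightTensor φ (LinearMap.ker f), map φ (LinearMap.ker f).subtype y = x := by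
  let Z := (map φ (LinearMap.ker f).subtype).range
  let q := QuotientAddGroup.mk' Z
  have key : ∀ m m' t, f m = f m' → q (tmul φ m t) = q (tmul φ m' t) := by
    intro m m' t h
    refine (QuotientAddGroup.eq_iff_sub_mem).2 ?_
    refine ⟨tmul φ ⟨m - m', by simp [h]⟩ t, ?_⟩
    rw [map_tmul, eq_sub_iff_add_eq, ← add_tmul]
    simp
  let s : N → M := Function.surjInv hf
  have hs : ∀ n, f (s n) = n := Function.surjInv_eq hf
  let b : N →+ T →+ (RightTensor φ M ⧸ Z) := AddMonoidHom.mk'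
    (fun n => AddMonoidHom.mk' (fun t => q (tmul φ (s n) t))
      (fun t t' => by rw [tmul_add, map_add]))
    (fun n n' => by
      ext t
      change q (tmul φ (s (n + n')) t) = q (tmul φ (s n) t) + q (tmul φ (s n') t)
      rw [← map_add, ← add_tmul]
      exact key _ _ _ (by simp [hs]))
  let g : RightTensor φ N →+ (RightTensor φ M ⧸ Z) := lift φ b (fun n a t => by
    change q (tmul φ (s (op a • n)) t) = q (tmul φ (s n) (φ a * t))
    rw [← tmul_balanced]
    exact key _ _ _ (by simp [hs]))
  have hg : g.comp (map φ f) = q := hom_ext φ (fun m t => by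
    change g (map φ f (tmul φ m t)) = _
    rw [map_tmul, lift_tmul]
    exact key _ _ _ (hs _))
  have : q x = 0 := by rw [← hg]; simp [hx]
  exact (QuotientAddGroup.eq_zero_iff x).1 this

end RightTensor

/-- `T`, regarded as a right module over `S` through `φ : S → T`. -/
def Restrict {S T : Type u} [Ring S] [Ring T] (_φ : S →+* T) : Type u := T

namespace Restrict

variable {S T : Type u} [Ring S] [Ring T] (φ : S →+* T)

instance : AddCommGroup (Restrict φ) := inferInstanceAs (AddCommGroup T)

instance : Module Sᵐᵒᵖ (Restrict φ) := Module.compHom T (RingHom.op φ)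

/-- The multiplication map `T ⊗_S T → T`, `t ⊗ t' ↦ t t'`. -/
def mul : RightTensor φ (Restrict φ) →+ T :=
  RightTensor.lift φ (AddMonoidHom.mul (R := T)) (fun m s t => mul_assoc (G := T) m (φ s) t)

end Restrict

/-- `φ : S → T` is flat: `- ⊗_S T` preserves injectivity of homomorphisms of right
`S`-modules. -/
def IsFlatHom {S T : Type u} [Ring S] [Ring T] (φ : S →+* T) : Prop :=
  ∀ (M N : Type u) [AddCommGroup M] [AddCommGroup N] [Module Sᵐᵒᵖ M] [Module Sᵐᵒᵖ N]
    (f : M →ₗ[Sᵐᵒᵖ] N), Function.Injective f → Function.Injective (RightTensor.map φ f)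

end NC

/-! ### NC schemes and quasi-coherent modules -/

/-- An NC scheme over a commutative ring `R`, with respect to a partially ordered set `I` in which
any two elements have a minimum. The homomorphism `φ` is the identity for `i = j`, so that all the
conditions only say something for `i < j`. -/
structure NCScheme (R : Type u) [CommRing R] (I : Type w) [SemilatticeInf I] where
  /-- the algebras `A_i` -/
  A : I → Type u
  [ring : ∀ i, Ring (A i)]
  [algebra : ∀ i, Algebra R (A i)]
  /-- the gluing homomorphisms `φ_{ij} : A_j → A_i` for `i ≤ j` -/
  φ : ∀ {i j : I}, i ≤ j → A j →ₐ[R] A i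
  φ_refl : ∀ (i : I) (a : A i), φ (le_refl i) a = a
  φ_comp : ∀ {i j l : I} (hij : i ≤ j) (hjl : j ≤ l) (a : A l),
    φ hij (φ hjl a) = φ (hij.trans hjl) a
  flat : ∀ {i j : I} (h : i ≤ j), NC.IsFlatHom (φ h : A j →+* A i)
  birational : ∀ {i j : I} (h : i ≤ j), Function.Bijective (NC.Restrict.mul (φ h : A j →+* A i))

attribute [instance] NCScheme.ring NCScheme.algebra

/-- The map `M' ⊗_S T → M`, `m ⊗ t ↦ ρ(m) t`, induced by an additive map `ρ : M' → M` from a right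
`S`-module to a right `T`-module with `ρ(m s) = ρ(m) φ(s)`. -/
def NC.glue {S T : Type u} [Ring S] [Ring T] (φ : S →+* T)
    {M' M : Type u} [AddCommGroup M'] [Module Sᵐᵒᵖ M'] [AddCommGroup M] [Module Tᵐᵒᵖ M]
    (ρ : M' →+ M) (hρ : ∀ (s : S) (m : M'), ρ (op s • m) = op (φ s) • ρ m) :
    NC.RightTensor φ M' →+ M :=
  NC.RightTensor.lift φ
    (AddMonoidHom.mk' (fun m => AddMonoidHom.mk' (fun t => op t • ρ m)
        (fun t t' => by rw [MulOpposite.op_add, add_smul]))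
      (fun m m' => by ext t; simp))
    (fun m s t => by
      change op t • ρ (op s • m) = op (φ s * t) • ρ m
      rw [hρ, smul_smul, op_mul])

theorem NC.glue_tmul {S T : Type u} [Ring S] [Ring T] (φ : S →+* T)
    {M' M : Type u} [AddCommGroup M'] [Module Sᵐᵒᵖ M'] [AddCommGroup M] [Module Tᵐᵒᵖ M]
    (ρ : M' →+ M) (hρ : ∀ (s : S) (m : M'), ρ (op s • m) = op (φ s) • ρ m) (m : M') (t : T) :
    NC.glue φ ρ hρ (NC.RightTensor.tmul φ m t) = op t • ρ m := rfl

/-- A quasi-coherent module on an NC scheme `A`: right `A_i`-modules `M_i` with gluing isomorphisms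
`ψ_{ij} : M_j ⊗_{A_j} A_i ≅ M_i`. The homomorphism `ψ_{ij}` is recorded by the map
`ρ_{ij} : M_j → M_i`, `ρ_{ij}(m) = ψ_{ij}(m ⊗ 1)`, so that `ψ_{ij}(m ⊗ a) = ρ_{ij}(m) a`.
The `R`-module structure of `M_i` is the one given by `R → A_i`. -/
structure QCoh {R : Type u} [CommRing R] {I : Type w} [SemilatticeInf I] (A : NCScheme R I) where
  /-- the right `A_i`-modules `M_i` -/
  M : I → Type u
  [addCommGroup : ∀ i, AddCommGroup (M i)]
  [moduleBase : ∀ i, Module R (M i)]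
  [module : ∀ i, Module (A.A i)ᵐᵒᵖ (M i)]
  [tower : ∀ i, IsScalarTower R (A.A i)ᵐᵒᵖ (M i)]
  /-- the maps `ρ_{ij} : M_j → M_i` for `i ≤ j` -/
  ρ : ∀ {i j : I}, i ≤ j → M j →+ M i
  ρ_smul : ∀ {i j : I} (h : i ≤ j) (a : A.A j) (m : M j), ρ h (op a • m) = op (A.φ h a) • ρ h m
  ρ_refl : ∀ (i : I) (m : M i), ρ (le_refl i) m = m
  ρ_comp : ∀ {i j l : I} (hij : i ≤ j) (hjl : j ≤ l) (m : M l),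
    ρ hij (ρ hjl m) = ρ (hij.trans hjl) m
  /-- `ψ_{ij}` is an isomorphism. -/
  bijective : ∀ {i j : I} (h : i ≤ j),
    Function.Bijective (NC.glue (A.φ h : A.A j →+* A.A i) (ρ h) (ρ_smul h))

attribute [instance] QCoh.addCommGroup QCoh.moduleBase QCoh.module QCoh.tower

namespace QCoh

variable {R : Type u} [CommRing R] {I : Type w} [SemilatticeInf I] {A : NCScheme R I}

/-- The gluing isomorphism `ψ_{ij} : M_j ⊗_{A_j} A_i → M_i`. -/
def ψ (M : QCoh A) {i j : I} (h : i ≤ j) :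
    NC.RightTensor (A.φ h : A.A j →+* A.A i) (M.M j) →+ M.M i :=
  NC.glue (A.φ h : A.A j →+* A.A i) (M.ρ h) (M.ρ_smul h)

/-- A homomorphism of quasi-coherent modules: homomorphisms of right `A_i`-modules that are
compatible with the gluing. -/
@[ext]
structure Hom (M N : QCoh A) where
  app : ∀ i, M.M i →ₗ[(A.A i)ᵐᵒᵖ] N.M i
  comm : ∀ {i j : I} (h : i ≤ j) (m : M.M j), app i (M.ρ h m) = N.ρ h (app j m)

instance : Category (QCoh A) where
  Hom := Hom
  id M := ⟨fun _ => LinearMap.id, fun _ _ => rfl⟩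
  comp f g := ⟨fun i => (g.app i).comp (f.app i), fun h m => by simp [f.comm, g.comm]⟩

@[simp] theorem id_app (M : QCoh A) (i : I) (m : M.M i) : Hom.app (𝟙 M) i m = m := rfl

@[simp] theorem comp_app {M N P : QCoh A} (f : M ⟶ N) (g : N ⟶ P) (i : I) (m : M.M i) :
    (f ≫ g).app i m = g.app i (f.app i m) := rfl

theorem hom_ext {M N : QCoh A} {f g : M ⟶ N} (h : ∀ i m, f.app i m = g.app i m) : f = g :=
  Hom.ext (funext fun i => LinearMap.ext (h i))

theorem ρ_base (M : QCoh A) {i j : I} (h : i ≤ j) (r : R) (m : M.M j) :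
    M.ρ h (r • m) = r • M.ρ h m := by
  rw [← algebraMap_smul (A.A j)ᵐᵒᵖ r m, ← algebraMap_smul (A.A i)ᵐᵒᵖ r (M.ρ h m)]
  rw [MulOpposite.algebraMap_apply, MulOpposite.algebraMap_apply, M.ρ_smul, AlgHom.commutes]

/-- `ρ_{ij}` as an `R`-linear map. -/
def ρLin (M : QCoh A) {i j : I} (h : i ≤ j) : M.M j →ₗ[R] M.M i :=
  { M.ρ h with map_smul' := fun r m => M.ρ_base h r m }

instance smulCommClassBase (M : QCoh A) (i : I) : SMulCommClass R (A.A i)ᵐᵒᵖ (M.M i) :=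
  IsScalarTower.to_smulCommClass

instance smulCommClassBase' (M : QCoh A) (i : I) : SMulCommClass (A.A i)ᵐᵒᵖ R (M.M i) :=
  SMulCommClass.symm _ _ _

/-! #### The `R`-linear structure -/

section Linear

variable (M N : QCoh A)

instance : Zero (M ⟶ N) := ⟨⟨fun _ => 0, fun _ _ => by simp⟩⟩
instance : Add (M ⟶ N) :=
  ⟨fun f g => ⟨fun i => f.app i + g.app i, fun h m => by simp [f.comm, g.comm]⟩⟩
instance : Neg (M ⟶ N) := ⟨fun f => ⟨fun i => -f.app i, fun h m => by simp [f.comm]⟩⟩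
instance : Sub (M ⟶ N) :=
  ⟨fun f g => ⟨fun i => f.app i - g.app i, fun h m => by simp [f.comm, g.comm]⟩⟩
instance : SMul R (M ⟶ N) :=
  ⟨fun r f => ⟨fun i => r • f.app i, fun h m => by simp [f.comm, ρ_base]⟩⟩
instance : SMul ℕ (M ⟶ N) :=
  ⟨fun n f => ⟨fun i => n • f.app i, fun h m => by simp [f.comm]⟩⟩
instance : SMul ℤ (M ⟶ N) :=
  ⟨fun n f => ⟨fun i => n • f.app i, fun h m => by simp [f.comm]⟩⟩

/-- The family of components of a homomorphism. -/
def components (f : M ⟶ N) : ∀ i, M.M i →ₗ[(A.A i)ᵐᵒᵖ] N.M i := f.app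

theorem components_injective : Function.Injective (components M N) :=
  fun _ _ h => Hom.ext h

instance : AddCommGroup (M ⟶ N) :=
  (components_injective M N).addCommGroup _ rfl (fun _ _ => rfl) (fun _ => rfl)
    (fun _ _ => rfl) (fun _ _ => rfl) (fun _ _ => rfl)

instance : Module R (M ⟶ N) :=
  (components_injective M N).module R
    (⟨⟨components M N, rfl⟩, fun _ _ => rfl⟩ : (M ⟶ N) →+ _) (fun _ _ => rfl)

variable {M N}

@[simp] theorem zero_app (i : I) (m : M.M i) : Hom.app (0 : M ⟶ N) i m = 0 := rfl
@[simp] theorem add_app (f g : M ⟶ N) (i : I) (m : M.M i) :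
    (f + g).app i m = f.app i m + g.app i m := rfl
@[simp] theorem smul_app (r : R) (f : M ⟶ N) (i : I) (m : M.M i) :
    (r • f).app i m = r • f.app i m := rfl

end Linear

instance : Preadditive (QCoh A) where
  add_comp _ _ _ f g h := hom_ext fun i m => by simp
  comp_add _ _ _ f g h := hom_ext fun i m => by simp

instance : Linear R (QCoh A) where
  smul_comp _ _ _ r f g := hom_ext fun i m => by
    simp only [comp_app, smul_app]
    exact LinearMap.map_smul_of_tower _ _ _
  comp_smul _ _ _ f r g := hom_ext fun i m => by simp

/-! #### The category of quasi-coherent modules is abelian -/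

theorem ψ_natural {M N : QCoh A} (f : M ⟶ N) {i j : I} (h : i ≤ j)
    (x : NC.RightTensor (A.φ h : A.A j →+* A.A i) (M.M j)) :
    N.ψ h (NC.RightTensor.map _ (f.app j) x) = f.app i (M.ψ h x) := by
  have : (N.ψ h).comp (NC.RightTensor.map _ (f.app j)) =
      (f.app i).toAddMonoidHom.comp (M.ψ h) := by
    refine NC.RightTensor.hom_ext _ fun m t => ?_
    change N.ψ h (NC.RightTensor.map _ (f.app j) (NC.RightTensor.tmul _ m t)) =
      f.app i (op t • M.ρ h m)
    rw [NC.RightTensor.map_tmul, map_smul, f.comm]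
    rfl
  exact DFunLike.congr_fun this x

theorem ker_bijective {M N : QCoh A} (f : M ⟶ N) {i j : I} (h : i ≤ j)
    (g : NC.RightTensor (A.φ h : A.A j →+* A.A i) (LinearMap.ker (f.app j)) →+ LinearMap.ker (f.app i))
    (hg : ∀ m t, (g (NC.RightTensor.tmul _ m t) : M.M i) = op t • M.ρ h m) :
    Function.Bijective g := by
  have key : ∀ x, (g x : M.M i) =
      M.ψ h (NC.RightTensor.map _ (LinearMap.ker (f.app j)).subtype x) := by
    intro x
    have : (LinearMap.ker (f.app i)).subtype.toAddMonoidHom.comp g = (M.ψ h).comp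
        (NC.RightTensor.map _ (LinearMap.ker (f.app j)).subtype) := by
      refine NC.RightTensor.hom_ext _ fun m t => ?_
      refine (hg m t).trans ?_
      rw [AddMonoidHom.comp_apply, NC.RightTensor.map_tmul]
      rfl
    exact DFunLike.congr_fun this x
  constructor
  · intro x y hxy
    refine A.flat h _ _ _ (Submodule.subtype_injective _) ((M.bijective h).1 ?_)
    exact (key x).symm.trans ((congrArg Subtype.val hxy).trans (key y))
  · rintro ⟨m, hm⟩
    obtain ⟨x, rfl⟩ := (M.bijective h).2 m
    have h0 : NC.RightTensor.map _ (f.app j) x = 0 := by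
      refine (N.bijective h).1 ?_
      refine (ψ_natural f h x).trans ?_
      rw [map_zero]; exact hm
    have h1 : NC.RightTensor.map (A.φ h : A.A j →+* A.A i) (f.app j).rangeRestrict x = 0 := by
      refine A.flat h _ _ (LinearMap.range (f.app j)).subtype
        (Submodule.subtype_injective _) ?_
      rw [NC.RightTensor.map_map, map_zero]
      exact h0
    obtain ⟨y, hy⟩ := NC.RightTensor.exact_of_surjective _ _
      (f.app j).surjective_rangeRestrict x h1
    have hk : LinearMap.ker (f.app j).rangeRestrict ≤ LinearMap.ker (f.app j) :=
      (LinearMap.ker_rangeRestrict _).le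
    refine ⟨NC.RightTensor.map _ (Submodule.inclusion hk) y, Subtype.ext ?_⟩
    rw [key, NC.RightTensor.map_map]
    exact congrArg (M.ψ h) hy

/-- The kernel of a homomorphism, formed componentwise. -/
def ker {M N : QCoh A} (f : M ⟶ N) : QCoh A where
  M i := LinearMap.ker (f.app i)
  ρ {i j} h := ((M.ρ h).comp (LinearMap.ker (f.app j)).subtype.toAddMonoidHom).codRestrict
    (LinearMap.ker (f.app i)).toAddSubgroup (fun m => by
      change f.app i (M.ρ h m) = 0
      rw [f.comm]; exact (congrArg (N.ρ h) m.2).trans (map_zero _))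
  ρ_smul h a m := Subtype.ext (M.ρ_smul h a m)
  ρ_refl i m := Subtype.ext (M.ρ_refl i m)
  ρ_comp h h' m := Subtype.ext (M.ρ_comp h h' m)
  bijective h := ker_bijective f h _ (fun _ _ => rfl)

/-- The inclusion of the kernel. -/
def kerι {M N : QCoh A} (f : M ⟶ N) : ker f ⟶ M :=
  ⟨fun i => (LinearMap.ker (f.app i)).subtype, fun _ _ => rfl⟩

theorem kerι_comp {M N : QCoh A} (f : M ⟶ N) : kerι f ≫ f = 0 :=
  hom_ext fun _ m => m.2

/-- Factorization through an injective homomorphism. -/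
noncomputable def liftInj {M N P : QCoh A} (f : M ⟶ N) (hf : ∀ i, Function.Injective (f.app i))
    (g : P ⟶ N) (hg : ∀ i x, g.app i x ∈ LinearMap.range (f.app i)) : P ⟶ M where
  app i := (LinearEquiv.ofInjective (f.app i) (hf i)).symm.toLinearMap.comp
    ((g.app i).codRestrict _ (hg i))
  comm {i j} h x := by
    refine hf i ?_
    rw [f.comm]
    have e : ∀ i x, f.app i ((LinearEquiv.ofInjective (f.app i) (hf i)).symm
        ((g.app i).codRestrict _ (hg i) x)) = g.app i x := fun i x =>
      congrArg Subtype.val ((LinearEquiv.ofInjective (f.app i) (hf i)).apply_symm_apply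
        ((g.app i).codRestrict _ (hg i) x))
    exact (e i _).trans ((g.comm h x).trans (congrArg (N.ρ h) (e j x)).symm)

theorem liftInj_comp {M N P : QCoh A} (f : M ⟶ N) (hf : ∀ i, Function.Injective (f.app i))
    (g : P ⟶ N) (hg : ∀ i x, g.app i x ∈ LinearMap.range (f.app i)) :
    liftInj f hf g hg ≫ f = g :=
  hom_ext fun i x => congrArg Subtype.val
    ((LinearEquiv.ofInjective (f.app i) (hf i)).apply_symm_apply
      ((g.app i).codRestrict _ (hg i) x))

/-- An injective homomorphism whose range is the kernel of `g` is a kernel of `g`. -/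
noncomputable def isLimitOfExact {M N P : QCoh A} (f : M ⟶ N) (g : N ⟶ P) (w : f ≫ g = 0)
    (hf : ∀ i, Function.Injective (f.app i))
    (hfg : ∀ i x, g.app i x = 0 → x ∈ LinearMap.range (f.app i)) :
    Limits.IsLimit (Limits.KernelFork.ofι f w) :=
  Limits.KernelFork.IsLimit.ofι f w
    (fun h hh => liftInj f hf h fun i x => hfg i _ (congrArg (fun t => Hom.app t i x) hh))
    (fun h hh => liftInj_comp _ _ _ _)
    (fun h hh m hm => hom_ext fun i x => hf i <| by
      change (m ≫ f).app i x = (liftInj f hf h (fun i x => hfg i _ (congrArg (fun t => Hom.app t i x) hh)) ≫ f).app i x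
      rw [hm, liftInj_comp])

theorem coker_bijective {M N : QCoh A} (f : M ⟶ N) {i j : I} (h : i ≤ j)
    (g : NC.RightTensor (A.φ h : A.A j →+* A.A i) (N.M j ⧸ LinearMap.range (f.app j)) →+
      N.M i ⧸ LinearMap.range (f.app i))
    (hg : ∀ m t, g (NC.RightTensor.tmul _ ((LinearMap.range (f.app j)).mkQ m) t) =
      (LinearMap.range (f.app i)).mkQ (op t • N.ρ h m)) :
    Function.Bijective g := by
  have key : ∀ x, g (NC.RightTensor.map _ (LinearMap.range (f.app j)).mkQ x) =
      (LinearMap.range (f.app i)).mkQ (N.ψ h x) := by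
    intro x
    have : g.comp (NC.RightTensor.map _ (LinearMap.range (f.app j)).mkQ) =
        (LinearMap.range (f.app i)).mkQ.toAddMonoidHom.comp (N.ψ h) := by
      refine NC.RightTensor.hom_ext _ fun m t => ?_
      rw [AddMonoidHom.comp_apply, NC.RightTensor.map_tmul]
      exact hg m t
    exact DFunLike.congr_fun this x
  constructor
  · rw [injective_iff_map_eq_zero]
    intro x hx
    obtain ⟨y, rfl⟩ := NC.RightTensor.map_surjective _ _ (Submodule.mkQ_surjective _) x
    rw [key] at hx
    obtain ⟨m, hm⟩ := (Submodule.Quotient.mk_eq_zero _).1 hx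
    obtain ⟨z, rfl⟩ := (M.bijective h).2 m
    have hz : NC.RightTensor.map _ (f.app j) z = y :=
      (N.bijective h).1 ((ψ_natural f h z).trans hm)
    rw [← hz, NC.RightTensor.map_map, LinearMap.range_mkQ_comp, NC.RightTensor.map_zero']
  · intro m
    obtain ⟨m, rfl⟩ := Submodule.mkQ_surjective _ m
    obtain ⟨x, rfl⟩ := (N.bijective h).2 m
    exact ⟨_, key x⟩

/-- The cokernel of a homomorphism, formed componentwise. -/
def coker {M N : QCoh A} (f : M ⟶ N) : QCoh A where
  M i := N.M i ⧸ LinearMap.range (f.app i)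
  ρ {i j} h := QuotientAddGroup.map (LinearMap.range (f.app j)).toAddSubgroup
    (LinearMap.range (f.app i)).toAddSubgroup (N.ρ h) (by
      rintro _ ⟨m, rfl⟩
      exact ⟨M.ρ h m, f.comm h m⟩)
  ρ_smul h a m := by
    obtain ⟨m, rfl⟩ := Submodule.Quotient.mk_surjective _ m
    exact congrArg (Submodule.Quotient.mk) (N.ρ_smul h a m)
  ρ_refl i m := by
    obtain ⟨m, rfl⟩ := Submodule.Quotient.mk_surjective _ m
    exact congrArg (Submodule.Quotient.mk) (N.ρ_refl i m)
  ρ_comp h h' m := by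
    obtain ⟨m, rfl⟩ := Submodule.Quotient.mk_surjective _ m
    exact congrArg (Submodule.Quotient.mk) (N.ρ_comp h h' m)
  bijective h := coker_bijective f h _ (fun _ _ => rfl)

/-- The projection to the cokernel. -/
def cokerπ {M N : QCoh A} (f : M ⟶ N) : N ⟶ coker f :=
  ⟨fun i => (LinearMap.range (f.app i)).mkQ, fun _ _ => rfl⟩

theorem comp_cokerπ {M N : QCoh A} (f : M ⟶ N) : f ≫ cokerπ f = 0 :=
  hom_ext fun _ m => (Submodule.Quotient.mk_eq_zero _).2 ⟨m, rfl⟩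

/-- Factorization through a surjective homomorphism. -/
noncomputable def descSurj {M N P : QCoh A} (f : M ⟶ N) (hf : ∀ i, Function.Surjective (f.app i))
    (g : M ⟶ P) (hg : ∀ i, LinearMap.ker (f.app i) ≤ LinearMap.ker (g.app i)) : N ⟶ P where
  app i := ((LinearMap.ker (f.app i)).liftQ (g.app i) (hg i)).comp
    (LinearMap.quotKerEquivOfSurjective (f.app i) (hf i)).symm.toLinearMap
  comm {i j} h x := by
    obtain ⟨x, rfl⟩ := hf j x
    have e : ∀ i x, ((LinearMap.ker (f.app i)).liftQ (g.app i) (hg i))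
        ((LinearMap.quotKerEquivOfSurjective (f.app i) (hf i)).symm (f.app i x)) = g.app i x := by
      intro i x
      have : (LinearMap.quotKerEquivOfSurjective (f.app i) (hf i)).symm (f.app i x) =
          (LinearMap.ker (f.app i)).mkQ x := by
        rw [LinearEquiv.symm_apply_eq]; rfl
      rw [this]; rfl
    change ((LinearMap.ker (f.app i)).liftQ (g.app i) (hg i))
      ((LinearMap.quotKerEquivOfSurjective (f.app i) (hf i)).symm (N.ρ h (f.app j x))) =
      P.ρ h (((LinearMap.ker (f.app j)).liftQ (g.app j) (hg j))
        ((LinearMap.quotKerEquivOfSurjective (f.app j) (hf j)).symm (f.app j x)))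
    rw [← f.comm, e, e, g.comm]

theorem comp_descSurj {M N P : QCoh A} (f : M ⟶ N) (hf : ∀ i, Function.Surjective (f.app i))
    (g : M ⟶ P) (hg : ∀ i, LinearMap.ker (f.app i) ≤ LinearMap.ker (g.app i)) :
    f ≫ descSurj f hf g hg = g :=
  hom_ext fun i x => by
    change ((LinearMap.ker (f.app i)).liftQ (g.app i) (hg i))
      ((LinearMap.quotKerEquivOfSurjective (f.app i) (hf i)).symm (f.app i x)) = _
    have : (LinearMap.quotKerEquivOfSurjective (f.app i) (hf i)).symm (f.app i x) =
        (LinearMap.ker (f.app i)).mkQ x := by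
      rw [LinearEquiv.symm_apply_eq]; rfl
    rw [this]; rfl

/-- A surjective homomorphism whose kernel is the range of `f` is a cokernel of `f`. -/
noncomputable def isColimitOfExact {M N P : QCoh A} (f : M ⟶ N) (g : N ⟶ P) (w : f ≫ g = 0)
    (hg : ∀ i, Function.Surjective (g.app i))
    (hfg : ∀ i x, g.app i x = 0 → x ∈ LinearMap.range (f.app i)) :
    Limits.IsColimit (Limits.CokernelCofork.ofπ g w) :=
  Limits.CokernelCofork.IsColimit.ofπ g w
    (fun h hh => descSurj g hg h fun i x hx => by
      obtain ⟨y, rfl⟩ := hfg i x hx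
      exact congrArg (fun t => Hom.app t i y) hh)
    (fun h hh => comp_descSurj _ _ _ _)
    (fun h hh m hm => hom_ext fun i x => by
      obtain ⟨x, rfl⟩ := hg i x
      change (g ≫ m).app i x = (g ≫ descSurj g hg h (fun i x hx => by
        obtain ⟨y, rfl⟩ := hfg i x hx
        exact congrArg (fun t => Hom.app t i y) hh)).app i x
      rw [hm, comp_descSurj])

instance : Limits.HasKernels (QCoh A) where
  has_limit f := ⟨⟨⟨_, isLimitOfExact (kerι f) f (kerι_comp f)
    (fun i => (LinearMap.ker (f.app i)).subtype_injective)
    (fun i x hx => ⟨(⟨x, hx⟩ : LinearMap.ker (f.app i)), rfl⟩)⟩⟩⟩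

instance : Limits.HasCokernels (QCoh A) where
  has_colimit f := ⟨⟨⟨_, isColimitOfExact f (cokerπ f) (comp_cokerπ f)
    (fun _ => Submodule.mkQ_surjective _)
    (fun _ _ hx => (Submodule.Quotient.mk_eq_zero _).1 hx)⟩⟩⟩

theorem injective_of_mono {M N : QCoh A} (f : M ⟶ N) [Mono f] (i : I) :
    Function.Injective (f.app i) := by
  have h : kerι f = 0 := by rw [← cancel_mono f, kerι_comp, Limits.zero_comp]
  rw [injective_iff_map_eq_zero]
  intro x hx
  exact congrArg (fun t => Hom.app t i (⟨x, hx⟩ : LinearMap.ker (f.app i))) h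

theorem surjective_of_epi {M N : QCoh A} (f : M ⟶ N) [Epi f] (i : I) :
    Function.Surjective (f.app i) := by
  have h : cokerπ f = 0 := by rw [← cancel_epi f, comp_cokerπ, Limits.comp_zero]
  intro x
  exact (Submodule.Quotient.mk_eq_zero _).1 (congrArg (fun t => Hom.app t i x) h)

instance : IsNormalMonoCategory (QCoh A) where
  normalMonoOfMono f _ := ⟨⟨_, cokerπ f, comp_cokerπ f, isLimitOfExact _ _ _
    (injective_of_mono f) (fun _ _ hx => (Submodule.Quotient.mk_eq_zero _).1 hx)⟩⟩

instance : IsNormalEpiCategory (QCoh A) where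
  normalEpiOfEpi f _ := ⟨⟨_, kerι f, kerι_comp f, isColimitOfExact (kerι f) f (kerι_comp f)
    (surjective_of_epi f) (fun i x hx => ⟨(⟨x, hx⟩ : LinearMap.ker (f.app i)), rfl⟩)⟩⟩

/-- The zero module. -/
def zero (A : NCScheme R I) : QCoh A where
  M _ := PUnit
  ρ _ := 0
  ρ_smul _ _ _ := rfl
  ρ_refl _ _ := rfl
  ρ_comp _ _ _ := rfl
  bijective {i j} h := by
    refine ⟨?_, fun _ => ⟨0, rfl⟩⟩
    have : ∀ x : NC.RightTensor (A.φ h : A.A j →+* A.A i) PUnit.{u + 1}, x = 0 := by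
      intro x
      induction x using NC.RightTensor.induction_on with
      | h0 => rfl
      | ht m t => exact NC.RightTensor.zero_tmul _ t
      | ha x y hx hy => rw [hx, hy, add_zero]
    intro x y _
    rw [this x, this y]

theorem prod_bijective (M N : QCoh A) {i j : I} (h : i ≤ j)
    (g : NC.RightTensor (A.φ h : A.A j →+* A.A i) (M.M j × N.M j) →+ M.M i × N.M i)
    (hg : ∀ m t, g (NC.RightTensor.tmul _ m t) = (op t • M.ρ h m.1, op t • N.ρ h m.2)) :
    Function.Bijective g := by
  have k₁ : ∀ x, (g x).1 = M.ψ h (NC.RightTensor.map _ (LinearMap.fst _ _ _) x) := by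
    intro x
    have : (AddMonoidHom.fst _ _).comp g =
        (M.ψ h).comp (NC.RightTensor.map _ (LinearMap.fst _ _ _)) := by
      refine NC.RightTensor.hom_ext _ fun m t => ?_
      rw [AddMonoidHom.comp_apply, AddMonoidHom.comp_apply, NC.RightTensor.map_tmul]
      exact congrArg Prod.fst (hg m t)
    exact DFunLike.congr_fun this x
  have k₂ : ∀ x, (g x).2 = N.ψ h (NC.RightTensor.map _ (LinearMap.snd _ _ _) x) := by
    intro x
    have : (AddMonoidHom.snd _ _).comp g =
        (N.ψ h).comp (NC.RightTensor.map _ (LinearMap.snd _ _ _)) := by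
      refine NC.RightTensor.hom_ext _ fun m t => ?_
      rw [AddMonoidHom.comp_apply, AddMonoidHom.comp_apply, NC.RightTensor.map_tmul]
      exact congrArg Prod.snd (hg m t)
    exact DFunLike.congr_fun this x
  have dec : ∀ x : NC.RightTensor (A.φ h : A.A j →+* A.A i) (M.M j × N.M j),
      NC.RightTensor.map _ (LinearMap.inl (A.A j)ᵐᵒᵖ _ _)
          (NC.RightTensor.map _ (LinearMap.fst _ _ _) x) +
        NC.RightTensor.map _ (LinearMap.inr (A.A j)ᵐᵒᵖ _ _)
          (NC.RightTensor.map _ (LinearMap.snd _ _ _) x) = x := by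
    intro x
    induction x using NC.RightTensor.induction_on with
    | h0 => simp
    | ht m t => simp [← NC.RightTensor.add_tmul]
    | ha x y hx hy =>
      rw [map_add, map_add, map_add, map_add]
      nth_rewrite 3 [← hx, ← hy]
      abel
  constructor
  · rw [injective_iff_map_eq_zero]
    intro x hx
    have h₁ : NC.RightTensor.map _ (LinearMap.fst _ _ _) x = 0 :=
      (M.bijective h).1 (((k₁ x).symm.trans (congrArg Prod.fst hx)).trans (map_zero _).symm)
    have h₂ : NC.RightTensor.map _ (LinearMap.snd _ _ _) x = 0 :=
      (N.bijective h).1 (((k₂ x).symm.trans (congrArg Prod.snd hx)).trans (map_zero _).symm)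
    rw [← dec x, h₁, h₂, map_zero, map_zero, add_zero]
  · rintro ⟨m, n⟩
    obtain ⟨x, rfl⟩ := (M.bijective h).2 m
    obtain ⟨y, rfl⟩ := (N.bijective h).2 n
    refine ⟨NC.RightTensor.map _ (LinearMap.inl (A.A j)ᵐᵒᵖ _ _) x +
      NC.RightTensor.map _ (LinearMap.inr (A.A j)ᵐᵒᵖ _ _) y, Prod.ext ?_ ?_⟩
    · rw [k₁, map_add, NC.RightTensor.map_map, NC.RightTensor.map_map,
        LinearMap.fst_comp_inl, LinearMap.fst_comp_inr, NC.RightTensor.map_zero', add_zero,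
        NC.RightTensor.map_id]
      rfl
    · rw [k₂, map_add, NC.RightTensor.map_map, NC.RightTensor.map_map,
        LinearMap.snd_comp_inl, LinearMap.snd_comp_inr, NC.RightTensor.map_zero', zero_add,
        NC.RightTensor.map_id]
      rfl

/-- The direct sum of two quasi-coherent modules, formed componentwise. -/
def prod (M N : QCoh A) : QCoh A where
  M i := M.M i × N.M i
  ρ h := (M.ρ h).prodMap (N.ρ h)
  ρ_smul h a m := Prod.ext (M.ρ_smul h a m.1) (N.ρ_smul h a m.2)
  ρ_refl i m := Prod.ext (M.ρ_refl i m.1) (N.ρ_refl i m.2)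
  ρ_comp h h' m := Prod.ext (M.ρ_comp h h' m.1) (N.ρ_comp h h' m.2)
  bijective h := prod_bijective M N h _ (fun _ _ => rfl)

instance : Limits.HasBinaryProducts (QCoh A) :=
  have (M N : QCoh A) : Limits.HasLimit (Limits.pair M N) :=
    ⟨⟨⟨Limits.BinaryFan.mk (P := prod M N)
        ⟨fun _ => LinearMap.fst _ _ _, fun _ _ => rfl⟩
        ⟨fun _ => LinearMap.snd _ _ _, fun _ _ => rfl⟩,
      Limits.BinaryFan.isLimitMk
        (fun s => ⟨fun i => (s.fst.app i).prod (s.snd.app i), fun h m => Prod.ext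
          (s.fst.comm h m) (s.snd.comm h m)⟩)
        (fun _ => rfl) (fun _ => rfl)
        (fun _ _ h₁ h₂ => hom_ext fun i x => Prod.ext
          (congrArg (fun t => Hom.app t i x) h₁) (congrArg (fun t => Hom.app t i x) h₂))⟩⟩⟩
  Limits.hasBinaryProducts_of_hasLimit_pair _

instance : Limits.HasTerminal (QCoh A) :=
  (Limits.IsTerminal.ofUniqueHom (Y := zero A) (fun _ => 0)
    (fun _ _ => hom_ext fun _ _ => rfl)).hasTerminal

instance : Limits.HasFiniteProducts (QCoh A) :=
  hasFiniteProducts_of_has_binary_and_terminal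

noncomputable instance : Abelian (QCoh A) where

end QCoh

/-! ### Locally free modules and vanishing of Ext groups -/

namespace QCoh

variable {R : Type u} [CommRing R] {I : Type w} [SemilatticeInf I] {A : NCScheme R I}

/-- `F` is locally free of rank `r`: every `F_i` is a free right `A_i`-module of rank `r`. -/
def IsLocallyFreeOfRank (F : QCoh A) (r : ℕ) : Prop :=
  ∀ i, Nonempty (F.M i ≃ₗ[(A.A i)ᵐᵒᵖ] (Fin r → A.A i))

/-- `F` is locally free (of some finite rank). -/
def IsLocallyFree (F : QCoh A) : Prop := ∃ r, F.IsLocallyFreeOfRank r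

end QCoh

/-- `Ext^p(M, N) = 0` in the abelian category `C`. -/
def ExtVanishes {C : Type v} [Category.{w} C] [Abelian C] (M N : C) (p : ℕ) : Prop :=
  letI : HasExt.{max v w} C := HasExt.standard C
  Subsingleton (Abelian.Ext M N p)

/-! ### NC deformations -/

/-- A covering of `X` by affine open subsets `U_i`, indexed by a partially ordered set `I` in which
any two elements have a minimum, with `U_i ∩ U_j = U_{min(i, j)}`; in particular `U_i ⊆ U_j` for
`i ≤ j`. -/
structure AffineMeetCover (X : Scheme.{u}) (I : Type w) [SemilatticeInf I] where
  U : I → X.Opens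
  isAffine : ∀ i, IsAffineOpen (U i)
  inf : ∀ i j, U (i ⊓ j) = U i ⊓ U j
  cover : ⨆ i, U i = ⊤

theorem AffineMeetCover.mono {X : Scheme.{u}} {I : Type w} [SemilatticeInf I]
    (𝒰 : AffineMeetCover X I) {i j : I} (h : i ≤ j) : 𝒰.U i ≤ 𝒰.U j := by
  have := 𝒰.inf i j
  rw [inf_eq_left.2 h] at this
  exact this.le.trans inf_le_right

/-- The structure homomorphism `k → Γ(X, U)` of a scheme over `k`. -/
noncomputable def sectionsBase {k : Type u} [Field k] {X : Scheme.{u}}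
    (f : X ⟶ Spec (.of k)) (U : X.Opens) : k →+* Γ(X, U) :=
  ((Scheme.ΓSpecIso (.of k)).inv ≫ f.appLE ⊤ U le_top).hom

/-- An NC deformation over the local `k`-algebra `R` of the `k`-scheme `X`, with respect to a
covering of `X` by affine open subsets `U_i = Spec A_i⁰`, `A_i⁰ = Γ(X, U_i)`: an NC scheme
`(A_i, φ_{ij})` consisting of flat `R`-algebras and `R`-homomorphisms, with isomorphisms of
`k`-algebras `α_i : R/𝔪 ⊗_R A_i ≅ A_i⁰` that are compatible with the `φ_{ij}` and the restriction
homomorphisms. -/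
structure NCDeformation {k : Type u} [Field k] {X : Scheme.{u}} (f : X ⟶ Spec (.of k))
    {I : Type w} [SemilatticeInf I] (𝒰 : AffineMeetCover X I)
    (R : Type u) [CommRing R] [IsLocalRing R] [Algebra k R] extends NCScheme R I where
  flat_base : ∀ i, Module.Flat R (A i)
  α : ∀ i, (IsLocalRing.ResidueField R ⊗[R] A i) ≃+* Γ(X, 𝒰.U i)
  α_base : ∀ i (c : k), α i (algebraMap k (IsLocalRing.ResidueField R) c ⊗ₜ[R] 1) =
    sectionsBase f (𝒰.U i) c
  α_comm : ∀ {i j : I} (h : i ≤ j) (x : IsLocalRing.ResidueField R ⊗[R] A j),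
    α i (Algebra.TensorProduct.map (AlgHom.id R (IsLocalRing.ResidueField R)) (φ h) x) =
      X.presheaf.map (homOfLE (𝒰.mono h)).op (α j x)

section Reduction

variable {k : Type u} [Field k] {X : Scheme.{u}} {f : X ⟶ Spec (.of k)}
  {I : Type w} [SemilatticeInf I] {𝒰 : AffineMeetCover X I}
  {R : Type u} [CommRing R] [IsLocalRing R] [Algebra k R]

/-- The sheaf of modules `F⁰` on `X` is locally free of rank `r`, with all the `U_i` as trivializing
open subsets. -/
def IsLocallyFreeOn (𝒰 : AffineMeetCover X I) (F₀ : X.Modules) (r : ℕ) : Prop :=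
  ∀ i, Nonempty (F₀.restrict (𝒰.U i).ι ≅
    (SheafOfModules.free (ULift.{u} (Fin r)) : (𝒰.U i).toScheme.Modules))

/-- An isomorphism `θ : R/𝔪 ⊗_R F ≅ F⁰` of a quasi-coherent module `F` on an NC deformation of `X`
reduced modulo `𝔪` with a sheaf of modules `F⁰` on `X`: isomorphisms
`θ_i : R/𝔪 ⊗_R F_i ≅ Γ(U_i, F⁰)` of modules over `α_i : R/𝔪 ⊗_R A_i ≅ A_i⁰`, compatible with the
gluing of `F` and the restriction of sections of `F⁰`. -/
structure ReductionIso (D : NCDeformation f 𝒰 R) (F : QCoh D.toNCScheme) (F₀ : X.Modules) where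
  θ : ∀ i, (IsLocalRing.ResidueField R ⊗[R] F.M i) ≃+ Γ(F₀, 𝒰.U i)
  θ_smul : ∀ i (c d : IsLocalRing.ResidueField R) (m : F.M i) (a : D.A i),
    θ i ((c * d) ⊗ₜ[R] (op a • m)) = D.α i (d ⊗ₜ[R] a) • θ i (c ⊗ₜ[R] m)
  θ_comm : ∀ {i j : I} (h : i ≤ j) (x : IsLocalRing.ResidueField R ⊗[R] F.M j),
    θ i ((F.ρLin h).lTensor (IsLocalRing.ResidueField R) x) =
      F₀.presheaf.map (homOfLE (𝒰.mono h)).op (θ j x)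

end Reduction

/-!
# Lifting pretilting bundles to NC deformations

The bundle `F₀` is lifted along a composition series of `R`, and everything about the lift `F` is
then deduced from the vanishing of one kind of cohomology. The argument takes place in the category
of *presheaves* of right modules on the NC scheme (`PreQCoh`), where the conditions on the gluing
maps are dropped. Its advantage is that it contains both the quasi-coherent modules on `A` and,
through `A_i → Γ(U_i, 𝒪)`, the families of sections `Γ(U_i, N)` of the sheaves of modules `N` on `X`
(`NCDeformation.sections`), and that all kernels and quotients are formed componentwise.

**Cohomology.** Let `J V` be the presheaf `j ↦ ∏_t V_{c t ∧ j}`, where `c t` runs through the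
indices of the covering, and let `K V` be the cokernel of the embedding `V → J V`. For a vector
bundle `P` the functor `Hom(P, J -)` is exact (`PreQCoh.Bundle.homSurj_J`), so that the resolution
`V → J V → J (K V) → ⋯` computes derived functors of `Hom(P, -)`. `PreQCoh.Acyclic c P V` says that
the higher ones vanish at `V`; the parts of the long exact sequences that are needed are proved by
diagram chases.

**Comparison on `X`.** The groups `Ext^p(F₀, N)` are taken in the category of all sheaves of
modules. Every sheaf of modules embeds in an injective one of the form `U ↦ ∏_{x ∈ U} T_x`
(`SheafGodement.exists_embedding`), whose presheaf of sections is a retract of its `J`. To shift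
dimensions, sections over the `U_i` have to lift along epimorphisms whose kernel is one of the
cosyzygies of `F₀`. This uses no theory of quasi-coherent sheaves: it suffices that sections over
`D(g) ∩ D(1 - g)` are differences of sections over `D(g)` and `D(1 - g)`, a property that holds for
`F₀` and passes to the cosyzygies (`SectionsSplit`). Hence a pretilting `F₀` is acyclic
(`NCDeformation.acyclic_sections`).

**Existence.** For ideals `𝔟 ⊆ 𝔞` of `R` with `𝔞 / 𝔟 ≅ R / 𝔪`, a lift of `F₀` to a vector bundle
modulo `𝔞` lifts to one modulo `𝔟`, because locally it does and the obstruction lies in the second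
cohomology of `F₀` (`PreQCoh.Bundle.exists_lift_step`). As `R` is Artinian, this yields a vector
bundle on `A` (`PreQCoh.Bundle.exists_lift`), which is quasi-coherent.

**The properties of the lift.** The filtration of a flat lift `F` by the `𝔞 F` has subquotients
`F₀`, so that all `𝔞 F` are acyclic (`PreQCoh.IsReduction.acyclic_idealSub`). Therefore
homomorphisms lift along `F → F₀`, which gives the uniqueness of `F` and the surjectivity of `End F
→ End F₀`, and `Hom(F, 𝔞 F) = 𝔞 End F` (`QCoh.mem_of_app_mem`), which gives the kernel `𝔪 End F` of
that map and the flatness of `End F` over `R`.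

**Ext groups on `A`.** The covering satisfies base change, `A_{i ∧ j} ⊗_{A_j} A_l ≅ A_{i ∧ l}` for
`l ≤ j`: this holds modulo `𝔪` by the intersection property of affine open subsets, and it lifts by
flatness (`NCDeformation.meetBaseChange`). So right `A_i`-modules have quasi-coherent direct images
`j ↦ N ⊗_{A_i} A_{i ∧ j}`, and every quasi-coherent module embeds in a finite sum of direct images
of injective modules, which is both injective and a retract of its `J`. Shifting dimensions,
acyclicity implies the vanishing of the groups `Ext^p(F, F)` (`QCoh.extVanishes_of_acyclic`).
-/

/-! ### Presheaves of modules on an NC scheme -/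

/-- A presheaf of right modules on an NC scheme `A`: the data of a quasi-coherent module, without
the condition that the gluing maps `M_j ⊗ A_i → M_i` are bijective. -/
structure PreQCoh {R : Type u} [CommRing R] {I : Type w} [SemilatticeInf I] (A : NCScheme R I) where
  /-- the right `A_i`-modules `M_i` -/
  M : I → Type u
  [addCommGroup : ∀ i, AddCommGroup (M i)]
  [moduleBase : ∀ i, Module R (M i)]
  [module : ∀ i, Module (A.A i)ᵐᵒᵖ (M i)]
  [tower : ∀ i, IsScalarTower R (A.A i)ᵐᵒᵖ (M i)]
  /-- the restriction maps `M_j → M_i` for `i ≤ j` -/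
  ρ : ∀ {i j : I}, i ≤ j → M j →+ M i
  ρ_smul : ∀ {i j : I} (h : i ≤ j) (a : A.A j) (m : M j), ρ h (op a • m) = op (A.φ h a) • ρ h m
  ρ_refl : ∀ (i : I) (m : M i), ρ (le_refl i) m = m
  ρ_comp : ∀ {i j l : I} (hij : i ≤ j) (hjl : j ≤ l) (m : M l),
    ρ hij (ρ hjl m) = ρ (hij.trans hjl) m

attribute [instance] PreQCoh.addCommGroup PreQCoh.moduleBase PreQCoh.module PreQCoh.tower

namespace PreQCoh

variable {R : Type u} [CommRing R] {I : Type w} [SemilatticeInf I] {A : NCScheme R I}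

/-- Homomorphisms of presheaves of modules. -/
structure Hom (M N : PreQCoh A) where
  app : ∀ i, M.M i →ₗ[(A.A i)ᵐᵒᵖ] N.M i
  comm : ∀ {i j : I} (h : i ≤ j) (m : M.M j), app i (M.ρ h m) = N.ρ h (app j m)

theorem ρ_base (M : PreQCoh A) {i j : I} (h : i ≤ j) (r : R) (m : M.M j) :
    M.ρ h (r • m) = r • M.ρ h m := by
  rw [← algebraMap_smul (A.A j)ᵐᵒᵖ r m, ← algebraMap_smul (A.A i)ᵐᵒᵖ r (M.ρ h m)]
  rw [MulOpposite.algebraMap_apply, MulOpposite.algebraMap_apply, M.ρ_smul, AlgHom.commutes]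

instance smulCommClassBase (M : PreQCoh A) (i : I) : SMulCommClass R (A.A i)ᵐᵒᵖ (M.M i) :=
  IsScalarTower.to_smulCommClass

instance smulCommClassBase' (M : PreQCoh A) (i : I) : SMulCommClass (A.A i)ᵐᵒᵖ R (M.M i) :=
  SMulCommClass.symm _ _ _

theorem Hom.app_base {M N : PreQCoh A} (f : Hom M N) (i : I) (r : R) (m : M.M i) :
    f.app i (r • m) = r • f.app i m := LinearMap.map_smul_of_tower _ _ _

/-- The identity. -/
def Hom.id (M : PreQCoh A) : Hom M M := ⟨fun _ => LinearMap.id, fun _ _ => rfl⟩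

/-- The composite `g ∘ f`. -/
def Hom.comp {M N P : PreQCoh A} (g : Hom N P) (f : Hom M N) : Hom M P :=
  ⟨fun i => (g.app i).comp (f.app i), fun h m => by simp [f.comm, g.comm]⟩

instance (M N : PreQCoh A) : Add (Hom M N) :=
  ⟨fun f g => ⟨fun i => f.app i + g.app i, fun h m => by simp [f.comm, g.comm]⟩⟩

instance (M N : PreQCoh A) : Sub (Hom M N) :=
  ⟨fun f g => ⟨fun i => f.app i - g.app i, fun h m => by simp [f.comm, g.comm]⟩⟩

@[simp] theorem Hom.id_app (M : PreQCoh A) (i : I) (m : M.M i) : (Hom.id M).app i m = m := rfl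
@[simp] theorem Hom.comp_app {M N P : PreQCoh A} (g : Hom N P) (f : Hom M N) (i : I) (m : M.M i) :
    (g.comp f).app i m = g.app i (f.app i m) := rfl
@[simp] theorem Hom.add_app {M N : PreQCoh A} (f g : Hom M N) (i : I) (m : M.M i) :
    (f + g).app i m = f.app i m + g.app i m := rfl
@[simp] theorem Hom.sub_app {M N : PreQCoh A} (f g : Hom M N) (i : I) (m : M.M i) :
    (f - g).app i m = f.app i m - g.app i m := rfl

/-- A subpresheaf, given by submodules that are stable under restriction. -/
@[reducible] def sub (V : PreQCoh A) (N : ∀ i, Submodule (A.A i)ᵐᵒᵖ (V.M i))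
    (hN : ∀ {i j : I} (h : i ≤ j) (m : V.M j), m ∈ N j → V.ρ h m ∈ N i) : PreQCoh A where
  M i := N i
  ρ {i j} h := ((V.ρ h).comp (N j).subtype.toAddMonoidHom).codRestrict
    (N i).toAddSubgroup (fun m => hN h _ m.2)
  ρ_smul h a m := Subtype.ext (V.ρ_smul h a m)
  ρ_refl i m := Subtype.ext (V.ρ_refl i m)
  ρ_comp h h' m := Subtype.ext (V.ρ_comp h h' m)

/-- The inclusion of a subpresheaf. -/
def subι (V : PreQCoh A) (N : ∀ i, Submodule (A.A i)ᵐᵒᵖ (V.M i))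
    (hN : ∀ {i j : I} (h : i ≤ j) (m : V.M j), m ∈ N j → V.ρ h m ∈ N i) : Hom (V.sub N hN) V :=
  ⟨fun i => (N i).subtype, fun _ _ => rfl⟩

/-- The quotient by a subpresheaf. -/
@[reducible] def quot (V : PreQCoh A) (N : ∀ i, Submodule (A.A i)ᵐᵒᵖ (V.M i))
    (hN : ∀ {i j : I} (h : i ≤ j) (m : V.M j), m ∈ N j → V.ρ h m ∈ N i) : PreQCoh A where
  M i := V.M i ⧸ N i
  ρ {i j} h := QuotientAddGroup.map (N j).toAddSubgroup (N i).toAddSubgroup (V.ρ h)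
    (fun m hm => hN h m hm)
  ρ_smul h a m := by
    obtain ⟨m, rfl⟩ := Submodule.Quotient.mk_surjective _ m
    exact congrArg Submodule.Quotient.mk (V.ρ_smul h a m)
  ρ_refl i m := by
    obtain ⟨m, rfl⟩ := Submodule.Quotient.mk_surjective _ m
    exact congrArg (Submodule.Quotient.mk) (V.ρ_refl i m)
  ρ_comp h h' m := by
    obtain ⟨m, rfl⟩ := Submodule.Quotient.mk_surjective _ m
    exact congrArg (Submodule.Quotient.mk) (V.ρ_comp h h' m)

/-- The projection to the quotient by a subpresheaf. -/
def quotπ (V : PreQCoh A) (N : ∀ i, Submodule (A.A i)ᵐᵒᵖ (V.M i))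
    (hN : ∀ {i j : I} (h : i ≤ j) (m : V.M j), m ∈ N j → V.ρ h m ∈ N i) : Hom V (V.quot N hN) :=
  ⟨fun i => (N i).mkQ, fun _ _ => rfl⟩

/-- Factorization through a surjective homomorphism. -/
theorem exists_desc {V W Z : PreQCoh A} (f : Hom V W) (hf : ∀ i, Function.Surjective (f.app i))
    (g : Hom V Z) (hg : ∀ i x, f.app i x = 0 → g.app i x = 0) :
    ∃ h : Hom W Z, ∀ i x, h.app i (f.app i x) = g.app i x := by
  let H : ∀ i, W.M i →ₗ[(A.A i)ᵐᵒᵖ] Z.M i := fun i =>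
    ((LinearMap.ker (f.app i)).liftQ (g.app i) (hg i)).comp
      (LinearMap.quotKerEquivOfSurjective (f.app i) (hf i)).symm.toLinearMap
  have e : ∀ i x, H i (f.app i x) = g.app i x := by
    intro i x
    have : (LinearMap.quotKerEquivOfSurjective (f.app i) (hf i)).symm (f.app i x) =
        (LinearMap.ker (f.app i)).mkQ x := by
      rw [LinearEquiv.symm_apply_eq]; rfl
    change ((LinearMap.ker (f.app i)).liftQ (g.app i) (hg i))
      ((LinearMap.quotKerEquivOfSurjective (f.app i) (hf i)).symm (f.app i x)) = _
    rw [this]; rfl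
  refine ⟨⟨H, fun {i j} h x => ?_⟩, e⟩
  obtain ⟨x, rfl⟩ := hf j x
  rw [← f.comm, e, e, g.comm]

/-- Factorization through an injective homomorphism. -/
theorem exists_lift {V W P : PreQCoh A} (f : Hom V W) (hf : ∀ i, Function.Injective (f.app i))
    (g : Hom P W) (hg : ∀ i x, ∃ y, f.app i y = g.app i x) :
    ∃ h : Hom P V, ∀ i x, f.app i (h.app i x) = g.app i x := by
  let H : ∀ i, P.M i →ₗ[(A.A i)ᵐᵒᵖ] V.M i := fun i =>
    (LinearEquiv.ofInjective (f.app i) (hf i)).symm.toLinearMap.comp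
      ((g.app i).codRestrict _ (hg i))
  have e : ∀ i x, f.app i (H i x) = g.app i x := fun i x =>
    congrArg Subtype.val ((LinearEquiv.ofInjective (f.app i) (hf i)).apply_symm_apply
      ((g.app i).codRestrict _ (hg i) x))
  refine ⟨⟨H, fun {i j} h x => hf i ?_⟩, e⟩
  rw [e, f.comm, e, g.comm]

/-- Componentwise exactness of `0 → V' → V → V'' → 0`. -/
structure ShortExact {V' V V'' : PreQCoh A} (f : Hom V' V) (g : Hom V V'') : Prop where
  inj : ∀ i, Function.Injective (f.app i)
  surj : ∀ i, Function.Surjective (g.app i)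
  zero : ∀ i x, g.app i (f.app i x) = 0
  exact : ∀ i x, g.app i x = 0 → ∃ y, f.app i y = x

/-- `Hom(P, V) → Hom(P, V'')` is surjective. -/
def HomSurj (P : PreQCoh A) {V V'' : PreQCoh A} (g : Hom V V'') : Prop :=
  ∀ t : Hom P V'', ∃ s : Hom P V, ∀ i x, g.app i (s.app i x) = t.app i x

/-! ### The Godement-type functors of a family of indices

For a family `c : ι → I` of indices, `J V` is the product over `t : ι` of the presheaves
`j ↦ V_{c t ⊓ j}`. If `c` is surjective, `V` embeds in `J V`; the cokernel is `K V`. -/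

section Godement

variable {ι : Type} (c : ι → I)

/-- The component `∏_t V_{c t ⊓ j}` of `J V`. -/
def JObj (V : PreQCoh A) (j : I) : Type u := ∀ t, V.M (c t ⊓ j)

instance (V : PreQCoh A) (j : I) : AddCommGroup (JObj c V j) :=
  inferInstanceAs (AddCommGroup (∀ t, V.M (c t ⊓ j)))

instance (V : PreQCoh A) (j : I) : Module R (JObj c V j) :=
  inferInstanceAs (Module R (∀ t, V.M (c t ⊓ j)))

instance (V : PreQCoh A) (j : I) : SMul (A.A j)ᵐᵒᵖ (JObj c V j) :=
  ⟨fun a m t => op (A.φ (inf_le_right : c t ⊓ j ≤ j) a.unop) • m t⟩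

theorem JObj_smul (V : PreQCoh A) (j : I) (a : (A.A j)ᵐᵒᵖ) (m : JObj c V j) (t : ι) :
    (a • m) t = op (A.φ (inf_le_right : c t ⊓ j ≤ j) a.unop) • m t := rfl

theorem JObj_add (V : PreQCoh A) (j : I) (m n : JObj c V j) (t : ι) :
    (m + n) t = m t + n t := rfl

instance (V : PreQCoh A) (j : I) : Module (A.A j)ᵐᵒᵖ (JObj c V j) where
  one_smul m := funext fun t => by rw [JObj_smul]; simp
  mul_smul a b m := funext fun t => by
    rw [JObj_smul, JObj_smul, JObj_smul, smul_smul]; simp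
  smul_zero a := funext fun t => smul_zero (A := V.M (c t ⊓ j)) _
  smul_add a m n := funext fun t => smul_add (A := V.M (c t ⊓ j)) _ _ _
  add_smul a b m := funext fun t => by
    rw [JObj_smul, JObj_add, JObj_smul, JObj_smul]; simp [add_smul]
  zero_smul m := funext fun t => by
    rw [JObj_smul]
    simp only [unop_zero, map_zero, op_zero, zero_smul]
    rfl

instance (V : PreQCoh A) (j : I) : IsScalarTower R (A.A j)ᵐᵒᵖ (JObj c V j) where
  smul_assoc r a m := funext fun t => by
    change (((r • a) • m : JObj c V j)) t = r • ((a • m : JObj c V j) t)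
    rw [JObj_smul, JObj_smul, MulOpposite.unop_smul, map_smul, MulOpposite.op_smul, smul_assoc]

/-- The presheaf `J V`. -/
@[reducible] def J (V : PreQCoh A) : PreQCoh A where
  M j := JObj c V j
  ρ {i j} h := AddMonoidHom.mk' (fun m t => V.ρ (inf_le_inf_left (c t) h) (m t))
    (fun m n => funext fun t => map_add (V.ρ (inf_le_inf_left (c t) h)) (m t) (n t))
  ρ_smul {i j} h a m := funext fun t => by
    change V.ρ (inf_le_inf_left (c t) h) ((op a • m : JObj c V j) t) =
      op (A.φ (inf_le_right : c t ⊓ i ≤ i) (A.φ h a)) • V.ρ (inf_le_inf_left (c t) h) (m t)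
    rw [JObj_smul, V.ρ_smul, unop_op, A.φ_comp, A.φ_comp]
  ρ_refl i m := funext fun t => V.ρ_refl _ _
  ρ_comp h h' m := funext fun t => V.ρ_comp _ _ _

theorem J_ρ (V : PreQCoh A) {i j : I} (h : i ≤ j) (m : (J c V).M j) (t : ι) :
    (J c V).ρ h m t = V.ρ (inf_le_inf_left (c t) h) (m t) := rfl

/-- The map `J f`. -/
def Jmap {V W : PreQCoh A} (f : Hom V W) : Hom (J c V) (J c W) where
  app j :=
    { toFun := fun m t => f.app _ (m t)
      map_add' := fun m n => funext fun t => map_add (f.app (c t ⊓ j)) (m t) (n t)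
      map_smul' := fun _ m => funext fun t => map_smul (f.app (c t ⊓ j)) _ (m t) }
  comm _ _ := funext fun _ => f.comm _ _

/-- The natural map `V → J V`. -/
def η (V : PreQCoh A) : Hom V (J c V) where
  app j :=
    { toFun := fun m t => V.ρ inf_le_right m
      map_add' := fun m n => funext fun t => map_add (V.ρ (inf_le_right : c t ⊓ j ≤ j)) m n
      map_smul' := fun a m => funext fun _ => V.ρ_smul _ a.unop m }
  comm _ _ := funext fun _ => by
    change V.ρ _ (V.ρ _ _) = V.ρ _ (V.ρ _ _)
    rw [V.ρ_comp, V.ρ_comp]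

@[simp] theorem η_app (V : PreQCoh A) (j : I) (m : V.M j) (t : ι) :
    (η c V).app j m t = V.ρ (inf_le_right : c t ⊓ j ≤ j) m := rfl

theorem η_natural {V W : PreQCoh A} (f : Hom V W) (j : I) (m : V.M j) :
    (Jmap c f).app j ((η c V).app j m) = (η c W).app j (f.app j m) :=
  funext fun _ => f.comm _ _

theorem η_range_stable (V : PreQCoh A) {i j : I} (h : i ≤ j) (m : (J c V).M j)
    (hm : m ∈ LinearMap.range ((η c V).app j)) :
    (J c V).ρ h m ∈ LinearMap.range ((η c V).app i) := by
  obtain ⟨m, rfl⟩ := hm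
  exact ⟨V.ρ h m, (η c V).comm h m⟩

/-- The cokernel `K V` of `V → J V`. -/
@[reducible] def K (V : PreQCoh A) : PreQCoh A :=
  (J c V).quot (fun i => LinearMap.range ((η c V).app i)) (η_range_stable c V)

/-- The projection `J V → K V`. -/
def Kπ (V : PreQCoh A) : Hom (J c V) (K c V) :=
  (J c V).quotπ (fun i => LinearMap.range ((η c V).app i)) (η_range_stable c V)

theorem Kπ_surjective (V : PreQCoh A) (j : I) : Function.Surjective ((Kπ c V).app j) :=
  Submodule.mkQ_surjective _

theorem Kπ_eq_zero (V : PreQCoh A) (j : I) (x : (J c V).M j) :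
    (Kπ c V).app j x = 0 ↔ ∃ m, (η c V).app j m = x :=
  Submodule.Quotient.mk_eq_zero _

@[simp] theorem Kπ_η (V : PreQCoh A) (j : I) (m : V.M j) :
    (Kπ c V).app j ((η c V).app j m) = 0 := (Kπ_eq_zero c V j _).2 ⟨m, rfl⟩

/-- The map `K f`. -/
def Kmap {V W : PreQCoh A} (f : Hom V W) : Hom (K c V) (K c W) where
  app j := Submodule.mapQ _ _ ((Jmap c f).app j) (by
    rintro _ ⟨m, rfl⟩
    exact ⟨f.app j m, (η_natural c f j m).symm⟩)
  comm {i j} h m := by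
    obtain ⟨m, rfl⟩ := Submodule.Quotient.mk_surjective _ m
    exact congrArg ((Kπ c W).app i) ((Jmap c f).comm h m)

@[simp] theorem Kmap_π {V W : PreQCoh A} (f : Hom V W) (j : I) (x : (J c V).M j) :
    (Kmap c f).app j ((Kπ c V).app j x) = (Kπ c W).app j ((Jmap c f).app j x) := rfl

variable {c}

theorem η_injective (hc : Function.Surjective c) (V : PreQCoh A) (j : I) :
    Function.Injective ((η c V).app j) := by
  rw [injective_iff_map_eq_zero]
  intro m hm
  obtain ⟨t, rfl⟩ := hc j
  have h := congrFun hm t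
  have h2 : V.ρ (le_inf le_rfl le_rfl : c t ≤ c t ⊓ c t)
      (V.ρ (inf_le_right : c t ⊓ c t ≤ c t) m) = 0 := by
    rw [← η_app c V (c t) m t, h]; exact map_zero _
  rwa [V.ρ_comp, V.ρ_refl] at h2

theorem ShortExact.J {V' V V'' : PreQCoh A} {f : Hom V' V} {g : Hom V V''} (h : ShortExact f g) :
    ShortExact (Jmap c f) (Jmap c g) where
  inj j x y hxy := funext fun t => h.inj _ (congrFun hxy t)
  surj j x := by
    choose y hy using fun t => h.surj _ (x t)
    exact ⟨y, funext hy⟩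
  zero j x := funext fun t => h.zero _ _
  exact j x hx := by
    choose y hy using fun t => h.exact _ (x t) (congrFun hx t)
    exact ⟨y, funext hy⟩

/-- Exactness of `K` follows from that of `J` by the snake lemma, since `V → J V` is injective. -/
theorem ShortExact.K (hc : Function.Surjective c) {V' V V'' : PreQCoh A} {f : Hom V' V}
    {g : Hom V V''} (h : ShortExact f g) : ShortExact (Kmap c f) (Kmap c g) where
  inj j := by
    rw [injective_iff_map_eq_zero]
    intro x hx
    obtain ⟨x, rfl⟩ := Kπ_surjective c _ _ x
    rw [Kmap_π, Kπ_eq_zero] at hx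
    obtain ⟨m, hm⟩ := hx
    have h0 : g.app j m = 0 := by
      apply η_injective hc V'' j
      rw [← η_natural, hm, h.J.zero, map_zero]
    obtain ⟨m', rfl⟩ := h.exact j m h0
    rw [← η_natural] at hm
    rw [Kπ_eq_zero]
    exact ⟨m', h.J.inj j hm⟩
  surj j x := by
    obtain ⟨x, rfl⟩ := Kπ_surjective c _ _ x
    obtain ⟨y, rfl⟩ := h.J.surj j x
    exact ⟨_, Kmap_π c g j y⟩
  zero j x := by
    obtain ⟨x, rfl⟩ := Kπ_surjective c _ _ x
    rw [Kmap_π, Kmap_π, h.J.zero, map_zero]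
  exact j x hx := by
    obtain ⟨x, rfl⟩ := Kπ_surjective c _ _ x
    rw [Kmap_π, Kπ_eq_zero] at hx
    obtain ⟨m, hm⟩ := hx
    obtain ⟨m, rfl⟩ := h.surj j m
    obtain ⟨y, hy⟩ := h.J.exact j (x - (η c V).app j m) (by
      rw [map_sub, η_natural, hm, sub_self])
    refine ⟨(Kπ c V').app j y, ?_⟩
    rw [Kmap_π, hy, map_sub, Kπ_η, sub_zero]

/-- The first cohomology of `V` with respect to `P`, computed by `J`, vanishes: every
homomorphism `P → K V` lifts to `J V`. -/
def FirstVanish (c : ι → I) (P V : PreQCoh A) : Prop := HomSurj P (Kπ c V)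

/-! ### Long exact sequence arguments -/

section Chase

variable (hc : Function.Surjective c) {P V' V V'' : PreQCoh A} {f : Hom V' V} {g : Hom V V''}
include hc

/-- The part `Hom(P, V) → Hom(P, V'') → H¹(V')` of the long exact sequence. -/
theorem ShortExact.homSurj (h : ShortExact f g) (hJ : HomSurj P (Jmap c g))
    (h' : FirstVanish c P V') : HomSurj P g := by
  intro t
  obtain ⟨e, he⟩ := hJ ((η c V'').comp t)
  obtain ⟨x, hx⟩ := exists_lift (Kmap c f) (h.K hc).inj ((Kπ c V).comp e) (fun i p => by
    refine (h.K hc).exact i _ ?_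
    rw [Hom.comp_app, Kmap_π, he, Hom.comp_app, Kπ_η])
  obtain ⟨y, hy⟩ := h' x
  obtain ⟨s, hs⟩ := exists_lift (η c V) (η_injective hc V) (e - (Jmap c f).comp y) (fun i p => by
    rw [← Kπ_eq_zero, Hom.sub_app, map_sub, Hom.comp_app, ← Kmap_π, hy, hx, Hom.comp_app,
      sub_self])
  refine ⟨s, fun i p => η_injective hc V'' i ?_⟩
  rw [← η_natural, hs, Hom.sub_app, map_sub, Hom.comp_app, h.J.zero, sub_zero, he, Hom.comp_app]

/-- The part `H¹(V') → H¹(V) → H¹(V'')` of the long exact sequence. -/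
theorem ShortExact.firstVanish_mid (h : ShortExact f g) (hJ : HomSurj P (Jmap c g))
    (h' : FirstVanish c P V') (h'' : FirstVanish c P V'') : FirstVanish c P V := by
  intro t
  obtain ⟨y'', hy''⟩ := h'' ((Kmap c g).comp t)
  obtain ⟨y, hy⟩ := hJ y''
  obtain ⟨x, hx⟩ := exists_lift (Kmap c f) (h.K hc).inj (t - (Kπ c V).comp y) (fun i p => by
    refine (h.K hc).exact i _ ?_
    rw [Hom.sub_app, map_sub, Hom.comp_app, Kmap_π, hy, hy'', Hom.comp_app, sub_self])
  obtain ⟨z, hz⟩ := h' x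
  refine ⟨y + (Jmap c f).comp z, fun i p => ?_⟩
  rw [Hom.add_app, map_add, Hom.comp_app, ← Kmap_π, hz, hx, Hom.sub_app, Hom.comp_app,
    add_sub_cancel]

/-- The part `Hom(P, V) → Hom(P, V'') → H¹(V') → H¹(V)` of the long exact sequence. -/
theorem ShortExact.firstVanish_left (h : ShortExact f g) (hg : HomSurj P g)
    (hV : FirstVanish c P V) : FirstVanish c P V' := by
  intro t
  obtain ⟨e, he⟩ := hV ((Kmap c f).comp t)
  obtain ⟨u, hu⟩ := exists_lift (η c V'') (η_injective hc V'') ((Jmap c g).comp e) (fun i p => by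
    rw [← Kπ_eq_zero, Hom.comp_app, ← Kmap_π, he, Hom.comp_app, (h.K hc).zero])
  obtain ⟨v, hv⟩ := hg u
  obtain ⟨y, hy⟩ := exists_lift (Jmap c f) h.J.inj (e - (η c V).comp v) (fun i p => by
    refine h.J.exact i _ ?_
    rw [Hom.sub_app, map_sub, Hom.comp_app, η_natural, hv, hu, Hom.comp_app, sub_self])
  refine ⟨y, fun i p => (h.K hc).inj i ?_⟩
  rw [Kmap_π, hy, Hom.sub_app, map_sub, Hom.comp_app, Kπ_η, sub_zero, he, Hom.comp_app]

omit hc in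
/-- The part `H¹(V) → H¹(V'') → H²(V')` of the long exact sequence; the vanishing of `H²(V')` enters
through the lifting property `hK`. -/
theorem firstVanish_right (hK : HomSurj P (Kmap c g)) (hV : FirstVanish c P V) :
    FirstVanish c P V'' := by
  intro t
  obtain ⟨s, hs⟩ := hK t
  obtain ⟨y, hy⟩ := hV s
  exact ⟨(Jmap c g).comp y, fun i p => by rw [Hom.comp_app, ← Kmap_π, hy, hs]⟩

end Chase

/-- The iterates of `K`. -/
def Kpow (c : ι → I) : ℕ → PreQCoh A → PreQCoh A
  | 0, V => V
  | n + 1, V => K c (Kpow c n V)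

/-- The map `Kⁿ f`. -/
def KpowMap (c : ι → I) {V W : PreQCoh A} (f : Hom V W) : ∀ n, Hom (Kpow c n V) (Kpow c n W)
  | 0 => f
  | n + 1 => Kmap c (KpowMap c f n)

theorem ShortExact.Kpow (hc : Function.Surjective c) {V' V V'' : PreQCoh A} {f : Hom V' V}
    {g : Hom V V''} (h : ShortExact f g) : ∀ n, ShortExact (KpowMap c f n) (KpowMap c g n)
  | 0 => h
  | n + 1 => (h.Kpow hc n).K hc

/-- All higher cohomology of `V` with respect to `P`, computed by the resolution
`V → J V → J (K V) → J (K (K V)) → ⋯`, vanishes. -/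
def Acyclic (c : ι → I) (P V : PreQCoh A) : Prop := ∀ n, FirstVanish c P (Kpow c n V)

/-- `V` is relatively injective: `V → J V` has a retraction. -/
def RelInj (c : ι → I) (V : PreQCoh A) : Prop :=
  ∃ ξ : Hom (J c V) V, ∀ i m, ξ.app i ((η c V).app i m) = m

theorem RelInj.exists_section {V : PreQCoh A} (h : RelInj c V) :
    ∃ σ : Hom (K c V) (J c V), ∀ i x, (Kπ c V).app i (σ.app i x) = x := by
  obtain ⟨ξ, hξ⟩ := h
  obtain ⟨σ, hσ⟩ := exists_desc (Kπ c V) (Kπ_surjective c V)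
    (Hom.id _ - (η c V).comp ξ) (fun i x hx => by
      obtain ⟨m, rfl⟩ := (Kπ_eq_zero c V i x).1 hx
      rw [Hom.sub_app, Hom.comp_app, hξ, Hom.id_app, sub_self])
  refine ⟨σ, fun i x => ?_⟩
  obtain ⟨x, rfl⟩ := Kπ_surjective c V i x
  rw [hσ, Hom.sub_app, map_sub, Hom.comp_app, Kπ_η, sub_zero, Hom.id_app]

theorem RelInj.firstVanish {V : PreQCoh A} (h : RelInj c V) (P : PreQCoh A) :
    FirstVanish c P V := by
  obtain ⟨σ, hσ⟩ := h.exists_section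
  exact fun t => ⟨σ.comp t, fun i x => hσ i _⟩

/-- The retraction of `J V → J (J V)` onto the diagonal components. -/
def Jμ (c : ι → I) (V : PreQCoh A) : Hom (J c (J c V)) (J c V) where
  app j :=
    { toFun := fun x t => V.ρ (le_inf inf_le_left le_rfl : c t ⊓ j ≤ c t ⊓ (c t ⊓ j)) (x t t)
      map_add' := fun x y => funext fun t =>
        map_add (V.ρ (le_inf inf_le_left le_rfl : c t ⊓ j ≤ c t ⊓ (c t ⊓ j))) (x t t) (y t t)
      map_smul' := fun a x => funext fun t => by
        have h := V.ρ_smul (le_inf inf_le_left le_rfl : c t ⊓ j ≤ c t ⊓ (c t ⊓ j))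
          (A.φ (inf_le_right : c t ⊓ (c t ⊓ j) ≤ c t ⊓ j)
            (A.φ (inf_le_right : c t ⊓ j ≤ j) a.unop)) (x t t)
        refine h.trans ?_
        rw [A.φ_comp, A.φ_comp]
        rfl }
  comm h x := funext fun t => by
    change V.ρ _ (V.ρ _ (x t t)) = V.ρ _ (V.ρ _ (x t t))
    rw [V.ρ_comp, V.ρ_comp]

theorem Jμ_η (V : PreQCoh A) (j : I) (x : (J c V).M j) :
    (Jμ c V).app j ((η c (J c V)).app j x) = x := funext fun t => by
  change V.ρ _ (V.ρ _ (x t)) = x t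
  rw [V.ρ_comp, V.ρ_refl]

theorem RelInj.K {V : PreQCoh A} (h : RelInj c V) : RelInj c (K c V) := by
  obtain ⟨σ, hσ⟩ := h.exists_section
  refine ⟨(Kπ c V).comp ((Jμ c V).comp (Jmap c σ)), fun i m => ?_⟩
  rw [Hom.comp_app, Hom.comp_app, η_natural, Jμ_η, hσ]

theorem RelInj.Kpow {V : PreQCoh A} (h : RelInj c V) : ∀ n, RelInj c (Kpow c n V)
  | 0 => h
  | n + 1 => (h.Kpow n).K

theorem RelInj.acyclic {V : PreQCoh A} (h : RelInj c V) (P : PreQCoh A) : Acyclic c P V :=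
  fun n => (h.Kpow n).firstVanish P

end Godement

end PreQCoh

/-! ### Bases of right modules modulo an ideal of the base ring -/

namespace NC

variable {R : Type u} [CommRing R] {S : Type u} [Ring S] [Algebra R S]
  {N : Type u} [AddCommGroup N] [Module R N] [Module Sᵐᵒᵖ N] [IsScalarTower R Sᵐᵒᵖ N]
  {N' : Type u} [AddCommGroup N'] [Module R N'] [Module Sᵐᵒᵖ N'] [IsScalarTower R Sᵐᵒᵖ N']
  {r : ℕ}

/-- The linear combinations `∑ e_a c_a` of a finite family `e` in a right module. -/
def combo (e : Fin r → N) : (Fin r → S) →ₗ[Sᵐᵒᵖ] N where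
  toFun c := ∑ a, op (c a) • e a
  map_add' c d := by simp [add_smul, Finset.sum_add_distrib]
  map_smul' s c := by
    rw [RingHom.id_apply, Finset.smul_sum]
    refine Finset.sum_congr rfl fun a _ => ?_
    rw [smul_smul]; rfl

theorem combo_apply (e : Fin r → N) (c : Fin r → S) : combo e c = ∑ a, op (c a) • e a := rfl

theorem combo_single (e : Fin r → N) (a : Fin r) : combo e (Pi.single a (1 : S)) = e a := by
  classical
  rw [combo_apply, Finset.sum_eq_single a]
  · simp
  · intro b _ hb; simp [Pi.single_eq_of_ne hb]
  · simp

theorem map_combo (f : N →ₗ[Sᵐᵒᵖ] N') (e : Fin r → N) (c : Fin r → S) :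
    f (combo e c) = combo (fun a => f (e a)) c := by
  simp [combo_apply]

omit [Algebra R S] [Module R N] [IsScalarTower R Sᵐᵒᵖ N] [Module R N'] [IsScalarTower R Sᵐᵒᵖ N'] in
/-- A homomorphism is given by the values on generators, if the relations between them are
respected. -/
theorem exists_hom_of_combo {e : Fin r → N} (he : Function.Surjective (combo (S := S) e))
    (v : Fin r → N') (hv : ∀ c : Fin r → S, combo e c = 0 → combo v c = 0) :
    ∃ f : N →ₗ[Sᵐᵒᵖ] N', ∀ a, f (e a) = v a := by
  let q := LinearMap.quotKerEquivOfSurjective (combo (S := S) e) he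
  refine ⟨((LinearMap.ker (combo (S := S) e)).liftQ (combo v) hv).comp
    q.symm.toLinearMap, fun a => ?_⟩
  have h : q.symm (e a) = (LinearMap.ker (combo (S := S) e)).mkQ (Pi.single a 1) := by
    rw [LinearEquiv.symm_apply_eq]
    exact (combo_single e a).symm
  rw [LinearMap.comp_apply, LinearEquiv.coe_coe, h]
  exact combo_single v a

theorem op_smul_mem {𝔞 : Ideal R} {s : S} (hs : s ∈ 𝔞 • (⊤ : Submodule R S)) (n : N) :
    op s • n ∈ 𝔞 • (⊤ : Submodule R N) := by
  refine Submodule.smul_induction_on hs (fun a ha x _ => ?_) (fun x y hx hy => ?_)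
  · rw [MulOpposite.op_smul, smul_assoc]
    exact Submodule.smul_mem_smul ha trivial
  · rw [MulOpposite.op_add, add_smul]; exact add_mem hx hy

theorem combo_mem {𝔞 : Ideal R} (e : Fin r → N) {c : Fin r → S}
    (hc : ∀ a, c a ∈ 𝔞 • (⊤ : Submodule R S)) : combo e c ∈ 𝔞 • (⊤ : Submodule R N) := by
  rw [combo_apply]
  exact Submodule.sum_mem _ fun a _ => op_smul_mem (hc a) (e a)

theorem eq_zero_of_mem_smul_top {𝔞 : Ideal R} (hN : ∀ a ∈ 𝔞, ∀ n : N, a • n = 0) {n : N}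
    (hn : n ∈ 𝔞 • (⊤ : Submodule R N)) : n = 0 := by
  refine Submodule.smul_induction_on hn (fun a ha x _ => hN a ha x) (fun x y hx hy => ?_)
  rw [hx, hy, add_zero]

/-- `e` is a basis of the right `S`-module `N` modulo the ideal `𝔞` of `R`: it induces an
isomorphism of `(S / 𝔞 S)^r` with `N`. -/
structure IsBasis (𝔞 : Ideal R) (e : Fin r → N) : Prop where
  surj : Function.Surjective (combo (S := S) e)
  ker : ∀ c : Fin r → S, combo e c = 0 ↔ ∀ a, c a ∈ 𝔞 • (⊤ : Submodule R S)

omit [Module R N] [IsScalarTower R Sᵐᵒᵖ N] in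
/-- A homomorphism to a module that is annihilated by `𝔞` is given by arbitrary values on a basis
modulo `𝔞`. -/
theorem IsBasis.exists_hom {𝔞 : Ideal R} {e : Fin r → N} (he : IsBasis (S := S) 𝔞 e)
    (hN : ∀ a ∈ 𝔞, ∀ n : N', a • n = 0) (v : Fin r → N') :
    ∃ f : N →ₗ[Sᵐᵒᵖ] N', ∀ a, f (e a) = v a :=
  exists_hom_of_combo he.surj v fun c hc =>
    eq_zero_of_mem_smul_top hN (combo_mem v ((he.ker c).1 hc))

omit [Module R N] [IsScalarTower R Sᵐᵒᵖ N] [Module R N'] [IsScalarTower R Sᵐᵒᵖ N'] in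
theorem IsBasis.hom_ext {𝔞 : Ideal R} {e : Fin r → N} (he : IsBasis (S := S) 𝔞 e)
    {f g : N →ₗ[Sᵐᵒᵖ] N'} (h : ∀ a, f (e a) = g (e a)) (n : N) : f n = g n := by
  obtain ⟨c, rfl⟩ := he.surj n
  rw [map_combo, map_combo]
  simp only [h]

theorem one_tmul_eq_zero_iff {N : Type*} [AddCommGroup N] [Module R N] (𝔟 : Ideal R) (x : N) :
    (1 : R ⧸ 𝔟) ⊗ₜ[R] x = 0 ↔ x ∈ 𝔟 • (⊤ : Submodule R N) := by
  rw [← (TensorProduct.quotTensorEquivQuotSMul N 𝔟).map_eq_zero_iff]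
  have : TensorProduct.quotTensorEquivQuotSMul N 𝔟 (1 ⊗ₜ[R] x) = Submodule.Quotient.mk x := by
    have := TensorProduct.quotTensorEquivQuotSMul_mk_tmul (M := N) 𝔟 1 x
    rw [one_smul] at this
    exact this
  rw [this, Submodule.Quotient.mk_eq_zero]

/-- If `(𝔞 : t) = 𝔪`, then `t n ∈ 𝔞 N` implies `n ∈ 𝔪 N` for `n` in a flat module `N`. -/
theorem mem_smul_top_of_flat {N : Type u} [AddCommGroup N] [Module R N] [Module.Flat R N]
    {𝔞 𝔪 : Ideal R} {t : R} (ht : ∀ a, a * t ∈ 𝔞 ↔ a ∈ 𝔪) {n : N}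
    (hn : t • n ∈ 𝔞 • (⊤ : Submodule R N)) : n ∈ 𝔪 • (⊤ : Submodule R N) := by
  let f : (R ⧸ 𝔪) →ₗ[R] (R ⧸ 𝔞) := Submodule.mapQ 𝔪 𝔞 (LinearMap.mulRight R t)
    (fun a ha => (ht a).2 ha)
  have hf : Function.Injective f := by
    rw [injective_iff_map_eq_zero]
    intro x hx
    obtain ⟨x, rfl⟩ := Submodule.Quotient.mk_surjective _ x
    exact (Submodule.Quotient.mk_eq_zero _).2 ((ht x).1 ((Submodule.Quotient.mk_eq_zero _).1 hx))
  rw [← one_tmul_eq_zero_iff]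
  refine Module.Flat.rTensor_preserves_injective_linearMap f hf ?_
  rw [map_zero, LinearMap.rTensor_tmul]
  have : f 1 = t • (1 : R ⧸ 𝔞) := by
    change Submodule.Quotient.mk (1 * t) = t • Submodule.Quotient.mk 1
    rw [← Submodule.Quotient.mk_smul, one_mul, smul_eq_mul, mul_one]
  rw [this, TensorProduct.smul_tmul]
  exact (one_tmul_eq_zero_iff _ _).2 hn

end NC

/-! ### Steps in a composition series of an Artinian local ring -/

/-- `𝔟 ⊆ 𝔞` are ideals such that `𝔞 / 𝔟` is isomorphic to `R / 𝔪`, with generator the class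
of `t`. -/
structure IsStep {R : Type u} [CommRing R] (𝔪 𝔟 𝔞 : Ideal R) (t : R) : Prop where
  le : 𝔟 ≤ 𝔞
  mem : t ∈ 𝔞
  exists_sub : ∀ x ∈ 𝔞, ∃ a, x - a * t ∈ 𝔟
  colon : ∀ a, a * t ∈ 𝔟 ↔ a ∈ 𝔪

theorem IsStep.exists_sub_smul_mem {R : Type u} [CommRing R] {𝔪 𝔟 𝔞 : Ideal R} {t : R}
    (hs : IsStep 𝔪 𝔟 𝔞 t) {N : Type*} [AddCommGroup N] [Module R N] {x : N}
    (hx : x ∈ 𝔞 • (⊤ : Submodule R N)) :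
    ∃ y : N, x - t • y ∈ 𝔟 • (⊤ : Submodule R N) := by
  refine Submodule.smul_induction_on hx (fun a ha y _ => ?_) (fun x x' hx hx' => ?_)
  · obtain ⟨b, hb⟩ := hs.exists_sub a ha
    refine ⟨b • y, ?_⟩
    rw [smul_smul, mul_comm t, ← sub_smul]
    exact Submodule.smul_mem_smul hb trivial
  · obtain ⟨y, hy⟩ := hx
    obtain ⟨y', hy'⟩ := hx'
    refine ⟨y + y', ?_⟩
    rw [smul_add, add_sub_add_comm]
    exact add_mem hy hy'

theorem IsStep.smul_mem {R : Type u} [CommRing R] {𝔪 𝔟 𝔞 : Ideal R} {t : R} (hs : IsStep 𝔪 𝔟 𝔞 t)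
    {N : Type*} [AddCommGroup N] [Module R N] {x : N} (hx : x ∈ 𝔪 • (⊤ : Submodule R N)) :
    t • x ∈ 𝔟 • (⊤ : Submodule R N) := by
  refine Submodule.smul_induction_on hx (fun a ha y _ => ?_) (fun x x' hx hx' => ?_)
  · rw [smul_smul, mul_comm]
    exact Submodule.smul_mem_smul ((hs.colon a).2 ha) trivial
  · rw [smul_add]; exact add_mem hx hx'

/-- The ideal `𝔟` is a maximal one among the ideals between `𝔪 𝔞` and `𝔞`, with `𝔪 𝔞 ≠ 𝔞` by
Nakayama's lemma. -/
theorem exists_isStep {R : Type u} [CommRing R] [IsLocalRing R] [IsNoetherianRing R]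
    {𝔞 : Ideal R} (h𝔞 : 𝔞 ≠ ⊥) :
    ∃ 𝔟 t, 𝔟 < 𝔞 ∧ IsStep (IsLocalRing.maximalIdeal R) 𝔟 𝔞 t := by
  have hne : IsLocalRing.maximalIdeal R * 𝔞 < 𝔞 := by
    refine lt_of_le_of_ne Ideal.mul_le_right fun h => h𝔞 ?_
    refine Submodule.eq_bot_of_le_smul_of_le_jacobson_bot (IsLocalRing.maximalIdeal R) 𝔞
      (IsNoetherian.noetherian 𝔞) h.ge ?_
    rw [IsLocalRing.jacobson_eq_maximalIdeal ⊥ bot_ne_top]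
  obtain ⟨𝔟, ⟨h𝔟, hlt⟩, hmax⟩ := WellFounded.has_min (r := fun a b : Ideal R => a > b)
    wellFounded_gt {𝔟 | IsLocalRing.maximalIdeal R * 𝔞 ≤ 𝔟 ∧ 𝔟 < 𝔞} ⟨_, le_rfl, hne⟩
  obtain ⟨t, ht, ht'⟩ := SetLike.exists_of_lt hlt
  have hm : ∀ a ∈ IsLocalRing.maximalIdeal R, a * t ∈ 𝔟 := fun a ha =>
    h𝔟 (Ideal.mul_mem_mul ha ht)
  refine ⟨𝔟, t, hlt, hlt.le, ht, fun x hx => ?_, fun a => ⟨fun ha => ?_, hm a⟩⟩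
  · have hsup : 𝔟 ⊔ Ideal.span {t} = 𝔞 := by
      by_contra hne
      refine hmax (𝔟 ⊔ Ideal.span {t}) ⟨h𝔟.trans le_sup_left, lt_of_le_of_ne ?_ hne⟩ ?_
      · exact sup_le hlt.le ((Ideal.span_singleton_le_iff_mem _).2 ht)
      · exact lt_of_le_of_ne le_sup_left fun h =>
          ht' (h ▸ Ideal.mem_sup_right (Ideal.mem_span_singleton_self t))
    rw [← hsup] at hx
    obtain ⟨y, hy, z, hz, rfl⟩ := Submodule.mem_sup.1 hx
    obtain ⟨a, rfl⟩ := Ideal.mem_span_singleton'.1 hz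
    exact ⟨a, by simpa using hy⟩
  · by_contra h
    have hu : IsUnit a := by
      by_contra h'
      exact h ((IsLocalRing.mem_maximalIdeal a).2 h')
    obtain ⟨b, hb⟩ := hu.exists_left_inv
    apply ht'
    rw [← one_mul t, ← hb, mul_assoc]
    exact Ideal.mul_mem_left _ _ ha

/-- Induction over ideals along steps with quotient `R / 𝔪`. -/
theorem ideal_induction {R : Type u} [CommRing R] [IsLocalRing R] [IsArtinianRing R]
    {p : Ideal R → Prop} (h0 : p ⊥)
    (h1 : ∀ 𝔟 𝔞 t, IsStep (IsLocalRing.maximalIdeal R) 𝔟 𝔞 t → p 𝔟 → p 𝔞) (𝔞 : Ideal R) :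
    p 𝔞 := by
  induction 𝔞 using WellFoundedLT.induction with
  | ind 𝔞 ih =>
    by_cases h : 𝔞 = ⊥
    · rw [h]; exact h0
    · obtain ⟨𝔟, t, hlt, hs⟩ := exists_isStep h
      exact h1 𝔟 𝔞 t hs (ih 𝔟 hlt)

namespace PreQCoh

variable {R : Type u} [CommRing R] {I : Type w} [SemilatticeInf I] {A : NCScheme R I}
  {ι : Type} {c : ι → I}

/-! ### Torsion and bundles -/

/-- `V` is annihilated by `𝔞`. -/
def Torsion (𝔞 : Ideal R) (V : PreQCoh A) : Prop := ∀ a ∈ 𝔞, ∀ i (m : V.M i), a • m = 0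

theorem Torsion.J {𝔞 : Ideal R} {V : PreQCoh A} (h : Torsion 𝔞 V) : Torsion 𝔞 (J c V) :=
  fun a ha _ m => funext fun t => h a ha _ (m t)

theorem Torsion.of_surjective {𝔞 : Ideal R} {V W : PreQCoh A} (h : Torsion 𝔞 V) (f : Hom V W)
    (hf : ∀ i, Function.Surjective (f.app i)) : Torsion 𝔞 W := by
  intro a ha i m
  obtain ⟨m, rfl⟩ := hf i m
  rw [← f.app_base, h a ha, map_zero]

theorem Torsion.K {𝔞 : Ideal R} {V : PreQCoh A} (h : Torsion 𝔞 V) : Torsion 𝔞 (K c V) :=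
  h.J.of_surjective (Kπ c V) (Kπ_surjective c V)

theorem Torsion.Kpow {𝔞 : Ideal R} {V : PreQCoh A} (h : Torsion 𝔞 V) :
    ∀ n, Torsion 𝔞 (Kpow c n V)
  | 0 => h
  | n + 1 => (h.Kpow n).K

theorem ρ_combo (V : PreQCoh A) {i j : I} (h : i ≤ j) {r : ℕ} (e : Fin r → V.M j)
    (x : Fin r → A.A j) :
    V.ρ h (NC.combo e x) = NC.combo (fun a => V.ρ h (e a)) (fun a => A.φ h (x a)) := by
  rw [NC.combo_apply, NC.combo_apply, map_sum]
  exact Finset.sum_congr rfl fun a _ => V.ρ_smul h _ _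

/-- `P` is a vector bundle of rank `r` modulo `𝔞`: every `P_i` has a basis modulo `𝔞` whose
restrictions to the smaller indices are bases modulo `𝔞`. -/
def Bundle (𝔞 : Ideal R) (r : ℕ) (P : PreQCoh A) : Prop :=
  ∀ i, ∃ e : Fin r → P.M i, ∀ (l : I) (h : l ≤ i),
    NC.IsBasis (S := A.A l) 𝔞 (fun a => P.ρ h (e a))

/-- A homomorphism from a vector bundle to `J V''` lifts along surjections: its component at `t` is
given by a homomorphism of the restrictions to the indices `l ≤ c t`, and this by the images in
`V''_{c t}` of the members of a basis of `P_{c t}`. -/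
theorem Bundle.homSurj_J {𝔞 : Ideal R} {r : ℕ} {P V V'' : PreQCoh A} (hP : Bundle 𝔞 r P)
    (hV : Torsion 𝔞 V) (g : Hom V V'') (hg : ∀ i, Function.Surjective (g.app i)) :
    HomSurj P (Jmap c g) := by
  intro t₀
  choose e he using hP
  have hdiag : ∀ t, c t ≤ c t ⊓ c t := fun t => le_inf le_rfl le_rfl
  choose v hv using fun t a => hg (c t) (V''.ρ (hdiag t) (t₀.app (c t) (e (c t) a) t))
  choose F hF using fun (t : ι) (l : I) (h : l ≤ c t) =>
    (he (c t) l h).exists_hom (fun a ha n => hV a ha l n) (fun a => V.ρ h (v t a))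
  have hcomm : ∀ t l l' (h : l ≤ c t) (h' : l' ≤ l) (p : P.M l),
      F t l' (h'.trans h) (P.ρ h' p) = V.ρ h' (F t l h p) := by
    intro t l l' h h' p
    obtain ⟨x, rfl⟩ := (he (c t) l h).surj p
    rw [ρ_combo, NC.map_combo, NC.map_combo, ρ_combo]
    simp only [P.ρ_comp, hF, V.ρ_comp]
  refine ⟨⟨fun j =>
    { toFun := fun p t => F t (c t ⊓ j) inf_le_left (P.ρ inf_le_right p)
      map_add' := fun p q => funext fun t => by rw [map_add, map_add]; rfl
      map_smul' := fun a p => funext fun t => by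
        have h := P.ρ_smul (inf_le_right : c t ⊓ j ≤ j) a.unop p
        rw [op_unop] at h
        rw [h, map_smul]; rfl }, fun {i j} h p => funext fun t => ?_⟩,
    fun j p => funext fun t => ?_⟩
  · change F t _ _ (P.ρ _ (P.ρ _ _)) = V.ρ _ (F t _ _ (P.ρ _ _))
    rw [← hcomm t _ _ inf_le_left (inf_le_inf_left (c t) h), P.ρ_comp, P.ρ_comp]
  · -- the component of `t₀` at `t`, on the indices `l ≤ c t`
    have hle : ∀ l, l ≤ c t → l ≤ c t ⊓ l := fun l h => le_inf h le_rfl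
    let G : ∀ l, l ≤ c t → (P.M l →ₗ[(A.A l)ᵐᵒᵖ] V''.M l) := fun l h =>
      { toFun := fun p => V''.ρ (hle l h) (t₀.app l p t)
        map_add' := fun p q => by rw [map_add, JObj_add, map_add]
        map_smul' := fun a p => by
          rw [map_smul, JObj_smul, V''.ρ_smul, A.φ_comp, A.φ_refl]; rfl }
    have hG : ∀ l (h : l ≤ c t) p, G l h p = g.app l (F t l h p) := by
      intro l h
      refine (he (c t) l h).hom_ext (f := G l h) (g := (g.app l).comp (F t l h)) fun a => ?_
      rw [LinearMap.comp_apply, hF, g.comm, hv, V''.ρ_comp]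
      change V''.ρ _ (t₀.app l (P.ρ h _) t) = _
      rw [t₀.comm h, J_ρ, V''.ρ_comp]
    have h1 : (Jmap c g).app j (fun t => F t (c t ⊓ j) inf_le_left (P.ρ inf_le_right p)) t =
        G (c t ⊓ j) inf_le_left (P.ρ inf_le_right p) := (hG _ _ _).symm
    refine h1.trans ?_
    change V''.ρ _ (t₀.app _ (P.ρ _ p) t) = _
    rw [t₀.comm, J_ρ, V''.ρ_comp, V''.ρ_refl]

/-! ### Acyclicity in short exact sequences -/

theorem ShortExact.acyclic_mid (hc : Function.Surjective c) {𝔞 : Ideal R} {r : ℕ}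
    {P V' V V'' : PreQCoh A} (hP : Bundle 𝔞 r P) (hV : Torsion 𝔞 V) {f : Hom V' V}
    {g : Hom V V''} (h : ShortExact f g) (h' : Acyclic c P V') (h'' : Acyclic c P V'') :
    Acyclic c P V := fun n =>
  (h.Kpow hc n).firstVanish_mid hc (hP.homSurj_J (hV.Kpow n) _ (h.Kpow hc n).surj) (h' n) (h'' n)

theorem ShortExact.acyclic_right (hc : Function.Surjective c) {𝔞 : Ideal R} {r : ℕ}
    {P V' V V'' : PreQCoh A} (hP : Bundle 𝔞 r P) (hV : Torsion 𝔞 V) {f : Hom V' V}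
    {g : Hom V V''} (h : ShortExact f g) (h' : Acyclic c P V') (hV' : Acyclic c P V) :
    Acyclic c P V'' := fun n =>
  firstVanish_right ((h.Kpow hc (n + 1)).homSurj hc
    (hP.homSurj_J (hV.Kpow (n + 1)) _ (h.Kpow hc (n + 1)).surj) (h' (n + 1))) (hV' n)

/-- If `V''` is annihilated by `𝔪`, then homomorphisms to `V''` factor through the reduction modulo
`𝔪`. -/
theorem HomSurj.of_torsion {𝔪 : Ideal R} {P P₀ V V'' : PreQCoh A} (π : Hom P P₀)
    (hπ : ∀ i, Function.Surjective (π.app i))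
    (hker : ∀ i x, π.app i x = 0 → x ∈ 𝔪 • (⊤ : Submodule R (P.M i))) {g : Hom V V''}
    (hV : Torsion 𝔪 V'') (h : HomSurj P₀ g) : HomSurj P g := by
  intro t
  obtain ⟨t', ht'⟩ := exists_desc π hπ t (fun i x hx => by
    refine Submodule.smul_induction_on (hker i x hx) (fun a ha y _ => ?_) (fun y z hy hz => ?_)
    · rw [t.app_base, hV a ha]
    · rw [map_add, hy, hz, add_zero])
  obtain ⟨s, hs⟩ := h t'
  exact ⟨s.comp π, fun i x => by rw [Hom.comp_app, hs, ht']⟩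

theorem Acyclic.of_torsion {𝔪 : Ideal R} {P P₀ V : PreQCoh A} (π : Hom P P₀)
    (hπ : ∀ i, Function.Surjective (π.app i))
    (hker : ∀ i x, π.app i x = 0 → x ∈ 𝔪 • (⊤ : Submodule R (P.M i)))
    (hV : Torsion 𝔪 V) (h : Acyclic c P₀ V) : Acyclic c P V := fun n =>
  (h n).of_torsion π hπ hker (hV.Kpow n).K

/-! ### The filtration by ideals of the base ring -/

/-- The submodules `𝔞 V_i`. -/
def idealSubmodule (V : PreQCoh A) (𝔞 : Ideal R) (i : I) : Submodule (A.A i)ᵐᵒᵖ (V.M i) :=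
  { (𝔞 • (⊤ : Submodule R (V.M i)) : Submodule R (V.M i)) with
    smul_mem' := fun s x hx => by
      change s • x ∈ 𝔞 • (⊤ : Submodule R (V.M i))
      refine Submodule.smul_induction_on (p := fun x => s • x ∈ 𝔞 • (⊤ : Submodule R (V.M i))) hx
        (fun a ha y _ => ?_) (fun y z hy hz => ?_)
      · rw [smul_comm]; exact Submodule.smul_mem_smul ha trivial
      · rw [smul_add]; exact add_mem hy hz }

theorem mem_idealSubmodule {V : PreQCoh A} {𝔞 : Ideal R} {i : I} {x : V.M i} :
    x ∈ V.idealSubmodule 𝔞 i ↔ x ∈ 𝔞 • (⊤ : Submodule R (V.M i)) := Iff.rfl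

theorem smul_mem_idealSubmodule (V : PreQCoh A) {𝔞 : Ideal R} {i : I} {a : R} (ha : a ∈ 𝔞)
    (x : V.M i) : a • x ∈ V.idealSubmodule 𝔞 i :=
  mem_idealSubmodule.2 (Submodule.smul_mem_smul ha trivial)

theorem idealSubmodule_stable (V : PreQCoh A) (𝔞 : Ideal R) {i j : I} (h : i ≤ j) (m : V.M j)
    (hm : m ∈ V.idealSubmodule 𝔞 j) : V.ρ h m ∈ V.idealSubmodule 𝔞 i := by
  refine Submodule.smul_induction_on (mem_idealSubmodule.1 hm) (fun a ha y _ => ?_)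
    (fun y z hy hz => ?_)
  · rw [ρ_base]; exact V.smul_mem_idealSubmodule ha _
  · rw [map_add]; exact add_mem hy hz

/-- The subpresheaf `𝔞 V`. -/
@[reducible] def idealSub (V : PreQCoh A) (𝔞 : Ideal R) : PreQCoh A :=
  V.sub (V.idealSubmodule 𝔞) (V.idealSubmodule_stable 𝔞)

/-- The inclusion `𝔞 V → V`. -/
def idealSubι (V : PreQCoh A) (𝔞 : Ideal R) : Hom (V.idealSub 𝔞) V :=
  V.subι (V.idealSubmodule 𝔞) (V.idealSubmodule_stable 𝔞)

/-- A reduction of `F` modulo `𝔪`: a surjective homomorphism with kernel `𝔪 F`. -/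
structure IsReduction (𝔪 : Ideal R) {F P₀ : PreQCoh A} (π : Hom F P₀) : Prop where
  surj : ∀ i, Function.Surjective (π.app i)
  ker : ∀ i x, π.app i x = 0 ↔ x ∈ 𝔪 • (⊤ : Submodule R (F.M i))

theorem IsReduction.torsion {𝔪 : Ideal R} {F P₀ : PreQCoh A} {π : Hom F P₀}
    (hπ : IsReduction 𝔪 π) : Torsion 𝔪 P₀ := by
  intro a ha i m
  obtain ⟨m, rfl⟩ := hπ.surj i m
  rw [← π.app_base, hπ.ker]
  exact Submodule.smul_mem_smul ha trivial

theorem IsReduction.shortExact {𝔪 : Ideal R} {F P₀ : PreQCoh A} {π : Hom F P₀}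
    (hπ : IsReduction 𝔪 π) : ShortExact (F.idealSubι 𝔪) π where
  inj _ := Subtype.val_injective
  surj := hπ.surj
  zero _ x := (hπ.ker _ _).2 x.2
  exact i x hx := ⟨⟨x, (hπ.ker i x).1 hx⟩, rfl⟩

/-- For flat `F`, the quotients of the filtration of `F` by a composition series of `R` are
isomorphic to the reduction of `F`. -/
theorem IsReduction.exists_shortExact {𝔪 𝔟 𝔞 : Ideal R} {t : R} (hs : IsStep 𝔪 𝔟 𝔞 t)
    {F P₀ : PreQCoh A} {π : Hom F P₀} (hπ : IsReduction 𝔪 π) (hF : ∀ i, Module.Flat R (F.M i)) :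
    ∃ (f : Hom (F.idealSub 𝔟) (F.idealSub 𝔞)) (g : Hom (F.idealSub 𝔞) P₀), ShortExact f g ∧
      (∀ i (x : (F.idealSub 𝔟).M i), (f.app i x : F.M i) = x) ∧
      ∀ i (y : F.M i), g.app i ⟨t • y, F.smul_mem_idealSubmodule hs.mem y⟩ = π.app i y := by
  have hle : ∀ i, F.idealSubmodule 𝔟 i ≤ F.idealSubmodule 𝔞 i :=
    fun i => Submodule.smul_mono_left (N := (⊤ : Submodule R (F.M i))) hs.le
  let f : Hom (F.idealSub 𝔟) (F.idealSub 𝔞) :=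
    ⟨fun i => Submodule.inclusion (hle i), fun _ _ => rfl⟩
  have hst : ∀ {i j : I} (h : i ≤ j) (m : (F.idealSub 𝔞).M j),
      m ∈ LinearMap.range (f.app j) → (F.idealSub 𝔞).ρ h m ∈ LinearMap.range (f.app i) := by
    rintro i j h _ ⟨m, rfl⟩
    exact ⟨(F.idealSub 𝔟).ρ h m, f.comm h m⟩
  let Q := (F.idealSub 𝔞).quot (fun i => LinearMap.range (f.app i)) hst
  let qπ : Hom (F.idealSub 𝔞) Q := (F.idealSub 𝔞).quotπ (fun i => LinearMap.range (f.app i)) hst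
  have hq0 : ∀ i x, qπ.app i x = 0 ↔ ∃ y, f.app i y = x := fun i x =>
    Submodule.Quotient.mk_eq_zero _
  let m : Hom F (F.idealSub 𝔞) :=
    ⟨fun i =>
      { toFun := fun y => ⟨t • y, F.smul_mem_idealSubmodule hs.mem y⟩
        map_add' := fun y z => Subtype.ext (smul_add t y z)
        map_smul' := fun a y => Subtype.ext (smul_comm t a y) },
      fun h y => Subtype.ext (F.ρ_base h t y).symm⟩
  have hm : ∀ i, Function.Surjective ((qπ.comp m).app i) := by
    intro i x
    obtain ⟨x, rfl⟩ := Submodule.mkQ_surjective _ x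
    obtain ⟨y, hy⟩ := hs.exists_sub_smul_mem (mem_idealSubmodule.1 x.2)
    refine ⟨y, ?_⟩
    change qπ.app i (m.app i y) = qπ.app i x
    rw [eq_comm, ← sub_eq_zero, ← map_sub, hq0]
    exact ⟨⟨_, hy⟩, Subtype.ext rfl⟩
  have hmk : ∀ i x, (qπ.comp m).app i x = 0 ↔ π.app i x = 0 := by
    intro i x
    rw [Hom.comp_app, hq0, hπ.ker]
    constructor
    · rintro ⟨y, hy⟩
      have := hF i
      refine NC.mem_smul_top_of_flat hs.colon (n := x) ?_
      have hy' : (y : F.M i) = t • x := congrArg Subtype.val hy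
      rw [← hy']; exact y.2
    · intro hx
      exact ⟨⟨t • x, hs.smul_mem hx⟩, rfl⟩
  obtain ⟨h, hh⟩ := exists_desc (qπ.comp m) hm π (fun i x hx => (hmk i x).1 hx)
  have hinj : ∀ i x, h.app i x = 0 → x = 0 := by
    intro i x hx
    obtain ⟨y, rfl⟩ := hm i x
    rw [hh] at hx
    exact (hmk i y).2 hx
  refine ⟨f, h.comp qπ, ⟨fun i => Submodule.inclusion_injective (hle i), fun i x => ?_,
    fun i x => ?_, fun i x hx => (hq0 i x).1 (hinj i _ hx)⟩, fun _ _ => rfl, fun i y => hh i y⟩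
  · obtain ⟨y, rfl⟩ := hπ.surj i x
    exact ⟨m.app i y, hh i y⟩
  · rw [Hom.comp_app, (hq0 i _).2 ⟨x, rfl⟩, map_zero]

theorem torsion_bot (V : PreQCoh A) : Torsion ⊥ V := by
  intro a ha i m
  rw [Ideal.mem_bot.1 ha, zero_smul]

theorem acyclic_of_subsingleton (P V : PreQCoh A) (hV : ∀ i, Subsingleton (V.M i)) :
    Acyclic c P V := by
  refine RelInj.acyclic ⟨⟨fun i => 0, fun h m => ?_⟩, fun i m => Subsingleton.elim _ _⟩ P
  exact Subsingleton.elim _ _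

/-- If the reduction of a flat `F` is acyclic, so are all the `𝔞 F`. -/
theorem IsReduction.acyclic_idealSub [IsLocalRing R] [IsArtinianRing R]
    (hc : Function.Surjective c) {P F P₀ : PreQCoh A} {r : ℕ} (hP : Bundle ⊥ r P) {π : Hom F P₀}
    (hπ : IsReduction (IsLocalRing.maximalIdeal R) π) (hF : ∀ i, Module.Flat R (F.M i))
    (h₀ : Acyclic c P P₀) (𝔞 : Ideal R) : Acyclic c P (F.idealSub 𝔞) := by
  induction 𝔞 using ideal_induction with
  | h0 =>
    refine acyclic_of_subsingleton _ _ fun i => ⟨fun x y => Subtype.ext ?_⟩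
    have h : ∀ z : (F.idealSub ⊥).M i, (z : F.M i) = 0 := fun z =>
      NC.eq_zero_of_mem_smul_top (fun a ha n => F.torsion_bot a ha i n) z.2
    rw [h x, h y]
  | h1 𝔟 𝔞 t hs ih =>
    obtain ⟨f, g, hfg, -⟩ := hπ.exists_shortExact hs hF
    exact hfg.acyclic_mid hc hP (torsion_bot _) ih h₀

theorem IsReduction.acyclic [IsLocalRing R] [IsArtinianRing R]
    (hc : Function.Surjective c) {P F P₀ : PreQCoh A} {r : ℕ} (hP : Bundle ⊥ r P) {π : Hom F P₀}
    (hπ : IsReduction (IsLocalRing.maximalIdeal R) π) (hF : ∀ i, Module.Flat R (F.M i))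
    (h₀ : Acyclic c P P₀) : Acyclic c P F :=
  hπ.shortExact.acyclic_mid hc hP (torsion_bot _)
    (hπ.acyclic_idealSub hc hP hF h₀ _) h₀

end PreQCoh

/-! ### Generators of right modules over an algebra -/

namespace NC

variable {R : Type u} [CommRing R] {S : Type u} [Ring S] [Algebra R S]
  {N : Type u} [AddCommGroup N] [Module R N] [Module Sᵐᵒᵖ N] [IsScalarTower R Sᵐᵒᵖ N]
  {N' : Type u} [AddCommGroup N'] [Module R N'] [Module Sᵐᵒᵖ N'] [IsScalarTower R Sᵐᵒᵖ N']
  {r : ℕ}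

theorem combo_smul (e : Fin r → N) (a : R) (c : Fin r → S) :
    combo e (a • c) = a • combo e c := by
  rw [combo_apply, combo_apply, Finset.smul_sum]
  refine Finset.sum_congr rfl fun i _ => ?_
  rw [Pi.smul_apply, MulOpposite.op_smul, smul_assoc]

theorem combo_smul_family (e : Fin r → N) (a : R) (c : Fin r → S) :
    combo (fun i => a • e i) c = a • combo e c := by
  have : SMulCommClass R Sᵐᵒᵖ N := IsScalarTower.to_smulCommClass
  rw [combo_apply, combo_apply, Finset.smul_sum]
  exact Finset.sum_congr rfl fun i _ => (smul_comm _ _ _).symm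

theorem pi_mem_smul_top {𝔞 : Ideal R} {c : Fin r → S} :
    c ∈ 𝔞 • (⊤ : Submodule R (Fin r → S)) ↔ ∀ a, c a ∈ 𝔞 • (⊤ : Submodule R S) := by
  constructor
  · intro h a
    refine Submodule.smul_induction_on (p := fun c => c a ∈ 𝔞 • (⊤ : Submodule R S)) h
      (fun b hb x _ => ?_) (fun x y hx hy => ?_)
    · exact Submodule.smul_mem_smul hb trivial
    · exact add_mem hx hy
  · intro h
    classical
    have key : ∀ a, ∀ s ∈ 𝔞 • (⊤ : Submodule R S),
        (Pi.single a s : Fin r → S) ∈ 𝔞 • (⊤ : Submodule R (Fin r → S)) := by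
      intro a s hs
      refine Submodule.smul_induction_on hs (fun b hb x _ => ?_) (fun x y hx hy => ?_)
      · rw [Pi.single_smul]; exact Submodule.smul_mem_smul hb trivial
      · rw [Pi.single_add]; exact add_mem hx hy
    rw [← Finset.univ_sum_single c]
    exact Submodule.sum_mem _ fun a _ => key a _ (h a)

theorem map_mem_smul_top {𝔞 : Ideal R} (f : N →ₗ[R] N') {n : N}
    (hn : n ∈ 𝔞 • (⊤ : Submodule R N)) : f n ∈ 𝔞 • (⊤ : Submodule R N') := by
  refine Submodule.smul_induction_on hn (fun b hb x _ => ?_) (fun x y hx hy => ?_)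
  · rw [map_smul]; exact Submodule.smul_mem_smul hb trivial
  · rw [map_add]; exact add_mem hx hy

/-- An element of `𝔞 N` is a linear combination of generators with coefficients in `𝔞 S`. -/
theorem exists_combo_of_mem {𝔞 : Ideal R} {e : Fin r → N}
    (he : Function.Surjective (combo (S := S) e)) {n : N} (hn : n ∈ 𝔞 • (⊤ : Submodule R N)) :
    ∃ c : Fin r → S, (∀ a, c a ∈ 𝔞 • (⊤ : Submodule R S)) ∧ combo e c = n := by
  refine Submodule.smul_induction_on hn (fun b hb x _ => ?_) (fun x y hx hy => ?_)
  · obtain ⟨c, rfl⟩ := he x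
    exact ⟨b • c, fun a => Submodule.smul_mem_smul hb trivial, combo_smul e b c⟩
  · obtain ⟨c, hc, rfl⟩ := hx
    obtain ⟨d, hd, rfl⟩ := hy
    exact ⟨c + d, fun a => add_mem (hc a) (hd a), map_add _ _ _⟩

end NC

namespace PreQCoh

variable {R : Type u} [CommRing R] {I : Type w} [SemilatticeInf I] {A : NCScheme R I}
  {ι : Type} {c : ι → I}

/-- A homomorphism as an `R`-linear map. -/
def Hom.appBase {V W : PreQCoh A} (f : Hom V W) (i : I) : V.M i →ₗ[R] W.M i :=
  { f.app i with map_smul' := fun a m => f.app_base i a m }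

theorem Hom.map_mem_smul_top {V W : PreQCoh A} (f : Hom V W) {𝔞 : Ideal R} {i : I} {x : V.M i}
    (hx : x ∈ 𝔞 • (⊤ : Submodule R (V.M i))) : f.app i x ∈ 𝔞 • (⊤ : Submodule R (W.M i)) :=
  NC.map_mem_smul_top (f.appBase i) hx

theorem exists_mem_smul_top {V W : PreQCoh A} (f : Hom V W)
    (hf : ∀ i, Function.Surjective (f.app i)) {𝔞 : Ideal R} {i : I} {x : W.M i}
    (hx : x ∈ 𝔞 • (⊤ : Submodule R (W.M i))) :
    ∃ y ∈ 𝔞 • (⊤ : Submodule R (V.M i)), f.app i y = x := by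
  refine Submodule.smul_induction_on hx (fun b hb x _ => ?_) (fun x y hx hy => ?_)
  · obtain ⟨z, rfl⟩ := hf i x
    exact ⟨b • z, Submodule.smul_mem_smul hb trivial, f.app_base _ _ _⟩
  · obtain ⟨x', hx', rfl⟩ := hx
    obtain ⟨y', hy', rfl⟩ := hy
    exact ⟨x' + y', add_mem hx' hy', map_add _ _ _⟩

theorem Bundle.torsion {𝔞 : Ideal R} {r : ℕ} {P : PreQCoh A} (hP : Bundle 𝔞 r P) :
    Torsion 𝔞 P := by
  intro a ha i m
  obtain ⟨e, he⟩ := hP i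
  obtain ⟨x, rfl⟩ := (he i le_rfl).surj m
  rw [← NC.combo_smul, (he i le_rfl).ker]
  exact fun b => Submodule.smul_mem_smul ha trivial

/-! ### Lifting a vector bundle along one step -/

/-- An extension `N` of `M` by `P₀` in which `t` acts as the composite `N → M → P₀ → N` is a vector
bundle modulo `𝔟`: bases of `M` modulo `𝔞` lift to bases of `N` modulo `𝔟`. -/
theorem Bundle.of_extension {𝔪 𝔟 𝔞 : Ideal R} {t : R} (hs : IsStep 𝔪 𝔟 𝔞 t) {r : ℕ}
    {P₀ N M : PreQCoh A} {k : Hom P₀ N} {pr : Hom N M} (h : ShortExact k pr) {π : Hom M P₀}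
    (hM : Bundle 𝔞 r M) (hπ : IsReduction 𝔪 π) (hN : Torsion 𝔟 N) (h𝔞 : 𝔞 ≤ 𝔪)
    (hk : ∀ i y, t • y = k.app i (π.app i (pr.app i y))) :
    Bundle 𝔟 r N := by
  intro i
  obtain ⟨e, he⟩ := hM i
  choose e' he' using fun a => h.surj i (e a)
  have hpr : ∀ l (hl : l ≤ i) (x : Fin r → A.A l),
      pr.app l (NC.combo (fun a => N.ρ hl (e' a)) x) = NC.combo (fun a => M.ρ hl (e a)) x := by
    intro l hl x
    rw [NC.map_combo]
    simp only [pr.comm, he']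
  refine ⟨e', fun l hl => ⟨fun y => ?_, fun x => ⟨fun hx => ?_, fun hx => ?_⟩⟩⟩
  · obtain ⟨x, hx⟩ := (he l hl).surj (pr.app l y)
    obtain ⟨p, hp⟩ := h.exact l (y - NC.combo (fun a => N.ρ hl (e' a)) x) (by
      rw [map_sub, hpr, hx, sub_self])
    obtain ⟨m, rfl⟩ := hπ.surj l p
    obtain ⟨x', rfl⟩ := (he l hl).surj m
    refine ⟨x + t • x', ?_⟩
    rw [map_add, NC.combo_smul, hk, hpr, hp, add_sub_cancel]
  · have h0 : NC.combo (fun a => M.ρ hl (e a)) x = 0 := by rw [← hpr, hx, map_zero]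
    have h1 := ((he l hl).ker x).1 h0
    choose y hy using fun a => hs.exists_sub_smul_mem (h1 a)
    have h2 : NC.combo (fun a => N.ρ hl (e' a)) (x - t • y) = 0 :=
      NC.eq_zero_of_mem_smul_top (fun a ha n => hN a ha l n) (NC.combo_mem _ hy)
    rw [map_sub, hx, zero_sub, neg_eq_zero, NC.combo_smul, hk, hpr] at h2
    have h3 := (hπ.ker l _).1 ((injective_iff_map_eq_zero _).1 (h.inj l) _ h2)
    obtain ⟨z, hz, hz'⟩ := NC.exists_combo_of_mem (he l hl).surj h3
    have h4 : ∀ a, y a ∈ 𝔪 • (⊤ : Submodule R (A.A l)) := by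
      intro a
      have := ((he l hl).ker (y - z)).1 (by rw [map_sub, hz', sub_self]) a
      have h5 := add_mem (Submodule.smul_mono_left (N := (⊤ : Submodule R (A.A l))) h𝔞 this) (hz a)
      simpa using h5
    intro a
    have h6 := add_mem (hy a) (hs.smul_mem (h4 a))
    simpa using h6
  · exact NC.eq_zero_of_mem_smul_top (fun a ha n => hN a ha l n) (NC.combo_mem _ hx)

theorem IsReduction.of_extension {𝔪 𝔟 𝔞 : Ideal R} {t : R} (hs : IsStep 𝔪 𝔟 𝔞 t)
    {P₀ N M : PreQCoh A} {k : Hom P₀ N} {pr : Hom N M} (h : ShortExact k pr) {π : Hom M P₀}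
    (hπ : IsReduction 𝔪 π) (h𝔞 : 𝔞 ≤ 𝔪)
    (hk : ∀ i y, t • y = k.app i (π.app i (pr.app i y))) :
    IsReduction 𝔪 (π.comp pr) where
  surj i := (hπ.surj i).comp (h.surj i)
  ker i y := by
    rw [Hom.comp_app, hπ.ker]
    constructor
    · intro hy
      obtain ⟨z, hz, hz'⟩ := exists_mem_smul_top pr h.surj hy
      obtain ⟨p, hp⟩ := h.exact i (y - z) (by rw [map_sub, hz', sub_self])
      obtain ⟨m, rfl⟩ := hπ.surj i p
      obtain ⟨m, rfl⟩ := h.surj i m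
      rw [← hk] at hp
      rw [← sub_add_cancel y z, ← hp]
      exact add_mem (Submodule.smul_mem_smul (h𝔞 hs.mem) trivial) hz
    · exact fun hy => pr.map_mem_smul_top hy

/-- The free presheaf of rank `r`. -/
@[reducible] def free (A : NCScheme R I) (r : ℕ) : PreQCoh A where
  M i := Fin r → A.A i
  ρ h := AddMonoidHom.mk' (fun x a => A.φ h (x a)) (fun _ _ => funext fun _ => map_add _ _ _)
  ρ_smul h s x := funext fun a => map_mul (A.φ h) (x a) s
  ρ_refl i _ := funext fun _ => A.φ_refl i _
  ρ_comp h h' _ := funext fun _ => A.φ_comp h h' _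

/-- The homomorphism `J V → J W` given by a compatible family of homomorphisms `V_l → W_l` for
`l ≤ c t`, for every `t`. -/
def JHom {V W : PreQCoh A} (F : ∀ (t : ι) (l : I), l ≤ c t → (V.M l →ₗ[(A.A l)ᵐᵒᵖ] W.M l))
    (hF : ∀ t l l' (h : l ≤ c t) (h' : l' ≤ l) (p : V.M l),
      F t l' (h'.trans h) (V.ρ h' p) = W.ρ h' (F t l h p)) : Hom (J c V) (J c W) where
  app j :=
    { toFun := fun x t => F t (c t ⊓ j) inf_le_left (x t)
      map_add' := fun _ _ => funext fun t => map_add (F t (c t ⊓ j) inf_le_left) _ _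
      map_smul' := fun _ _ => funext fun t => map_smul (F t (c t ⊓ j) inf_le_left) _ _ }
  comm h x := funext fun t => hF t _ _ inf_le_left (inf_le_inf_left (c t) h) (x t)

/-- Local lifts of a vector bundle `M` modulo `𝔞` to free modules modulo `𝔟`, as an extension
of `J M` by `J P₀`. -/
theorem Bundle.exists_local_lift (hA : ∀ i, Module.Flat R (A.A i))
    {𝔪 𝔟 𝔞 : Ideal R} {t : R} (hs : IsStep 𝔪 𝔟 𝔞 t) {r : ℕ}
    {P₀ M : PreQCoh A} {π : Hom M P₀} (hM : Bundle 𝔞 r M) (hπ : IsReduction 𝔪 π) (h𝔞 : 𝔞 ≤ 𝔪) :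
    ∃ (B : PreQCoh A) (κ : Hom (J c P₀) B) (β : Hom B (J c M)), ShortExact κ β ∧
      Torsion 𝔟 B ∧ ∀ i x, t • x = κ.app i ((Jmap c π).app i (β.app i x)) := by
  choose e he using hM
  -- `B = J B₀` for the free presheaf `B₀` modulo `𝔟`
  let L := free A r
  let B₀ := L.quot (L.idealSubmodule 𝔟) (L.idealSubmodule_stable 𝔟)
  have hB₀ : Torsion 𝔟 B₀ := by
    intro a ha i m
    obtain ⟨m, rfl⟩ := Submodule.mkQ_surjective _ m
    refine (Submodule.Quotient.mk_eq_zero _).2 (L.smul_mem_idealSubmodule ha m)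
  let q : ∀ l, (Fin r → A.A l) →ₗ[(A.A l)ᵐᵒᵖ] B₀.M l := fun l => (L.idealSubmodule 𝔟 l).mkQ
  have hq : ∀ l, Function.Surjective (q l) := fun l => Submodule.mkQ_surjective _
  have hq0 : ∀ l x, q l x = 0 ↔ ∀ a, x a ∈ 𝔟 • (⊤ : Submodule R (A.A l)) := fun l x =>
    (Submodule.Quotient.mk_eq_zero _).trans NC.pi_mem_smul_top
  have hqs : ∀ l (a : R) x, q l (a • x) = a • q l x := fun l a x => rfl
  have hqρ : ∀ {l l'} (h : l' ≤ l) x, B₀.ρ h (q l x) = q l' (L.ρ h x) := fun _ _ => rfl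
  -- the map `B₀ → M` given by the chosen basis
  let b : ∀ (t : ι) (l : I), l ≤ c t → (B₀.M l →ₗ[(A.A l)ᵐᵒᵖ] M.M l) := fun t l h =>
    (L.idealSubmodule 𝔟 l).liftQ (NC.combo fun a => M.ρ h (e (c t) a)) (fun x hx => by
      refine ((he (c t) l h).ker x).2 fun a => ?_
      exact Submodule.smul_mono_left (N := (⊤ : Submodule R (A.A l))) hs.le
        (NC.pi_mem_smul_top.1 hx a))
  have hb : ∀ t l h x, b t l h (q l x) = NC.combo (fun a => M.ρ h (e (c t) a)) x :=
    fun _ _ _ _ => rfl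
  have hπe : ∀ t l h (x : Fin r → A.A l), NC.combo (fun a => π.app l (M.ρ h (e (c t) a))) x = 0 ↔
      ∀ a, x a ∈ 𝔪 • (⊤ : Submodule R (A.A l)) := by
    intro t l h x
    rw [← NC.map_combo, hπ.ker]
    refine ⟨fun hx a => ?_, fun hx => NC.combo_mem _ hx⟩
    obtain ⟨z, hz, hz'⟩ := NC.exists_combo_of_mem (he (c t) l h).surj hx
    have := ((he (c t) l h).ker (x - z)).1 (by rw [map_sub, hz', sub_self]) a
    have h5 := add_mem (Submodule.smul_mono_left (N := (⊤ : Submodule R (A.A l))) h𝔞 this) (hz a)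
    simpa using h5
  have hsurj : ∀ t l h, Function.Surjective
      (NC.combo (S := A.A l) (fun a => π.app l (M.ρ h (e (c t) a)))) := by
    intro t l h p
    obtain ⟨m, rfl⟩ := hπ.surj l p
    obtain ⟨x, rfl⟩ := (he (c t) l h).surj m
    exact ⟨x, (NC.map_combo _ _ _).symm⟩
  have hstd : ∀ l (x : Fin r → A.A l),
      NC.combo (fun a => q l (Pi.single a 1)) x = q l x := by
    intro l x
    rw [← NC.map_combo]
    congr 1
    rw [NC.combo_apply]
    refine Eq.trans (Finset.sum_congr rfl fun a _ => ?_) (Finset.univ_sum_single x)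
    rw [← Pi.single_smul]
    exact congrArg (Pi.single a) (one_mul (x a))
  -- the map `P₀ → B₀` given by multiplication by `t`
  choose k hk using fun t' l h => NC.exists_hom_of_combo (hsurj t' l h)
    (fun a => t • q l (Pi.single a 1)) (fun x hx => by
      refine (NC.combo_smul_family (N := B₀.M l) _ t x).trans ?_
      rw [hstd, ← hqs, hq0]
      exact fun a => hs.smul_mem ((hπe _ _ _ _).1 hx a))
  have hk' : ∀ t' l h x, k t' l h (NC.combo (fun a => π.app l (M.ρ h (e (c t') a))) x) =
      t • q l x := by
    intro t' l h x
    rw [NC.map_combo]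
    simp only [hk]
    refine (NC.combo_smul_family (N := B₀.M l) _ t x).trans ?_
    rw [hstd]
  have hbρ : ∀ t l l' (h : l ≤ c t) (h' : l' ≤ l) (p : B₀.M l),
      b t l' (h'.trans h) (B₀.ρ h' p) = M.ρ h' (b t l h p) := by
    intro t l l' h h' p
    obtain ⟨x, rfl⟩ := hq l p
    rw [hqρ, hb, hb, ρ_combo]
    simp only [M.ρ_comp]
    rfl
  have hkρ : ∀ t l l' (h : l ≤ c t) (h' : l' ≤ l) (p : P₀.M l),
      k t l' (h'.trans h) (P₀.ρ h' p) = B₀.ρ h' (k t l h p) := by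
    intro t' l l' h h' p
    obtain ⟨x, rfl⟩ := hsurj t' l h p
    rw [ρ_combo, hk', ρ_base, hqρ]
    simp only [← π.comm, M.ρ_comp]
    exact hk' _ _ _ _
  refine ⟨J c B₀, JHom k hkρ, JHom b hbρ, ⟨fun j => ?_, fun j y => ?_, fun j x => ?_,
    fun j y hy => ?_⟩, hB₀.J, fun j y => ?_⟩
  · rw [injective_iff_map_eq_zero]
    intro y hy
    refine funext fun t' => ?_
    have h0 : k t' (c t' ⊓ j) inf_le_left (y t') = 0 := congrFun hy t'
    obtain ⟨x, hx⟩ := hsurj t' (c t' ⊓ j) inf_le_left (y t')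
    rw [← hx, hk', ← hqs, hq0] at h0
    refine hx.symm.trans ((hπe _ _ _ _).2 fun a => ?_)
    have := hA (c t' ⊓ j)
    exact NC.mem_smul_top_of_flat hs.colon (h0 a)
  · choose x hx using fun t' => (he (c t') (c t' ⊓ j) inf_le_left).surj (y t')
    exact ⟨fun t' => q _ (x t'), funext hx⟩
  · refine funext fun t' => ?_
    change b t' _ _ (k t' _ inf_le_left (x t')) = 0
    obtain ⟨z, hz⟩ := hsurj t' (c t' ⊓ j) inf_le_left (x t')
    rw [← hz, hk', ← hqs, hb, (he _ _ _).ker]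
    exact fun a => Submodule.smul_mem_smul hs.mem trivial
  · have : ∀ t', ∃ x, k t' (c t' ⊓ j) inf_le_left x = y t' := by
      intro t'
      have h0 : b t' (c t' ⊓ j) inf_le_left (y t') = 0 := congrFun hy t'
      obtain ⟨x, hx⟩ := hq _ (y t')
      rw [← hx, hb, (he _ _ _).ker] at h0
      choose z hz using fun a => hs.exists_sub_smul_mem (h0 a)
      refine ⟨NC.combo (fun a => π.app _ (M.ρ (inf_le_left : c t' ⊓ j ≤ c t') (e (c t') a))) z, ?_⟩
      rw [hk', ← hqs, ← hx, ← sub_eq_zero, ← map_sub, ← neg_sub, map_neg, neg_eq_zero, hq0]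
      exact hz
    choose x hx using this
    exact ⟨x, funext hx⟩
  · refine funext fun t' => ?_
    change t • y t' = k t' _ inf_le_left (π.app _ (b t' _ inf_le_left (y t')))
    obtain ⟨x, hx⟩ := hq _ (y t')
    rw [← hx, hb, NC.map_combo]
    exact (hk' t' _ inf_le_left x).symm

/-- A vector bundle modulo `𝔞` lifts to a vector bundle modulo `𝔟` if the second cohomology of `P₀`
vanishes. The local lifts form an extension `B` of `J M` by `J P₀`. Let `Y` be the preimage of
`M ⊆ J M` in `B`; then `Y / P₀` is an extension of `M` by `K P₀ = J P₀ / P₀`, whose class is the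
obstruction, and the preimage in `Y` of the image of a splitting is a lift of `M`. -/
theorem Bundle.exists_lift_step (hA : ∀ i, Module.Flat R (A.A i)) (hc : Function.Surjective c)
    {𝔪 𝔟 𝔞 : Ideal R} {t : R} (hs : IsStep 𝔪 𝔟 𝔞 t) {r : ℕ}
    {P₀ M : PreQCoh A} {π : Hom M P₀} (hM : Bundle 𝔞 r M) (hπ : IsReduction 𝔪 π) (h𝔞 : 𝔞 ≤ 𝔪)
    (h₀ : FirstVanish c P₀ (K c P₀)) :
    ∃ (N : PreQCoh A) (π' : Hom N P₀), Bundle 𝔟 r N ∧ IsReduction 𝔪 π' := by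
  obtain ⟨B, κ, β, hκβ, hB, hBt⟩ := Bundle.exists_local_lift (c := c) hA hs hM hπ h𝔞
  have hηM := η_injective hc M
  have hYst : ∀ {i j : I} (h : i ≤ j) (m : B.M j),
      m ∈ (LinearMap.range ((η c M).app j)).comap (β.app j) →
      B.ρ h m ∈ (LinearMap.range ((η c M).app i)).comap (β.app i) := by
    rintro i j h m ⟨x, hx⟩
    refine ⟨M.ρ h x, ?_⟩
    rw [(η c M).comm, hx, β.comm]
  let Y := B.sub (fun i => (LinearMap.range ((η c M).app i)).comap (β.app i)) hYst
  let yι : Hom Y B := B.subι (fun i => (LinearMap.range ((η c M).app i)).comap (β.app i)) hYst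
  have hyι : ∀ i, Function.Injective (yι.app i) := fun i => Subtype.val_injective
  obtain ⟨pr, hpr⟩ := exists_lift (η c M) hηM (β.comp yι) (fun i y => y.2)
  obtain ⟨κ', hκ'⟩ := exists_lift yι hyι κ (fun i x =>
    ⟨⟨κ.app i x, 0, by rw [map_zero, hκβ.zero]⟩, rfl⟩)
  have hprκ : ∀ i x, pr.app i (κ'.app i x) = 0 := by
    intro i x
    apply hηM
    rw [hpr, Hom.comp_app, hκ', hκβ.zero, map_zero]
  have hκ'inj : ∀ i, Function.Injective (κ'.app i) := by
    intro i x y hxy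
    apply hκβ.inj i
    rw [← hκ', ← hκ', hxy]
  have hprsurj : ∀ i, Function.Surjective (pr.app i) := by
    intro i m
    obtain ⟨y, hy⟩ := hκβ.surj i ((η c M).app i m)
    refine ⟨⟨y, m, hy.symm⟩, hηM i ?_⟩
    rw [hpr]; exact hy
  have hprex : ∀ i y, pr.app i y = 0 → ∃ x, κ'.app i x = y := by
    intro i y hy
    obtain ⟨x, hx⟩ := hκβ.exact i (yι.app i y) (by
      rw [← Hom.comp_app, ← hpr, hy, map_zero])
    exact ⟨x, hyι i (by rw [hκ', hx])⟩
  have hYt : ∀ i y, t • y = κ'.app i ((η c P₀).app i (π.app i (pr.app i y))) := by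
    intro i y
    apply hyι i
    rw [yι.app_base, hBt, hκ', ← η_natural, hpr, Hom.comp_app]
  have hY𝔟 : Torsion 𝔟 Y := fun a ha i y => hyι i (by rw [yι.app_base, hB a ha, map_zero])
  have hQst : ∀ {i j : I} (h : i ≤ j) (m : Y.M j),
      m ∈ LinearMap.range ((κ'.comp (η c P₀)).app j) →
      Y.ρ h m ∈ LinearMap.range ((κ'.comp (η c P₀)).app i) := by
    rintro i j h _ ⟨x, rfl⟩
    exact ⟨P₀.ρ h x, (κ'.comp (η c P₀)).comm h x⟩
  let Q := Y.quot (fun i => LinearMap.range ((κ'.comp (η c P₀)).app i)) hQst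
  let q : Hom Y Q := Y.quotπ (fun i => LinearMap.range ((κ'.comp (η c P₀)).app i)) hQst
  have hq : ∀ i, Function.Surjective (q.app i) := fun i => Submodule.mkQ_surjective _
  have hq0 : ∀ i y, q.app i y = 0 ↔ ∃ x, κ'.app i ((η c P₀).app i x) = y := fun i y =>
    Submodule.Quotient.mk_eq_zero _
  obtain ⟨pr', hpr'⟩ := exists_desc q hq pr (fun i y hy => by
    obtain ⟨x, rfl⟩ := (hq0 i y).1 hy
    exact hprκ _ _)
  obtain ⟨f, hf⟩ := exists_desc (Kπ c P₀) (Kπ_surjective c P₀) (q.comp κ') (fun i x hx => by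
    obtain ⟨p, rfl⟩ := (Kπ_eq_zero c P₀ i x).1 hx
    exact (hq0 i _).2 ⟨p, rfl⟩)
  have hSES : ShortExact f pr' := by
    refine ⟨fun i => ?_, fun i m => ?_, fun i x => ?_, fun i y hy => ?_⟩
    · rw [injective_iff_map_eq_zero]
      intro x hx
      obtain ⟨x, rfl⟩ := Kπ_surjective c P₀ i x
      rw [hf, Hom.comp_app, hq0] at hx
      obtain ⟨p, hp⟩ := hx
      exact (Kπ_eq_zero c P₀ i x).2 ⟨p, hκ'inj i hp⟩
    · obtain ⟨y, rfl⟩ := hprsurj i m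
      exact ⟨q.app i y, hpr' i y⟩
    · obtain ⟨x, rfl⟩ := Kπ_surjective c P₀ i x
      rw [hf, Hom.comp_app, hpr', hprκ]
    · obtain ⟨y, rfl⟩ := hq i y
      rw [hpr'] at hy
      obtain ⟨x, rfl⟩ := hprex i y hy
      exact ⟨(Kπ c P₀).app i x, hf i x⟩
  have hQ : Torsion 𝔞 Q := by
    intro a ha i y
    obtain ⟨y, rfl⟩ := hq i y
    obtain ⟨b, hb⟩ := hs.exists_sub a ha
    have h1 : a • y = t • (b • y) := by
      rw [← sub_eq_zero]
      refine Eq.trans ?_ (hY𝔟 _ hb i y)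
      exact ((congrArg (a • y - ·) (smul_smul t b y)).trans (sub_smul a (t * b) y).symm).trans
        (by rw [mul_comm])
    rw [← q.app_base, h1, hYt]
    exact (hq0 i _).2 ⟨_, rfl⟩
  obtain ⟨s, hs'⟩ := hSES.homSurj hc (hM.homSurj_J hQ pr' hSES.surj)
    (h₀.of_torsion π hπ.surj (fun i x => (hπ.ker i x).1) hπ.torsion.K.K) (Hom.id M)
  -- the preimage in `Y` of the image of `s` is the equalizer of `Y → Q` and `Y → M → Q`
  have hNst : ∀ {i j : I} (h : i ≤ j) (m : Y.M j),
      m ∈ LinearMap.ker ((q - s.comp pr).app j) →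
      Y.ρ h m ∈ LinearMap.ker ((q - s.comp pr).app i) := by
    intro i j h m hm
    rw [LinearMap.mem_ker, (q - s.comp pr).comm, LinearMap.mem_ker.1 hm, map_zero]
  let N := Y.sub (fun i => LinearMap.ker ((q - s.comp pr).app i)) hNst
  let nι : Hom N Y := Y.subι (fun i => LinearMap.ker ((q - s.comp pr).app i)) hNst
  have hnι : ∀ i, Function.Injective (nι.app i) := fun i => Subtype.val_injective
  have hN : ∀ i y, (∃ n, nι.app i n = y) ↔ q.app i y = s.app i (pr.app i y) := by
    intro i y
    rw [← sub_eq_zero]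
    exact ⟨fun ⟨n, hn⟩ => hn ▸ n.2, fun h => ⟨⟨y, h⟩, rfl⟩⟩
  obtain ⟨k, hk⟩ := exists_lift nι hnι (κ'.comp (η c P₀)) (fun i x => by
    rw [hN, Hom.comp_app, hprκ, map_zero, hq0]
    exact ⟨x, rfl⟩)
  have hN' : ∀ i n, q.app i (nι.app i n) = s.app i (pr.app i (nι.app i n)) := fun i n =>
    (hN i _).1 ⟨n, rfl⟩
  have hSES' : ShortExact k (pr.comp nι) := by
    refine ⟨fun i x y hxy => ?_, fun i m => ?_, fun i x => ?_, fun i n hn => ?_⟩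
    · apply η_injective hc P₀ i
      apply hκ'inj i
      rw [← Hom.comp_app, ← hk, hxy, hk, Hom.comp_app]
    · obtain ⟨y, rfl⟩ := hprsurj i m
      obtain ⟨x, hx⟩ := hSES.exact i (q.app i y - s.app i (pr.app i y)) (by
        rw [map_sub, hpr', hs', Hom.id_app, sub_self])
      obtain ⟨x, rfl⟩ := Kπ_surjective c P₀ i x
      rw [hf, Hom.comp_app] at hx
      obtain ⟨n, hn⟩ := (hN i (y - κ'.app i x)).2 (by
        rw [map_sub, hx, map_sub, hprκ, sub_zero, sub_sub_cancel])
      exact ⟨n, by rw [Hom.comp_app, hn, map_sub, hprκ, sub_zero]⟩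
    · rw [Hom.comp_app, hk, Hom.comp_app, hprκ]
    · rw [Hom.comp_app] at hn
      obtain ⟨p, hp⟩ := (hq0 i _).1 ((hN' i n).trans (by rw [hn, map_zero]))
      exact ⟨p, hnι i (by rw [hk, Hom.comp_app, hp])⟩
  have hNt : ∀ i y, t • y = k.app i (π.app i ((pr.comp nι).app i y)) := by
    intro i y
    apply hnι i
    rw [nι.app_base, hYt, hk, Hom.comp_app, Hom.comp_app]
  exact ⟨N, π.comp (pr.comp nι), Bundle.of_extension hs hSES' hM hπ
    (fun a ha i y => hnι i (by rw [nι.app_base, hY𝔟 a ha, map_zero])) h𝔞 hNt,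
    hπ.of_extension hs hSES' h𝔞 hNt⟩

/-- A vector bundle modulo the maximal ideal whose second cohomology vanishes lifts to a
vector bundle. -/
theorem Bundle.exists_lift [IsLocalRing R] [IsArtinianRing R] (hA : ∀ i, Module.Flat R (A.A i))
    (hc : Function.Surjective c) {r : ℕ} {P₀ : PreQCoh A}
    (hP₀ : Bundle (IsLocalRing.maximalIdeal R) r P₀) (h₀ : FirstVanish c P₀ (K c P₀)) :
    ∃ (N : PreQCoh A) (π : Hom N P₀),
      Bundle ⊥ r N ∧ IsReduction (IsLocalRing.maximalIdeal R) π := by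
  let s : Set (Ideal R) := {𝔞 | 𝔞 ≤ IsLocalRing.maximalIdeal R ∧
    ∃ (N : PreQCoh A) (π : Hom N P₀), Bundle 𝔞 r N ∧ IsReduction (IsLocalRing.maximalIdeal R) π}
  have hs : s.Nonempty := by
    refine ⟨_, le_rfl, P₀, Hom.id P₀, hP₀, fun i => Function.surjective_id, fun i x => ?_⟩
    refine ⟨fun h => ?_, fun h => NC.eq_zero_of_mem_smul_top (fun a ha n => hP₀.torsion a ha i n) h⟩
    rw [Hom.id_app] at h
    rw [h]; exact zero_mem _
  obtain ⟨𝔞, ⟨h𝔞, N, π, hN, hπ⟩, hmin⟩ := WellFounded.has_min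
    (r := fun a b : Ideal R => a < b) wellFounded_lt s hs
  by_cases h : 𝔞 = ⊥
  · exact ⟨N, π, h ▸ hN, hπ⟩
  · obtain ⟨𝔟, t, hlt, hst⟩ := exists_isStep h
    obtain ⟨N', π', hN', hπ'⟩ := hN.exists_lift_step hA hc hst hπ h𝔞 h₀
    exact absurd hlt (hmin 𝔟 ⟨hlt.le.trans h𝔞, N', π', hN', hπ'⟩)

end PreQCoh

/-! ### Products of modules over the stalks -/

namespace SheafGodement

open TopologicalSpace

variable {X : Scheme.{u}} (T : X → Type u) [∀ x, AddCommGroup (T x)]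
  [∀ x, Module (X.presheaf.stalk x) (T x)]

/-- The presheaf `U ↦ ∏_{x ∈ U} T_x` of abelian groups. -/
def presheaf : TopCat.Presheaf Ab.{u} X.carrier where
  obj U := AddCommGrpCat.of (∀ x : U.unop, T x)
  map i := AddCommGrpCat.ofHom (AddMonoidHom.mk' (fun s x => s ⟨x.1, i.unop.le x.2⟩)
    (fun _ _ => rfl))

noncomputable instance (U : (Opens X)ᵒᵖ) : Module (X.ringCatSheaf.obj.obj U) ((presheaf T).obj U) :=
  letI : ∀ x : U.unop, Module (X.presheaf.obj U) (T x) := fun x =>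
    Module.compHom _ (X.presheaf.germ U.unop x.1 x.2).hom
  inferInstanceAs (Module (X.presheaf.obj U) (∀ x : U.unop, T x))

/-- The sheaf of modules `U ↦ ∏_{x ∈ U} T_x`, for a family of modules `T_x` over the stalks. -/
noncomputable def sheaf : X.Modules where
  val := PresheafOfModules.ofPresheaf (R := X.ringCatSheaf.obj) (presheaf T) (fun U V f r m => by
    funext x
    exact congrArg (fun a : X.presheaf.stalk x.1 => a • (show T x.1 from m ⟨x.1, f.unop.le x.2⟩))
      (TopCat.Presheaf.germ_res_apply' X.presheaf f _ _ r).symm)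
  isSheaf := by
    change TopCat.Presheaf.IsSheaf (presheaf T)
    rw [TopCat.Presheaf.isSheaf_iff_isSheaf_comp (forget Ab)]
    exact TopCat.Presheaf.toTypes_isSheaf X.carrier T

/-- A section of `sheaf T` as a family. -/
def sec {U : X.Opens} (s : Γ(sheaf T, U)) (x : X) (hx : x ∈ U) : T x :=
  (show ∀ x : U, T x from s) ⟨x, hx⟩

/-- The section of `sheaf T` given by a family. -/
def mkSec {U : X.Opens} (s : ∀ x : X, x ∈ U → T x) : Γ(sheaf T, U) :=
  (show ∀ x : U, T x from fun x => s x.1 x.2)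

theorem sec_ext {U : X.Opens} {s t : Γ(sheaf T, U)} (h : ∀ x hx, sec T s x hx = sec T t x hx) :
    s = t := funext fun x => h x.1 x.2

theorem sec_add {U : X.Opens} (s t : Γ(sheaf T, U)) (x : X) (hx : x ∈ U) :
    sec T (s + t) x hx = sec T s x hx + sec T t x hx := rfl

theorem sec_smul {U : X.Opens} (r : Γ(X, U)) (s : Γ(sheaf T, U)) (x : X) (hx : x ∈ U) :
    sec T (r • s) x hx = X.presheaf.germ U x hx r • sec T s x hx := rfl

/-- The stalk of a sheaf of modules. -/
def stalk (M : X.Modules) (x : X) : Type u := ((M.presheaf.stalk x : Ab.{u}) : Type u)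

noncomputable instance (M : X.Modules) (x : X) : AddCommGroup (stalk M x) :=
  inferInstanceAs (AddCommGroup ((M.presheaf.stalk x : Ab.{u}) : Type u))

/-- The germ of a section. -/
noncomputable def germ (M : X.Modules) {U : X.Opens} (x : X) (hx : x ∈ U) : Γ(M, U) →+ stalk M x :=
  (TopCat.Presheaf.germ M.presheaf U x hx).hom

/-- The module structure of the stalk of a presheaf of modules over the commutative structure
sheaf. -/
noncomputable abbrev presheafStalkModule
    (N : PresheafOfModules.{u} (X.presheaf ⋙ forget₂ CommRingCat RingCat)) (x : X) :
    Module (X.presheaf.stalk x) ((TopCat.Presheaf.stalk N.presheaf x : Ab.{u}) : Type u) :=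
  inferInstance

noncomputable instance (M : X.Modules) (x : X) : Module (X.presheaf.stalk x) (stalk M x) :=
  presheafStalkModule M.val x

theorem germ_smul (M : X.Modules) {U : X.Opens} (x : X) (hx : x ∈ U) (r : Γ(X, U)) (m : Γ(M, U)) :
    germ M x hx (r • m) = X.presheaf.germ U x hx r • germ M x hx m :=
  PresheafOfModules.germ_smul (R := X.presheaf) M.val x U hx r m

theorem germ_map (M : X.Modules) {U V : X.Opens} (i : U ⟶ V) (x : X) (hx : x ∈ U) (m : Γ(M, V)) :
    germ M x hx (M.presheaf.map i.op m) = germ M x (i.le hx) m :=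
  TopCat.Presheaf.germ_res_apply M.presheaf i x hx m

theorem exists_germ (M : X.Modules) (x : X) (t : stalk M x) :
    ∃ (U : X.Opens) (hx : x ∈ U) (m : Γ(M, U)), germ M x hx m = t :=
  TopCat.Presheaf.exists_germ_eq M.presheaf t

theorem germ_eq_zero (M : X.Modules) {U : X.Opens} {x : X} {hx : x ∈ U} {m : Γ(M, U)}
    (h : germ M x hx m = 0) : ∃ (V : X.Opens) (i : V ⟶ U), x ∈ V ∧ M.presheaf.map i.op m = 0 := by
  obtain ⟨V, hV, i, j, h'⟩ := TopCat.Presheaf.germ_eq M.presheaf x hx hx m 0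
    (h.trans (map_zero (germ M x hx)).symm)
  exact ⟨V, i, hV, h'.trans (map_zero _)⟩

theorem app_map {M N : X.Modules} (g : M ⟶ N) {U V : X.Opens} (i : U ⟶ V) (m : Γ(M, V)) :
    g.app U (M.presheaf.map i.op m) = N.presheaf.map i.op (g.app V m) :=
  ConcreteCategory.congr_hom (g.mapPresheaf.naturality i.op) m

/-- The homomorphism to `sheaf T` given by linear maps on the stalks. -/
noncomputable def ofStalk (M : X.Modules) (f : ∀ x, stalk M x →ₗ[X.presheaf.stalk x] T x) :
    M ⟶ sheaf T where
  val := PresheafOfModules.homMk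
    { app := fun U => AddCommGrpCat.ofHom (AddMonoidHom.mk'
        (fun m => mkSec T (U := U.unop) fun x hx => f x (germ M x hx m))
        (fun m n => sec_ext T fun x hx => by
          exact (congrArg (f x) (map_add (germ M x hx) m n)).trans (map_add (f x) _ _)))
      naturality := fun U V i => by
        ext m
        refine sec_ext T fun x hx => ?_
        change f x (germ M x hx (M.presheaf.map i.unop.op m)) = f x (germ M x _ m)
        exact congrArg (f x) (germ_map M i.unop x hx m) }
    (fun U r m => sec_ext T fun x hx => by
      change f x (germ M x hx ((show Γ(X, U.unop) from r) • (show Γ(M, U.unop) from m))) =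
        X.presheaf.germ U.unop x hx r • f x (germ M x hx m)
      exact (congrArg (f x) (germ_smul M x hx _ _)).trans (map_smul (f x) _ _))

theorem exists_opens_le_le (U V : X.Opens) {x : X} (hU : x ∈ U) (hV : x ∈ V) :
    ∃ (W : X.Opens) (_ : W ⟶ U) (_ : W ⟶ V), x ∈ W :=
  ⟨U ⊓ V, homOfLE inf_le_left, homOfLE inf_le_right, hU, hV⟩

theorem exists_ring_germ (x : X) (r : X.presheaf.stalk x) :
    ∃ (U : X.Opens) (hx : x ∈ U) (a : Γ(X, U)), X.presheaf.germ U x hx a = r :=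
  TopCat.Presheaf.exists_germ_eq X.presheaf r

theorem ring_germ_map {U V : X.Opens} (i : U ⟶ V) (x : X) (hx : x ∈ U) (a : Γ(X, V)) :
    X.presheaf.germ U x hx (X.presheaf.map i.op a) = X.presheaf.germ V x (i.le hx) a :=
  TopCat.Presheaf.germ_res_apply X.presheaf i x hx a

variable {T} in
/-- A homomorphism `M → sheaf T` is given by linear maps `M_x → T_x` on the stalks. -/
theorem exists_stalk {M : X.Modules} (g : M ⟶ sheaf T) (x : X) :
    ∃ f : stalk M x →ₗ[X.presheaf.stalk x] T x, ∀ (U : X.Opens) (hx : x ∈ U) (m : Γ(M, U)),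
      f (germ M x hx m) = sec T (g.app U m) x hx := by
  let ev : ∀ (U : OpenNhds x), M.presheaf.obj (.op U.1) ⟶ AddCommGrpCat.of (T x) := fun U =>
    AddCommGrpCat.ofHom (AddMonoidHom.mk' (fun m => sec T (g.app U.1 m) x U.2) (fun m n => by
      exact (congrArg (fun s => sec T s x U.2) (map_add (g.app U.1).hom m n)).trans
        (sec_add T _ _ x U.2)))
  let c : Limits.Cocone ((OpenNhds.inclusion x).op ⋙ M.presheaf) :=
    { pt := AddCommGrpCat.of (T x)
      ι := { app := fun U => ev U.unop
             naturality := fun U V i => by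
              ext m
              exact congrArg (fun s => sec T s x V.unop.2)
                (app_map g ((OpenNhds.inclusion x).map i.unop) m) } }
  let F : TopCat.Presheaf.stalk M.presheaf x ⟶ AddCommGrpCat.of (T x) :=
    Limits.colimit.desc _ c
  have hF : ∀ (U : X.Opens) (hx : x ∈ U) (m : Γ(M, U)),
      F.hom (germ M x hx m) = sec T (g.app U m) x hx := fun U hx m =>
    ConcreteCategory.congr_hom (Limits.colimit.ι_desc c (.op ⟨U, hx⟩)) m
  refine ⟨{ F.hom with map_smul' := fun r m => ?_ }, hF⟩
  obtain ⟨U, hU, m, rfl⟩ := exists_germ M x m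
  obtain ⟨V, hV, r, rfl⟩ := exists_ring_germ x r
  obtain ⟨W, i, j, hW⟩ := exists_opens_le_le U V hU hV
  rw [← ring_germ_map j x hW, ← germ_map M i x hW, ← germ_smul]
  refine (hF _ _ _).trans ?_
  rw [Scheme.Modules.Hom.app_smul, sec_smul]
  exact congrArg (_ • ·) (hF _ _ _).symm

/-! ### Stalks and exactness -/

theorem eq_of_germ (M : X.Modules) {U : X.Opens} {m n : Γ(M, U)}
    (h : ∀ x hx, germ M x hx m = germ M x hx n) : m = n :=
  TopCat.Presheaf.section_ext ⟨M.presheaf, M.isSheaf⟩ U m n h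

theorem app_injective_of_mono {M N : X.Modules} (f : M ⟶ N) [Mono f] (U : X.Opens) :
    Function.Injective (f.app U) := by
  have h1 : Mono ((Scheme.Modules.toPresheaf X).map f) := inferInstance
  have h2 : Mono (((Scheme.Modules.toPresheaf X).map f).app (.op U)) := inferInstance
  exact (AddCommGrpCat.mono_iff_injective _).1 h2

/-- An epimorphism of sheaves of modules is locally surjective on sections: otherwise the
projections of the germs to the cokernels of the maps of stalks would be a nonzero homomorphism
that vanishes on the image. -/
theorem exists_local_lift_of_epi {M N : X.Modules} (f : M ⟶ N) [Epi f] {U : X.Opens}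
    (n : Γ(N, U)) (x : X) (hx : x ∈ U) :
    ∃ (V : X.Opens) (i : V ⟶ U) (m : Γ(M, V)), x ∈ V ∧ f.app V m = N.presheaf.map i.op n := by
  let L : ∀ x, Submodule (X.presheaf.stalk x) (stalk N x) := fun x => Submodule.span _
    {t | ∃ (V : X.Opens) (hx : x ∈ V) (m : Γ(M, V)), germ N x hx (f.app V m) = t}
  have hL : ∀ x, ∀ t ∈ L x, ∃ (V : X.Opens) (hx : x ∈ V) (m : Γ(M, V)),
      germ N x hx (f.app V m) = t := by
    intro x t ht
    induction ht using Submodule.span_induction with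
    | mem t ht => exact ht
    | zero => exact ⟨⊤, trivial, 0, by rw [map_zero, map_zero]⟩
    | add s t _ _ hs ht =>
      obtain ⟨V, hV, m, rfl⟩ := hs
      obtain ⟨W, hW, n, rfl⟩ := ht
      obtain ⟨Z, i, j, hZ⟩ := exists_opens_le_le V W hV hW
      refine ⟨Z, hZ, M.presheaf.map i.op m + M.presheaf.map j.op n, ?_⟩
      rw [map_add, map_add, app_map, app_map, germ_map, germ_map]
    | smul r t _ ht =>
      obtain ⟨U, hU, m, rfl⟩ := ht
      obtain ⟨V, hV, r, rfl⟩ := exists_ring_germ x r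
      obtain ⟨Z, i, j, hZ⟩ := exists_opens_le_le U V hU hV
      refine ⟨Z, hZ, X.presheaf.map j.op r • M.presheaf.map i.op m, ?_⟩
      rw [Scheme.Modules.Hom.app_smul, germ_smul, app_map, germ_map, ring_germ_map]
  let q := ofStalk (fun x => stalk N x ⧸ L x) N (fun x => (L x).mkQ)
  have hq : q = 0 := by
    rw [← cancel_epi f, Limits.comp_zero]
    refine Scheme.Modules.hom_ext _ _ fun V => ?_
    ext m
    refine sec_ext _ fun y hy => (Submodule.Quotient.mk_eq_zero _).2 ?_
    exact Submodule.subset_span ⟨V, hy, m, rfl⟩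
  have h1 : germ N x hx n ∈ L x := by
    rw [← Submodule.Quotient.mk_eq_zero]
    exact congrArg (fun g : N ⟶ _ => sec _ (g.app U n) x hx) hq
  obtain ⟨V, hV, m, hm⟩ := hL x _ h1
  obtain ⟨W, hW, i, j, h⟩ := TopCat.Presheaf.germ_eq N.presheaf x hV hx _ _ hm
  exact ⟨W, j, M.presheaf.map i.op m, hW, (app_map f i m).trans h⟩

/-! ### Injective modules and embeddings -/

/-- A homomorphism to `∏ T_x` is a family of linear maps on the stalks, and each of these extends
along monomorphisms. -/
theorem injective_sheaf (hT : ∀ x, Module.Injective (X.presheaf.stalk x) (T x)) :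
    Injective (sheaf T) where
  factors {M N} g f _ := by
    choose gx hg using exists_stalk g
    let fx : ∀ x, ∃ h : stalk M x →ₗ[X.presheaf.stalk x] stalk N x,
        ∀ (U : X.Opens) (hx : x ∈ U) (m : Γ(M, U)),
          h (germ M x hx m) = germ N x hx (f.app U m) := by
      exact fun x => exists_stalk (f ≫ ofStalk (fun x => stalk N x) N (fun x => LinearMap.id)) x
    choose fx hf using fx
    have hinj : ∀ x, Function.Injective (fx x) := by
      intro x
      rw [injective_iff_map_eq_zero]
      intro t ht
      obtain ⟨U, hU, m, rfl⟩ := exists_germ M x t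
      rw [hf] at ht
      obtain ⟨V, i, hV, h⟩ := germ_eq_zero N ht
      rw [← app_map] at h
      have := app_injective_of_mono f V (h.trans (map_zero _).symm)
      rw [← germ_map M i x hV, this, map_zero]
    choose k hk using fun x => (hT x).out (fx x) (hinj x) (gx x)
    refine ⟨ofStalk T N k, ?_⟩
    refine Scheme.Modules.hom_ext _ _ fun V => ?_
    ext m
    refine sec_ext _ fun y hy => ?_
    change k y (germ N y hy (f.app V m)) = _
    rw [← hf, hk, hg]

/-- Every sheaf of modules embeds into a sheaf `∏ T_x` of injective modules. -/
theorem exists_embedding (M : X.Modules) :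
    ∃ (T : X → Type u) (_ : ∀ x, AddCommGroup (T x)) (_ : ∀ x, Module (X.presheaf.stalk x) (T x))
      (f : M ⟶ sheaf T), (∀ x, Module.Injective (X.presheaf.stalk x) (T x)) ∧ Mono f := by
  let J : ∀ x, ModuleCat.{u} (X.presheaf.stalk x) := fun x =>
    Injective.under (ModuleCat.of (X.presheaf.stalk x) (stalk M x))
  let j : ∀ x, stalk M x →ₗ[X.presheaf.stalk x] J x := fun x =>
    (Injective.ι (ModuleCat.of (X.presheaf.stalk x) (stalk M x))).hom
  have hj : ∀ x, Function.Injective (j x) := fun x => (ModuleCat.mono_iff_injective _).1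
    (inferInstance : Mono (Injective.ι (ModuleCat.of (X.presheaf.stalk x) (stalk M x))))
  refine ⟨fun x => J x, fun x => inferInstance, fun x => inferInstance,
    ofStalk _ M j, fun x => ?_, ?_⟩
  · have : Injective (J x) := inferInstance
    exact Module.injective_module_of_injective_object _ _
  · have : Mono ((Scheme.Modules.toPresheaf X).map (ofStalk (fun x => J x) M j)) := by
      rw [NatTrans.mono_iff_mono_app]
      intro U
      refine (AddCommGrpCat.mono_iff_injective _).2 fun m n h => ?_
      refine eq_of_germ M fun x hx => hj x ?_
      exact congrArg (fun s => sec (fun x => J x) (U := U.unop) s x hx) h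
    exact (Scheme.Modules.toPresheaf X).mono_of_mono_map this

end SheafGodement

/-! ### Dimension shifting for Ext groups -/

section ExtShift

variable {C : Type v} [Category.{w} C] [Abelian C] {S : ShortComplex C} (hS : S.ShortExact) (P : C)
include hS

theorem CategoryTheory.ShortComplex.ShortExact.exists_lift_of_extVanishes
    (h : ExtVanishes P S.X₁ 1) (t : P ⟶ S.X₃) : ∃ s : P ⟶ S.X₂, s ≫ S.g = t := by
  let : HasExt.{max v w} C := HasExt.standard C
  have : Subsingleton (Abelian.Ext P S.X₁ 1) := h
  obtain ⟨x, hx⟩ := Abelian.Ext.covariant_sequence_exact₃ P hS (Abelian.Ext.mk₀ t) (n₁ := 1)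
    rfl (Subsingleton.elim _ _)
  obtain ⟨s, rfl⟩ := (Abelian.Ext.mk₀_bijective _ _).2 x
  refine ⟨s, (Abelian.Ext.mk₀_bijective _ _).1 ?_⟩
  rw [← hx, Abelian.Ext.mk₀_comp_mk₀]

theorem CategoryTheory.ShortComplex.ShortExact.extVanishes_right [Injective S.X₂] {p : ℕ}
    (hp : 0 < p) (h : ExtVanishes P S.X₁ (p + 1)) : ExtVanishes P S.X₃ p := by
  let : HasExt.{max v w} C := HasExt.standard C
  have : Subsingleton (Abelian.Ext P S.X₁ (p + 1)) := h
  obtain ⟨n, rfl⟩ : ∃ n, p = n + 1 := ⟨p - 1, by omega⟩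
  refine ⟨fun x y => ?_⟩
  have key : ∀ x : Abelian.Ext P S.X₃ (n + 1), x = 0 := by
    intro x
    obtain ⟨y, rfl⟩ := Abelian.Ext.covariant_sequence_exact₃ P hS x rfl (Subsingleton.elim _ _)
    rw [Abelian.Ext.eq_zero_of_injective y, Abelian.Ext.zero_comp]
  rw [key x, key y]

theorem CategoryTheory.ShortComplex.ShortExact.extVanishes_left [Injective S.X₂] {p : ℕ}
    (h : ExtVanishes P S.X₃ p) : ExtVanishes P S.X₁ (p + 1) := by
  let : HasExt.{max v w} C := HasExt.standard C
  have : Subsingleton (Abelian.Ext P S.X₃ p) := h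
  refine ⟨fun x y => ?_⟩
  have key : ∀ x : Abelian.Ext P S.X₁ (p + 1), x = 0 := by
    intro x
    obtain ⟨y, rfl⟩ := Abelian.Ext.covariant_sequence_exact₁ P hS x
      (Abelian.Ext.eq_zero_of_injective _) rfl
    rw [Subsingleton.elim y 0, Abelian.Ext.zero_comp]
  rw [key x, key y]

/-- `Ext¹(P, X₁)` is the cokernel of `Hom(P, X₂) → Hom(P, X₃)` for an injective object `X₂`. -/
theorem CategoryTheory.ShortComplex.ShortExact.extVanishes_one [Injective S.X₂]
    (h : ∀ t : P ⟶ S.X₃, ∃ s : P ⟶ S.X₂, s ≫ S.g = t) : ExtVanishes P S.X₁ 1 := by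
  let : HasExt.{max v w} C := HasExt.standard C
  refine ⟨fun x y => ?_⟩
  have key : ∀ x : Abelian.Ext P S.X₁ 1, x = 0 := by
    intro x
    obtain ⟨y, rfl⟩ := Abelian.Ext.covariant_sequence_exact₁ P hS x
      (Abelian.Ext.eq_zero_of_injective _) (n₀ := 0) rfl
    obtain ⟨t, rfl⟩ := (Abelian.Ext.mk₀_bijective _ _).2 y
    obtain ⟨s, rfl⟩ := h t
    rw [← Abelian.Ext.mk₀_comp_mk₀, Abelian.Ext.comp_assoc_of_second_deg_zero,
      hS.comp_extClass, Abelian.Ext.comp_zero]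
  rw [key x, key y]

end ExtShift

/-! ### Gluing sections of sheaves of modules -/

namespace AlgebraicGeometry.Scheme.Modules

open SheafGodement

variable {X : Scheme.{u}}

/-- The restriction of sections of a sheaf of modules. -/
noncomputable def res (M : X.Modules) {U V : X.Opens} (h : U ≤ V) : Γ(M, V) →+ Γ(M, U) :=
  (M.presheaf.map (homOfLE h).op).hom

theorem res_res (M : X.Modules) {U V W : X.Opens} (h : U ≤ V) (h' : V ≤ W) (m : Γ(M, W)) :
    M.res h (M.res h' m) = M.res (h.trans h') m :=
  (ConcreteCategory.congr_hom (M.presheaf.map_comp (homOfLE h').op (homOfLE h).op) m).symm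

theorem res_self (M : X.Modules) {U : X.Opens} (h : U ≤ U) (m : Γ(M, U)) : M.res h m = m :=
  ConcreteCategory.congr_hom (M.presheaf.map_id (.op U)) m

theorem app_res {M N : X.Modules} (f : M ⟶ N) {U V : X.Opens} (h : U ≤ V) (m : Γ(M, V)) :
    f.app U (M.res h m) = N.res h (f.app V m) := app_map f (homOfLE h) m

/-- The restriction of functions. -/
noncomputable def ringRes {U V : X.Opens} (h : U ≤ V) : Γ(X, V) →+* Γ(X, U) :=
  (X.presheaf.map (homOfLE h).op).hom

theorem ringRes_ringRes {U V W : X.Opens} (h : U ≤ V) (h' : V ≤ W) (a : Γ(X, W)) :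
    ringRes h (ringRes h' a) = ringRes (h.trans h') a :=
  (ConcreteCategory.congr_hom (X.presheaf.map_comp (homOfLE h').op (homOfLE h).op) a).symm

theorem res_smul (M : X.Modules) {U V : X.Opens} (h : U ≤ V) (a : Γ(X, V)) (m : Γ(M, V)) :
    M.res h (a • m) = ringRes h a • M.res h m := M.map_smul (homOfLE h) a m

theorem eq_of_cover (M : X.Modules) {ι : Type*} {U : ι → X.Opens} {W : X.Opens}
    (h : ∀ i, U i ≤ W) (hW : W ≤ ⨆ i, U i) {m n : Γ(M, W)}
    (hmn : ∀ i, M.res (h i) m = M.res (h i) n) : m = n := by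
  refine eq_of_germ M fun x hx => ?_
  obtain ⟨i, hi⟩ := TopologicalSpace.Opens.mem_iSup.1 (hW hx)
  rw [← germ_map M (homOfLE (h i)) x hi, ← germ_map M (homOfLE (h i)) x hi]
  exact congrArg _ (hmn i)

theorem exists_glue (M : X.Modules) {ι : Type*} {U : ι → X.Opens} {W : X.Opens}
    (h : ∀ i, U i ≤ W) (hW : W ≤ ⨆ i, U i) (m : ∀ i, Γ(M, U i))
    (hm : ∀ i j, M.res (inf_le_left : U i ⊓ U j ≤ U i) (m i) =
      M.res (inf_le_right : U i ⊓ U j ≤ U j) (m j)) :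
    ∃ n : Γ(M, W), ∀ i, M.res (h i) n = m i := by
  obtain ⟨n, hn, -⟩ := TopCat.Sheaf.existsUnique_gluing' ⟨M.presheaf, M.isSheaf⟩ U W
    (fun i => homOfLE (h i)) hW m hm
  exact ⟨n, hn⟩

theorem exists_glue₂ (M : X.Modules) {U V W : X.Opens} (hU : U ≤ W) (hV : V ≤ W)
    (hW : W ≤ U ⊔ V) (m : Γ(M, U)) (n : Γ(M, V))
    (h : M.res (inf_le_left : U ⊓ V ≤ U) m = M.res (inf_le_right : U ⊓ V ≤ V) n) :
    ∃ s : Γ(M, W), M.res hU s = m ∧ M.res hV s = n := by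
  obtain ⟨s, hs⟩ := exists_glue M (U := fun b => cond b U V) (W := W)
    (fun b => by cases b <;> assumption)
    (hW.trans (sup_le (le_iSup (fun b => cond b U V) true) (le_iSup (fun b => cond b U V) false)))
    (fun b => match b with | true => m | false => n)
    (fun b b' => match b, b' with
      | true, true => rfl
      | true, false => h
      | false, true => by
        have h' := congrArg (M.res ((inf_comm V U).le : V ⊓ U ≤ U ⊓ V)) h
        rw [res_res, res_res] at h'
        exact h'.symm
      | false, false => rfl)
  exact ⟨s, hs true, hs false⟩

theorem eq_of_cover₂ (M : X.Modules) {U V W : X.Opens} (hU : U ≤ W) (hV : V ≤ W)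
    (hW : W ≤ U ⊔ V) {m n : Γ(M, W)} (h₁ : M.res hU m = M.res hU n)
    (h₂ : M.res hV m = M.res hV n) : m = n :=
  eq_of_cover M (U := fun b => cond b U V) (fun b => by cases b; exacts [hV, hU])
    (hW.trans (sup_le (le_iSup (fun b => cond b U V) true) (le_iSup (fun b => cond b U V) false)))
    (fun b => by cases b; exacts [h₂, h₁])

/-! ### Sections over affine open subsets -/

variable {I : Type w} [SemilatticeInf I] (𝒰 : AffineMeetCover X I)

/-- The sections of `N` over `D(g) ∩ D(1 - g)` are differences of sections over `D(g)` and
`D(1 - g)`, for all functions `g` on affine open subsets of the members of `𝒰`. -/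
def SectionsSplit (N : X.Modules) : Prop :=
  ∀ (i : I) (W : X.Opens), IsAffineOpen W → W ≤ 𝒰.U i → ∀ (g : Γ(X, W))
    (n : Γ(N, X.basicOpen g ⊓ X.basicOpen (1 - g))),
    ∃ (n₁ : Γ(N, X.basicOpen g)) (n₂ : Γ(N, X.basicOpen (1 - g))),
      n = N.res inf_le_left n₁ - N.res inf_le_right n₂

theorem le_basicOpen_sup {W : X.Opens} (g : Γ(X, W)) :
    W ≤ X.basicOpen g ⊔ X.basicOpen (1 - g) := by
  have := X.basicOpen_add_le g (1 - g)
  rwa [add_sub_cancel, X.basicOpen_one] at this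

variable {𝒰}

/-- If the sections of `N` split in the sense of `SectionsSplit`, then sections over affine open
subsets lift along epimorphisms with kernel `N`: the functions `a` such that a given section lifts
over `D(a)` form an ideal. -/
theorem SectionsSplit.surjective {N E N' : X.Modules} (hN : SectionsSplit 𝒰 N) (f : N ⟶ E)
    (p : E ⟶ N') [Epi p] (hfp : ∀ (U : X.Opens) (n : Γ(N, U)), p.app U (f.app U n) = 0)
    (hex : ∀ (U : X.Opens) (e : Γ(E, U)), p.app U e = 0 → ∃ n, f.app U n = e)
    {i : I} {W : X.Opens} (hW : IsAffineOpen W) (hWi : W ≤ 𝒰.U i) :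
    Function.Surjective (p.app W) := by
  intro s
  let Lifts : ∀ V : X.Opens, Prop := fun V =>
    ∃ (h : V ≤ W) (e : Γ(E, V)), p.app V e = N'.res h s
  have mono : ∀ V V' : X.Opens, V' ≤ V → Lifts V → Lifts V' := by
    rintro V V' h ⟨hV, e, he⟩
    exact ⟨h.trans hV, E.res h e, by rw [app_res, he, res_res]⟩
  have glue : ∀ (V : X.Opens) (hVW : V ≤ W) (hV : IsAffineOpen V) (g : Γ(X, V)),
      Lifts (X.basicOpen g) → Lifts (X.basicOpen (1 - g)) → Lifts V := by
    rintro V hVW hV g ⟨h₁, e₁, he₁⟩ ⟨h₂, e₂, he₂⟩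
    obtain ⟨n, hn⟩ := hex (X.basicOpen g ⊓ X.basicOpen (1 - g))
      (E.res inf_le_left e₁ - E.res inf_le_right e₂) (by
        rw [map_sub, app_res, app_res, he₁, he₂, res_res, res_res, sub_self])
    obtain ⟨n₁, n₂, rfl⟩ := hN i V hV (hVW.trans hWi) g n
    obtain ⟨e, h₁', h₂'⟩ := exists_glue₂ E (X.basicOpen_le g) (X.basicOpen_le (1 - g))
      (le_basicOpen_sup g) (e₁ - f.app _ n₁) (e₂ - f.app _ n₂) (by
        rw [map_sub, app_res, app_res] at hn
        rw [map_sub, map_sub, ← sub_eq_zero, sub_sub_sub_comm, hn, sub_self])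
    refine ⟨hVW, e, ?_⟩
    refine eq_of_cover₂ N' (X.basicOpen_le g) (X.basicOpen_le (1 - g)) (le_basicOpen_sup g) ?_ ?_
    · rw [← app_res, res_res, h₁', map_sub, hfp, sub_zero, he₁]
    · rw [← app_res, res_res, h₂', map_sub, hfp, sub_zero, he₂]
  let 𝔍 : Ideal Γ(X, W) :=
    { carrier := {a | Lifts (X.basicOpen a)}
      zero_mem' := by
        refine ⟨X.basicOpen_le _, 0, eq_of_germ N' fun x hx => ?_⟩
        rw [X.basicOpen_zero] at hx
        exact hx.elim
      smul_mem' := fun a b hb => mono _ _ (by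
        rw [smul_eq_mul, X.basicOpen_mul]; exact inf_le_right) hb
      add_mem' := by
        intro a b ha hb
        have hle := X.basicOpen_le (a + b)
        have hu : IsUnit (ringRes hle (a + b)) := RingedSpace.isUnit_res_basicOpen _ (a + b)
        obtain ⟨v, hv⟩ := hu.exists_right_inv
        have hb' : 1 - ringRes hle a * v = ringRes hle b * v := by
          rw [← hv, map_add]; ring
        have key : ∀ c : Γ(X, W), X.basicOpen (ringRes hle c * v) ≤ X.basicOpen c := by
          intro c
          rw [X.basicOpen_mul]
          refine inf_le_left.trans ?_
          exact (X.basicOpen_res c (homOfLE hle).op).le.trans inf_le_right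
        refine glue _ hle (hW.basicOpen _) (ringRes hle a * v) (mono _ _ (key a) ha) ?_
        rw [hb']
        exact mono _ _ (key b) hb }
  have htop : 𝔍 = ⊤ := by
    rw [← Ideal.span_eq 𝔍, ← hW.iSup_basicOpen_eq_self_iff]
    refine le_antisymm (iSup_le fun a => X.basicOpen_le _) fun x hx => ?_
    obtain ⟨V, h, e, hV, he⟩ := exists_local_lift_of_epi p s x hx
    obtain ⟨a, ha, hxa⟩ := hW.exists_basicOpen_le ⟨x, hV⟩ hx
    exact TopologicalSpace.Opens.mem_iSup.2 ⟨⟨a, mono _ _ ha ⟨h.le, e, he⟩⟩, hxa⟩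
  have h1 : (1 : Γ(X, W)) ∈ 𝔍 := htop ▸ trivial
  obtain ⟨h, e, he⟩ := mono _ W (X.basicOpen_one (U := W)).ge h1
  exact ⟨e, he.trans (res_self _ _ _)⟩

/-- A quotient of a flasque sheaf by a sheaf whose sections split has the same property. -/
theorem SectionsSplit.quotient {N E N' : X.Modules} (hN : SectionsSplit 𝒰 N) (f : N ⟶ E)
    (p : E ⟶ N') [Epi p] (hfp : ∀ (U : X.Opens) (n : Γ(N, U)), p.app U (f.app U n) = 0)
    (hex : ∀ (U : X.Opens) (e : Γ(E, U)), p.app U e = 0 → ∃ n, f.app U n = e)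
    (hE : ∀ (U V : X.Opens) (h : U ≤ V), Function.Surjective (E.res h)) :
    SectionsSplit 𝒰 N' := by
  intro i W hW hWi g n
  have haff : IsAffineOpen (X.basicOpen g ⊓ X.basicOpen (1 - g)) := by
    rw [← X.basicOpen_mul]; exact hW.basicOpen _
  obtain ⟨e, rfl⟩ := hN.surjective f p hfp hex haff
    (inf_le_left.trans ((X.basicOpen_le g).trans hWi)) n
  obtain ⟨e', rfl⟩ := hE _ _ (inf_le_left : X.basicOpen g ⊓ X.basicOpen (1 - g) ≤ _) e
  refine ⟨p.app _ e', 0, ?_⟩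
  rw [map_zero, sub_zero, app_res]

/-- On an affine open subset, functions on `D(g) ∩ D(1 - g)` are differences of functions on `D(g)`
and `D(1 - g)`. -/
theorem exists_ringRes_sub {W : X.Opens} (hW : IsAffineOpen W) (g : Γ(X, W))
    (c : Γ(X, X.basicOpen g ⊓ X.basicOpen (1 - g))) :
    ∃ (c₁ : Γ(X, X.basicOpen g)) (c₂ : Γ(X, X.basicOpen (1 - g))),
      c = ringRes inf_le_left c₁ - ringRes inf_le_right c₂ := by
  obtain ⟨V, hV⟩ : ∃ V, V = X.basicOpen g ⊓ X.basicOpen (1 - g) := ⟨_, rfl⟩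
  have hV' : V = X.basicOpen (g * (1 - g)) := by rw [hV, X.basicOpen_mul]
  have h₁ : V ≤ X.basicOpen g := hV.le.trans inf_le_left
  have h₂ : V ≤ X.basicOpen (1 - g) := hV.le.trans inf_le_right
  suffices ∀ c : Γ(X, V), ∃ (c₁ : Γ(X, X.basicOpen g)) (c₂ : Γ(X, X.basicOpen (1 - g))),
      c = ringRes h₁ c₁ - ringRes h₂ c₂ by
    subst hV; exact this c
  have hVW : V ≤ W := h₁.trans (X.basicOpen_le g)
  intro c
  -- `c` is a fraction with denominator `(g (1 - g)) ^ n`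
  obtain ⟨n, a, ha⟩ : ∃ (n : ℕ) (a : Γ(X, W)),
      c * ringRes hVW (g * (1 - g)) ^ n = ringRes hVW a := by
    subst hV'
    have := hW.isLocalization_basicOpen (g * (1 - g))
    obtain ⟨n, a, ha⟩ := IsLocalization.Away.surj (g * (1 - g)) c
    exact ⟨n, a, ha⟩
  obtain ⟨u, v, huv⟩ : IsCoprime (g ^ n) ((1 - g) ^ n) :=
    IsCoprime.pow ⟨1, 1, by ring⟩
  have hu : ∀ g : Γ(X, W), IsUnit (ringRes (X.basicOpen_le g) g) := fun g =>
    RingedSpace.isUnit_res_basicOpen _ g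
  obtain ⟨w₁, hw₁⟩ := ((hu g).pow n).exists_right_inv
  obtain ⟨w₂, hw₂⟩ := ((hu (1 - g)).pow n).exists_right_inv
  refine ⟨ringRes (X.basicOpen_le g) (v * a) * w₁,
    -(ringRes (X.basicOpen_le (1 - g)) (u * a) * w₂), ?_⟩
  have hw₁' := congrArg (ringRes h₁) hw₁
  have hw₂' := congrArg (ringRes h₂) hw₂
  have huv' := congrArg (ringRes hVW) huv
  simp only [map_mul, map_pow, map_one, map_add, map_neg, ringRes_ringRes] at hw₁' hw₂' huv' ha ⊢
  rw [← ha]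
  linear_combination (-c) * huv' - c * ringRes hVW v * ringRes hVW (1 - g) ^ n * hw₁' -
    c * ringRes hVW u * ringRes hVW g ^ n * hw₂'

end AlgebraicGeometry.Scheme.Modules

/-! ### Bases of locally free sheaves -/

namespace AlgebraicGeometry.Scheme.Modules

open SheafGodement

theorem sum_app {X : Scheme.{u}} {M N : X.Modules} {κ : Type*} (s : Finset κ) (f : κ → (M ⟶ N))
    {U : X.Opens} (m : Γ(M, U)) : (∑ a ∈ s, f a).app U m = ∑ a ∈ s, (f a).app U m := by
  classical
  induction s using Finset.induction_on with
  | empty => rw [Finset.sum_empty, Finset.sum_empty]; rfl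
  | insert a s ha ih => rw [Finset.sum_insert ha, Finset.sum_insert ha, ← ih]; rfl

/-- The structure sheaf as a sheaf of modules. -/
noncomputable def unit (Y : Scheme.{u}) : Y.Modules := SheafOfModules.unit Y.ringCatSheaf

/-- The section `1` of the structure sheaf. -/
def unitOne (Y : Scheme.{u}) (W : Y.Opens) : Γ(unit Y, W) := (1 : Γ(Y, W))

theorem unit_res_one {Y : Scheme.{u}} {W V : Y.Opens} (h : W ≤ V) :
    (unit Y).res h (unitOne Y V) = unitOne Y W :=
  map_one (ringRes (X := Y) h)

theorem unit_bijective {Y : Scheme.{u}} (W : Y.Opens) :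
    Function.Bijective (fun c : Γ(Y, W) => c • unitOne Y W) := by
  have h : ∀ c : Γ(Y, W), c • unitOne Y W = (show Γ(unit Y, W) from c) := fun c => mul_one c
  exact ⟨fun c d hcd => (h c).symm.trans (hcd.trans (h d)), fun s => ⟨s, h s⟩⟩

/-- The images of the standard basis, and the coordinates, come from the inclusions and the
projections of the biproduct. -/
theorem exists_basis_of_iso_free {Y : Scheme.{u}} {r : ℕ} (G : Y.Modules)
    (φ : G ≅ (SheafOfModules.free (ULift.{u} (Fin r)) : Y.Modules)) :
    ∃ e : Fin r → Γ(G, ⊤), ∀ W : Y.Opens, Function.Bijective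
      (fun c : Fin r → Γ(Y, W) => ∑ a, c a • G.res (le_top : W ≤ ⊤) (e a)) := by
  classical
  let Z : ULift.{u} (Fin r) → Y.Modules := fun _ => unit Y
  let φ' : G ≅ ∐ Z := φ
  let ι : Fin r → (unit Y ⟶ G) := fun a => Limits.Sigma.ι Z ⟨a⟩ ≫ φ'.inv
  let π : Fin r → (G ⟶ unit Y) := fun a => φ'.hom ≫ Limits.Sigma.π Z ⟨a⟩
  have hιπ : ∀ a b, ι a ≫ π b = if a = b then 𝟙 (unit Y) else 0 := by
    intro a b
    have : ι a ≫ π b = Limits.Sigma.ι Z ⟨a⟩ ≫ Limits.Sigma.π Z ⟨b⟩ := by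
      simp only [ι, π, Category.assoc, Iso.inv_hom_id_assoc]
    rw [this]
    split_ifs with h
    · subst h; exact Limits.Sigma.ι_π_eq_id Z _
    · exact Limits.Sigma.ι_π_of_ne Z fun h' => h (congrArg ULift.down h')
  have hπι : ∑ a, π a ≫ ι a = 𝟙 G := by
    rw [← cancel_epi φ'.inv, ← cancel_mono φ'.hom]
    refine Limits.Sigma.hom_ext _ _ fun ⟨a⟩ => ?_
    simp only [Preadditive.comp_sum, Preadditive.sum_comp, Category.comp_id, Iso.inv_hom_id]
    rw [Finset.sum_eq_single a]
    · simp only [ι, π, Category.assoc, Iso.inv_hom_id_assoc, Iso.inv_hom_id, Category.comp_id]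
      rw [← Category.assoc, Limits.Sigma.ι_π_eq_id, Category.id_comp]
    · intro b _ hb
      simp only [ι, π, Category.assoc, Iso.inv_hom_id_assoc, Iso.inv_hom_id, Category.comp_id]
      rw [← Category.assoc, Limits.Sigma.ι_π_of_ne Z fun h' => hb (congrArg ULift.down h').symm,
        Limits.zero_comp]
    · simp
  refine ⟨fun a => (ι a).app ⊤ (unitOne Y ⊤), fun W => ?_⟩
  have key : ∀ c : Fin r → Γ(Y, W),
      ∑ a, c a • G.res (le_top : W ≤ ⊤) ((ι a).app ⊤ (unitOne Y ⊤)) =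
        ∑ a, (ι a).app W (c a • unitOne Y W) := fun c => by
    refine Finset.sum_congr rfl fun a _ => ?_
    rw [← app_res, unit_res_one, Hom.app_smul]
  have hπ : ∀ (c : Fin r → Γ(Y, W)) (b : Fin r),
      (π b).app W (∑ a, (ι a).app W (c a • unitOne Y W)) = c b • unitOne Y W := by
    intro c b
    rw [map_sum]
    have : ∀ a, (π b).app W ((ι a).app W (c a • unitOne Y W)) =
        if a = b then c a • unitOne Y W else 0 := fun a => by
      have := congrArg (fun f : unit Y ⟶ unit Y => f.app W (c a • unitOne Y W)) (hιπ a b)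
      refine Eq.trans this ?_
      split_ifs <;> rfl
    rw [Finset.sum_congr rfl fun a _ => this a, Finset.sum_ite_eq' Finset.univ b]
    simp
  constructor
  · intro c d hcd
    simp only [key] at hcd
    funext b
    apply (unit_bijective W).1
    change c b • unitOne Y W = d b • unitOne Y W
    rw [← hπ, hcd, hπ]
  · intro s
    choose c hc using fun a => (unit_bijective W).2 ((π a).app W s)
    refine ⟨c, (key c).trans ?_⟩
    have := congrArg (fun f : G ⟶ G => f.app W s) hπι
    refine Eq.trans ?_ this
    rw [sum_app]
    refine Finset.sum_congr rfl fun a _ => ?_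
    exact congrArg _ (hc a)

end AlgebraicGeometry.Scheme.Modules

open AlgebraicGeometry.Scheme.Modules SheafGodement in
theorem IsLocallyFreeOn.exists_basis {X : Scheme.{u}} {I : Type w} [SemilatticeInf I]
    {𝒰 : AffineMeetCover X I} {F₀ : X.Modules} {r : ℕ} (h : IsLocallyFreeOn 𝒰 F₀ r) (i : I) :
    ∃ e : Fin r → Γ(F₀, 𝒰.U i), ∀ (W : X.Opens) (hW : W ≤ 𝒰.U i), Function.Bijective
      (fun c : Fin r → Γ(X, W) => ∑ a, c a • F₀.res hW (e a)) := by
  obtain ⟨φ⟩ := h i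
  obtain ⟨e, he⟩ := exists_basis_of_iso_free _ φ
  let ι := (𝒰.U i).ι
  have htop : 𝒰.U i ≤ ι ''ᵁ ⊤ := (Scheme.Opens.ι_image_top _).ge
  refine ⟨fun a => F₀.res htop (show Γ(F₀, ι ''ᵁ ⊤) from e a), fun W hW => ?_⟩
  obtain ⟨W, rfl⟩ : ∃ W', W = ι ''ᵁ W' := ⟨ι ⁻¹ᵁ W, by
    rw [Scheme.Hom.image_preimage_eq_opensRange_inf]; simp [ι, hW]⟩
  have hsmul : ∀ (c : Γ((𝒰.U i).toScheme, W)) (m : Γ(F₀.restrict ι, W)),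
      c • m = (show Γ(X, ι ''ᵁ W) from c) • (show Γ(F₀, ι ''ᵁ W) from m) := by
    intro c m
    have h₁ : (ι.appIso W).inv c = (show Γ(X, ι ''ᵁ W) from c) := by
      rw [Scheme.Opens.ι_appIso]; rfl
    exact congrArg (fun a : Γ(X, ι ''ᵁ W) => a • (show Γ(F₀, ι ''ᵁ W) from m)) h₁
  have hres : ∀ a, F₀.res hW (F₀.res htop (show Γ(F₀, ι ''ᵁ ⊤) from e a)) =
      (show Γ(F₀, ι ''ᵁ W) from (F₀.restrict ι).res le_top (e a)) := fun a => by
    rw [res_res]; rfl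
  have key : (fun c : Fin r → Γ(X, ι ''ᵁ W) =>
      ∑ a, c a • F₀.res hW (F₀.res htop (show Γ(F₀, ι ''ᵁ ⊤) from e a))) =
      (show (Fin r → Γ(X, ι ''ᵁ W)) → Γ(F₀, ι ''ᵁ W) from
        fun c : Fin r → Γ((𝒰.U i).toScheme, W) =>
          ∑ a, c a • (F₀.restrict ι).res (le_top : W ≤ ⊤) (e a)) := by
    funext c
    refine Finset.sum_congr rfl fun a _ => ?_
    rw [hres]
    exact (hsmul _ _).symm
  rw [key]
  exact he W

namespace AlgebraicGeometry.Scheme.Modules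

theorem SectionsSplit.of_isLocallyFreeOn {X : Scheme.{u}} {I : Type w} [SemilatticeInf I]
    {𝒰 : AffineMeetCover X I} {F₀ : X.Modules} {r : ℕ} (h : IsLocallyFreeOn 𝒰 F₀ r) :
    SectionsSplit 𝒰 F₀ := by
  intro i W hW hWi g n
  obtain ⟨e, he⟩ := h.exists_basis i
  have h₀ : X.basicOpen g ⊓ X.basicOpen (1 - g) ≤ 𝒰.U i :=
    inf_le_left.trans ((X.basicOpen_le g).trans hWi)
  obtain ⟨c, rfl⟩ := (he _ h₀).2 n
  choose c₁ c₂ hc using fun a => exists_ringRes_sub hW g (c a)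
  refine ⟨∑ a, c₁ a • F₀.res ((X.basicOpen_le g).trans hWi) (e a),
    ∑ a, c₂ a • F₀.res ((X.basicOpen_le _).trans hWi) (e a), ?_⟩
  simp only [map_sum, res_smul, res_res]
  rw [← Finset.sum_sub_distrib]
  refine Finset.sum_congr rfl fun a _ => ?_
  rw [← sub_smul, ← hc]

end AlgebraicGeometry.Scheme.Modules

section

open AlgebraicGeometry.Scheme.Modules SheafGodement

/-- Left exactness of the functor of sections. -/
theorem AlgebraicGeometry.Scheme.Modules.exists_of_app_eq_zero {X : Scheme.{u}}
    {S : ShortComplex X.Modules} (hS : S.ShortExact)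
    {U : X.Opens} (e : Γ(S.X₂, U)) (he : S.g.app U e = 0) : ∃ n, S.f.app U n = e := by
  have hf := hS.mono_f
  let F : X.Modules ⥤ Ab := Scheme.Modules.toPresheaf X ⋙
    (CategoryTheory.evaluation _ _).obj (.op U)
  have : F.PreservesZeroMorphisms := ⟨fun _ _ => rfl⟩
  have : Limits.PreservesLimitsOfShape Limits.WalkingParallelPair F :=
    have : Limits.PreservesLimitsOfShape Limits.WalkingParallelPair
        ((CategoryTheory.evaluation X.Opensᵒᵖ Ab.{u}).obj (.op U)) :=
      Limits.evaluation_preservesLimitsOfShape _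
    Limits.comp_preservesLimitsOfShape (Scheme.Modules.toPresheaf X)
      ((CategoryTheory.evaluation X.Opensᵒᵖ Ab.{u}).obj (.op U))
  have h := hS.exact.map_of_mono_of_preservesKernel F hf inferInstance
  rw [ShortComplex.ab_exact_iff] at h
  exact h e he

/-! ### The presheaf of sections of a sheaf of modules -/

namespace NCDeformation

variable {k : Type u} [Field k] {X : Scheme.{u}} {f : X ⟶ Spec (.of k)}
  {I : Type w} [SemilatticeInf I] {𝒰 : AffineMeetCover X I}
  {R : Type u} [CommRing R] [IsLocalRing R] [Algebra k R] (D : NCDeformation f 𝒰 R)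

/-- The reduction homomorphism `A_i → Γ(X, U_i)`. -/
noncomputable def γ (i : I) : D.A i →+* Γ(X, 𝒰.U i) :=
  (D.α i).toRingHom.comp (Algebra.TensorProduct.includeRight :
    D.A i →ₐ[R] IsLocalRing.ResidueField R ⊗[R] D.A i).toRingHom

theorem γ_apply (i : I) (a : D.A i) : D.γ i a = D.α i (1 ⊗ₜ[R] a) := rfl

theorem exists_one_tmul {N : Type*} [AddCommGroup N] [Module R N]
    (x : IsLocalRing.ResidueField R ⊗[R] N) : ∃ n : N, x = 1 ⊗ₜ[R] n := by
  induction x using TensorProduct.induction_on with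
  | zero => exact ⟨0, (TensorProduct.tmul_zero _ _).symm⟩
  | tmul c n =>
    obtain ⟨c, rfl⟩ := IsLocalRing.residue_surjective c
    refine ⟨c • n, ?_⟩
    rw [← TensorProduct.smul_tmul, Algebra.smul_def, mul_one]
    rfl
  | add x y hx hy =>
    obtain ⟨m, rfl⟩ := hx
    obtain ⟨n, rfl⟩ := hy
    exact ⟨m + n, (TensorProduct.tmul_add _ _ _).symm⟩

theorem γ_surjective (i : I) : Function.Surjective (D.γ i) := by
  intro x
  obtain ⟨a, ha⟩ := exists_one_tmul ((D.α i).symm x)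
  exact ⟨a, by rw [γ_apply, ← ha, RingEquiv.apply_symm_apply]⟩

theorem γ_eq_zero (i : I) (a : D.A i) :
    D.γ i a = 0 ↔ a ∈ IsLocalRing.maximalIdeal R • (⊤ : Submodule R (D.A i)) := by
  rw [γ_apply, map_eq_zero_iff _ (D.α i).injective]
  exact NC.one_tmul_eq_zero_iff _ a

theorem γ_φ {i j : I} (h : i ≤ j) (a : D.A j) :
    D.γ i (D.φ h a) = ringRes (𝒰.mono h) (D.γ j a) :=
  D.α_comm h (1 ⊗ₜ[R] a)

/-- The sections of a sheaf of modules over the `U_i`, as a presheaf of right modules on `D`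
through the homomorphisms `A_i → Γ(X, U_i)`. -/
noncomputable def sections (N : X.Modules) : PreQCoh D.toNCScheme where
  M i := Γ(N, 𝒰.U i)
  moduleBase i := Module.compHom _ ((D.γ i).comp (algebraMap R (D.A i)))
  module i := Module.compHom _ ((D.γ i).fromOpposite fun x y => Commute.all _ _)
  tower i :=
    letI := Module.compHom Γ(N, 𝒰.U i) ((D.γ i).comp (algebraMap R (D.A i)))
    letI := Module.compHom Γ(N, 𝒰.U i) ((D.γ i).fromOpposite fun x y => Commute.all _ _)
    ⟨fun r a m => by
      change D.γ i (r • a).unop • (show Γ(N, 𝒰.U i) from m) =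
        D.γ i (algebraMap R (D.A i) r) • D.γ i a.unop • (show Γ(N, 𝒰.U i) from m)
      rw [unop_smul, Algebra.smul_def, map_mul, mul_smul]⟩
  ρ h := N.res (𝒰.mono h)
  ρ_smul {i j} h a m := by
    change N.res (𝒰.mono h) (D.γ j a • (show Γ(N, 𝒰.U j) from m)) =
      D.γ i (D.φ h a) • N.res (𝒰.mono h) m
    rw [res_smul, γ_φ]
  ρ_refl i m := res_self N _ m
  ρ_comp h h' m := res_res N _ _ m

theorem sections_torsion (N : X.Modules) :
    PreQCoh.Torsion (IsLocalRing.maximalIdeal R) (D.sections N) := by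
  intro a ha i m
  have h : D.γ i (algebraMap R (D.A i) a) = 0 := by
    rw [γ_eq_zero, Algebra.algebraMap_eq_smul_one]
    exact Submodule.smul_mem_smul ha trivial
  change D.γ i (algebraMap R (D.A i) a) • (show Γ(N, 𝒰.U i) from m) = 0
  rw [h, zero_smul]

/-- The homomorphism of presheaves of sections. -/
noncomputable def sectionsMap {M N : X.Modules} (g : M ⟶ N) :
    PreQCoh.Hom (D.sections M) (D.sections N) where
  app i :=
    { toFun := fun m => g.app (𝒰.U i) m
      map_add' := fun m n => map_add (g.app (𝒰.U i)).hom m n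
      map_smul' := fun a m => Scheme.Modules.Hom.app_smul g (D.γ i a.unop) m }
  comm h m := app_res g (𝒰.mono h) m

theorem combo_sections (N : X.Modules) {i : I} {r : ℕ} (e : Fin r → (D.sections N).M i)
    (c : Fin r → D.A i) : NC.combo e c = ∑ a, D.γ i (c a) • (show Γ(N, 𝒰.U i) from e a) := rfl

theorem sections_bundle {F₀ : X.Modules} {r : ℕ} (h : IsLocallyFreeOn 𝒰 F₀ r) :
    PreQCoh.Bundle (IsLocalRing.maximalIdeal R) r (D.sections F₀) := by
  intro i
  obtain ⟨e, he⟩ := h.exists_basis i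
  refine ⟨e, fun l hl => ⟨fun m => ?_, fun c => ?_⟩⟩
  · obtain ⟨c, hc⟩ := (he _ (𝒰.mono hl)).2 m
    choose x hx using fun a => D.γ_surjective l (c a)
    refine ⟨x, ?_⟩
    rw [combo_sections, ← hc]
    exact Finset.sum_congr rfl fun a _ => by rw [hx]; rfl
  · simp only [← D.γ_eq_zero]
    refine ⟨fun hc a => ?_, fun hc => ?_⟩
    · exact congrFun (@(he _ (𝒰.mono hl)).1 (fun a => D.γ l (c a)) 0 (by
        refine Eq.trans hc ?_
        exact (Finset.sum_eq_zero fun a _ =>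
          zero_smul Γ(X, 𝒰.U l) (F₀.res (𝒰.mono hl) (e a))).symm)) a
    · rw [combo_sections]
      exact Finset.sum_eq_zero fun a _ => by
        rw [hc]
        exact zero_smul Γ(X, 𝒰.U l) (show Γ(F₀, 𝒰.U l) from F₀.res (𝒰.mono hl) (e a))

/-- A retraction of `Γ(U_j, N) → ∏_t Γ(U_{c t} ∩ U_j, N)` for `N = ∏ T_x` takes the value at `x`
from the component at an index `t` with `x ∈ U_{c t}`. -/
theorem relInj_sections {ι : Type} {c : ι → I} (hc : Function.Surjective c) (T : X → Type u)
    [∀ x, AddCommGroup (T x)] [∀ x, Module (X.presheaf.stalk x) (T x)] :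
    PreQCoh.RelInj c (D.sections (sheaf T)) := by
  have hx : ∀ x : X, ∃ t : ι, x ∈ 𝒰.U (c t) := by
    intro x
    have : x ∈ ⨆ i, 𝒰.U i := 𝒰.cover ▸ trivial
    obtain ⟨i, hi⟩ := TopologicalSpace.Opens.mem_iSup.1 this
    obtain ⟨t, rfl⟩ := hc i
    exact ⟨t, hi⟩
  choose t ht using hx
  have hm : ∀ (j : I) (x : X), x ∈ 𝒰.U j → x ∈ 𝒰.U (c (t x) ⊓ j) := fun j x hx => by
    rw [𝒰.inf]; exact ⟨ht x, hx⟩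
  refine ⟨⟨fun j =>
    { toFun := fun m => mkSec T fun x hx => sec T (m (t x)) x (hm j x hx)
      map_add' := fun m n => rfl
      map_smul' := fun a m => sec_ext T fun x hx => ?_ }, fun {i j} h m => rfl⟩, fun i m => rfl⟩
  change X.presheaf.germ _ x _ (D.γ _ (D.φ _ a.unop)) • sec T (m (t x)) x _ =
    X.presheaf.germ _ x hx (D.γ j a.unop) • sec T (m (t x)) x _
  rw [γ_φ]
  exact congrArg (fun b : X.presheaf.stalk x => b • sec T (m (t x)) x (hm j x hx))
    (ring_germ_map (homOfLE (𝒰.mono inf_le_right)) x (hm j x hx) _)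

end NCDeformation

end

section

open AlgebraicGeometry.Scheme.Modules SheafGodement

/-! ### Homomorphisms of sheaves and of their sections over the covering -/

namespace AlgebraicGeometry.Scheme.Modules

variable {X : Scheme.{u}}

/-- The homomorphism of sheaves with given components. -/
noncomputable def mkHom {M N : X.Modules} (T : ∀ W : X.Opens, Γ(M, W) →ₗ[Γ(X, W)] Γ(N, W))
    (hT : ∀ (V W : X.Opens) (h : V ≤ W) (m : Γ(M, W)), T V (M.res h m) = N.res h (T W m)) :
    M ⟶ N where
  val := PresheafOfModules.homMk
    { app := fun U => AddCommGrpCat.ofHom (T U.unop).toAddMonoidHom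
      naturality := fun U V i => by
        ext m
        exact hT V.unop U.unop i.unop.le m }
    (fun U r m => (T U.unop).map_smul r m)

/-- Homomorphisms that are defined on the open subsets of the members of a covering and agree on
the overlaps glue. -/
theorem exists_hom_of_local {M N : X.Modules} {ι : Type*} {U : ι → X.Opens} (hU : ⨆ i, U i = ⊤)
    (L : ∀ i (W : X.Opens), W ≤ U i → Γ(M, W) →ₗ[Γ(X, W)] Γ(N, W))
    (hres : ∀ i (V W : X.Opens) (h : V ≤ W) (hW : W ≤ U i) (m : Γ(M, W)),
      L i V (h.trans hW) (M.res h m) = N.res h (L i W hW m))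
    (hL : ∀ i j (W : X.Opens) (h : W ≤ U i) (h' : W ≤ U j) (m : Γ(M, W)), L i W h m = L j W h' m) :
    ∃ g : M ⟶ N, ∀ i (W : X.Opens) (h : W ≤ U i) (m : Γ(M, W)), g.app W m = L i W h m := by
  have hcov : ∀ W : X.Opens, W ≤ ⨆ i, W ⊓ U i := fun W => by
    rw [← inf_iSup_eq, hU, inf_top_eq]
  have key : ∀ (W : X.Opens) (m : Γ(M, W)), ∃ n : Γ(N, W), ∀ i,
      N.res (inf_le_left : W ⊓ U i ≤ W) n = L i _ inf_le_right (M.res inf_le_left m) := by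
    intro W m
    refine exists_glue N (fun i => inf_le_left) (hcov W) _ fun i j => ?_
    rw [← hres, ← hres, res_res, res_res]
    exact hL _ _ _ _ _ _
  choose T hT using key
  have uniq : ∀ (W : X.Opens) (m : Γ(M, W)) (n : Γ(N, W)), (∀ i,
      N.res (inf_le_left : W ⊓ U i ≤ W) n = L i _ inf_le_right (M.res inf_le_left m)) →
      T W m = n := fun W m n h =>
    eq_of_cover N (fun i => inf_le_left) (hcov W) fun i => (hT W m i).trans (h i).symm
  refine ⟨mkHom (fun W =>
    { toFun := T W
      map_add' := fun m n => uniq _ _ _ fun i => by rw [map_add, hT, hT, map_add, map_add]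
      map_smul' := fun a m => uniq _ _ _ fun i => by
        rw [RingHom.id_apply, res_smul, hT, res_smul, _root_.map_smul] }) fun V W h m => ?_, ?_⟩
  · refine uniq _ _ _ fun i => ?_
    have h' : V ⊓ U i ≤ W ⊓ U i := inf_le_inf_right _ h
    have := congrArg (N.res h') (hT W m i)
    rw [← hres, res_res, res_res] at this
    rw [res_res, res_res]
    exact this
  · intro i W h m
    refine uniq _ _ _ fun j => ?_
    rw [← hres]
    exact hL _ _ _ _ _ _

end AlgebraicGeometry.Scheme.Modules

namespace NCDeformation

variable {k : Type u} [Field k] {X : Scheme.{u}} {f : X ⟶ Spec (.of k)}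
  {I : Type w} [SemilatticeInf I] {𝒰 : AffineMeetCover X I}
  {R : Type u} [CommRing R] [IsLocalRing R] [Algebra k R] (D : NCDeformation f 𝒰 R)

theorem sections_app_smul {M N : X.Modules} (t : PreQCoh.Hom (D.sections M) (D.sections N)) (i : I)
    (c : Γ(X, 𝒰.U i)) (m : Γ(M, 𝒰.U i)) :
    t.app i (c • m : Γ(M, 𝒰.U i)) = (c • (show Γ(N, 𝒰.U i) from t.app i m) : Γ(N, 𝒰.U i)) := by
  obtain ⟨a, rfl⟩ := D.γ_surjective i c
  exact (t.app i).map_smul (op a) m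

/-- A homomorphism `t` of the presheaves of sections gives homomorphisms `L` of sheaves on the
`U_i`, defined by the images under `t` of a basis of `F₀` on `U_i`. -/
theorem exists_local_hom_of_sections {F₀ N : X.Modules} {r : ℕ} (h : IsLocallyFreeOn 𝒰 F₀ r)
    (t : PreQCoh.Hom (D.sections F₀) (D.sections N)) (i : I) :
    ∃ L : ∀ W : X.Opens, W ≤ 𝒰.U i → Γ(F₀, W) →ₗ[Γ(X, W)] Γ(N, W),
      ∀ (W : X.Opens) (hW : W ≤ 𝒰.U i) (l : I) (_ : l ≤ i) (hWl : W ≤ 𝒰.U l) (m : Γ(F₀, 𝒰.U l)),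
        L W hW (F₀.res hWl m) = N.res hWl (show Γ(N, 𝒰.U l) from t.app l m) := by
  obtain ⟨e, he⟩ := h.exists_basis i
  let b : ∀ (W : X.Opens) (hW : W ≤ 𝒰.U i), (Fin r → Γ(X, W)) ≃ₗ[Γ(X, W)] Γ(F₀, W) :=
    fun W hW => LinearEquiv.ofBijective (Fintype.linearCombination Γ(X, W)
      fun a => F₀.res hW (e a)) (he W hW)
  have hb : ∀ W hW c, b W hW c = ∑ a, c a • F₀.res hW (e a) := fun _ _ _ => rfl
  let te : Fin r → Γ(N, 𝒰.U i) := fun a => t.app i (e a)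
  refine ⟨fun W hW => (Fintype.linearCombination Γ(X, W)
    fun a => N.res hW (te a)).comp (b W hW).symm.toLinearMap, ?_⟩
  intro W hW l hl hWl m
  obtain ⟨c, hc⟩ := (he _ (𝒰.mono hl)).2 m
  dsimp only at hc
  have h1 : F₀.res hWl m = b W hW fun a => ringRes hWl (c a) := by
    rw [hb, ← hc, map_sum]
    exact Finset.sum_congr rfl fun a _ => by rw [res_smul, res_res]
  have h2 : t.app l m = ∑ a, c a • N.res (𝒰.mono hl) (te a) := by
    rw [← hc]
    refine (map_sum (t.app l) _ _).trans (Finset.sum_congr rfl fun a _ => ?_)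
    refine (D.sections_app_smul t l _ _).trans ?_
    exact congrArg (fun x : Γ(N, 𝒰.U l) => c a • x) (t.comm hl (e a))
  rw [h1, LinearMap.comp_apply, LinearEquiv.coe_coe, LinearEquiv.symm_apply_apply, h2,
    Fintype.linearCombination_apply, map_sum]
  exact Finset.sum_congr rfl fun a _ => by rw [res_smul, res_res]

/-- For `F₀` locally free on the covering, every homomorphism of the presheaves of sections over
the `U_i` comes from a homomorphism of sheaves. -/
theorem exists_hom_of_sections {F₀ N : X.Modules} {r : ℕ} (h : IsLocallyFreeOn 𝒰 F₀ r)
    (t : PreQCoh.Hom (D.sections F₀) (D.sections N)) :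
    ∃ g : F₀ ⟶ N, ∀ i (m : Γ(F₀, 𝒰.U i)), g.app (𝒰.U i) m = t.app i m := by
  choose L hL using D.exists_local_hom_of_sections h t
  have uniq : ∀ (l : I) (W : X.Opens) (_ : W ≤ 𝒰.U l) {P : Type u} [AddCommGroup P]
      (x y : Γ(F₀, W) →+ P), (∀ (a : Γ(X, W)) (m : Γ(F₀, 𝒰.U l)) (h : W ≤ 𝒰.U l),
        x (a • F₀.res h m) = y (a • F₀.res h m)) → ∀ m, x m = y m := by
    intro l W hW P _ x y hxy m
    obtain ⟨e, he⟩ := h.exists_basis l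
    obtain ⟨c, rfl⟩ := (he W hW).2 m
    dsimp only
    rw [map_sum, map_sum]
    exact Finset.sum_congr rfl fun a _ => hxy _ _ _
  have hres : ∀ i (V W : X.Opens) (hVW : V ≤ W) (hW : W ≤ 𝒰.U i) (m : Γ(F₀, W)),
      L i V (hVW.trans hW) (F₀.res hVW m) = N.res hVW (L i W hW m) := by
    intro i V W hVW hW m
    refine uniq i W hW ((L i V (hVW.trans hW)).toAddMonoidHom.comp (F₀.res hVW))
      ((N.res hVW).comp (L i W hW).toAddMonoidHom) (fun a m h => ?_) m
    change L i V _ (F₀.res hVW (a • F₀.res h m)) = N.res hVW (L i W hW (a • F₀.res h m))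
    rw [res_smul, res_res, _root_.map_smul, _root_.map_smul, res_smul, hL _ _ _ i le_rfl,
      hL _ _ _ i le_rfl, res_res]
  have heq : ∀ i j (W : X.Opens) (hi : W ≤ 𝒰.U i) (hj : W ≤ 𝒰.U j) (m : Γ(F₀, W)),
      L i W hi m = L j W hj m := by
    intro i j W hi hj m
    have hW : W ≤ 𝒰.U (i ⊓ j) := by rw [𝒰.inf]; exact le_inf hi hj
    refine uniq (i ⊓ j) W hW (L i W hi).toAddMonoidHom (L j W hj).toAddMonoidHom
      (fun a m h => ?_) m
    change L i W hi (a • F₀.res h m) = L j W hj (a • F₀.res h m)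
    rw [_root_.map_smul, _root_.map_smul, hL _ _ _ (i ⊓ j) inf_le_left,
      hL _ _ _ (i ⊓ j) inf_le_right]
  obtain ⟨g, hg⟩ := exists_hom_of_local 𝒰.cover L hres heq
  refine ⟨g, fun i m => ?_⟩
  rw [hg i _ le_rfl]
  have := hL i _ le_rfl i le_rfl le_rfl m
  rwa [res_self, res_self] at this

/-! ### Acyclicity of the presheaf of sections -/

theorem _root_.SheafGodement.res_surjective (T : X → Type u) [∀ x, AddCommGroup (T x)]
    [∀ x, Module (X.presheaf.stalk x) (T x)] {U V : X.Opens} (h : U ≤ V) :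
    Function.Surjective ((sheaf T).res h) := by
  classical
  intro m
  refine ⟨mkSec T fun x _ => if hx : x ∈ U then sec T m x hx else 0, sec_ext T fun x hx => ?_⟩
  exact dif_pos hx

/-- A short exact sequence of sheaves whose first term has split sections gives a short exact
sequence of sections over the `U_i`. -/
theorem sections_shortExact {S : ShortComplex X.Modules} (hS : S.ShortExact)
    (h : SectionsSplit 𝒰 S.X₁) :
    PreQCoh.ShortExact (D.sectionsMap S.f) (D.sectionsMap S.g) := by
  have := hS.mono_f
  have := hS.epi_g
  have hfp : ∀ (U : X.Opens) (n : Γ(S.X₁, U)), S.g.app U (S.f.app U n) = 0 := fun U n =>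
    congrArg (fun g : S.X₁ ⟶ S.X₃ => g.app U n) S.zero
  exact ⟨fun i => app_injective_of_mono S.f _,
    fun i => h.surjective S.f S.g hfp (fun U e he => exists_of_app_eq_zero hS e he)
      (𝒰.isAffine i) le_rfl,
    fun i x => hfp _ x, fun i x hx => exists_of_app_eq_zero hS x hx⟩

/-- The vanishing of the groups `Ext^p(F₀, N)`, computed in the category of sheaves of modules,
gives the vanishing of the cohomology computed with the covering: shift dimensions along an
embedding of `N` in an injective sheaf `∏ T_x`. -/
theorem firstVanish_sections {ι : Type} {c : ι → I} (hc : Function.Surjective c) {F₀ : X.Modules}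
    {r : ℕ} (h : IsLocallyFreeOn 𝒰 F₀ r) (n : ℕ) (N : X.Modules) (hN : SectionsSplit 𝒰 N)
    (hExt : ∀ p, 0 < p → ExtVanishes F₀ N p) :
    PreQCoh.FirstVanish c (D.sections F₀) (PreQCoh.Kpow c n (D.sections N)) := by
  induction n generalizing N with
  | zero =>
    obtain ⟨T, _, _, g, hT, hg⟩ := exists_embedding N
    have hS : (ShortComplex.mk g (Limits.cokernel.π g) (by simp)).ShortExact :=
      { exact := ShortComplex.exact_cokernel g }
    have hex := D.sections_shortExact hS hN
    refine hex.firstVanish_left hc (fun t => ?_) ((D.relInj_sections hc T).firstVanish _)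
    obtain ⟨t', ht'⟩ := D.exists_hom_of_sections h t
    obtain ⟨s, rfl⟩ := hS.exists_lift_of_extVanishes F₀ (hExt 1 one_pos) t'
    exact ⟨D.sectionsMap s, ht'⟩
  | succ n ih =>
    obtain ⟨T, _, _, g, hT, hg⟩ := exists_embedding N
    have hS : (ShortComplex.mk g (Limits.cokernel.π g) (by simp)).ShortExact :=
      { exact := ShortComplex.exact_cokernel g }
    have := injective_sheaf T hT
    have hex := D.sections_shortExact hS hN
    refine (hex.Kpow hc (n + 1)).firstVanish_left hc (fun t => ?_)
      (((D.relInj_sections hc T).Kpow (n + 1)).firstVanish _)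
    obtain ⟨y, hy⟩ := ih (Limits.cokernel g)
      (hN.quotient g (Limits.cokernel.π g)
        (fun U m => congrArg (fun q : N ⟶ _ => q.app U m) (Limits.cokernel.condition g))
        (fun U e he => exists_of_app_eq_zero hS e he) fun U V hUV => res_surjective T hUV)
      (fun p hp => hS.extVanishes_right F₀ hp (hExt (p + 1) p.succ_pos)) t
    obtain ⟨z, hz⟩ := (D.sections_bundle h).homSurj_J
      ((D.sections_torsion (sheaf T)).Kpow n) _ (hex.Kpow hc n).surj y
    refine ⟨(PreQCoh.Kπ c _).comp z, fun i x => ?_⟩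
    exact (congrArg ((PreQCoh.Kπ c _).app i) (hz i x)).trans (hy i x)

theorem acyclic_sections {ι : Type} {c : ι → I} (hc : Function.Surjective c) {F₀ : X.Modules}
    {r : ℕ} (h : IsLocallyFreeOn 𝒰 F₀ r) (hExt : ∀ p, 0 < p → ExtVanishes F₀ F₀ p) :
    PreQCoh.Acyclic c (D.sections F₀) (D.sections F₀) := fun n =>
  D.firstVanish_sections hc h n F₀ (.of_isLocallyFreeOn h) hExt

end NCDeformation

end

/-! ### Direct images of modules along the inclusions of the covering -/

namespace NC.RightTensor

variable {S T T' : Type u} [Ring S] [Ring T] [Ring T'] (φ : S →+* T) (φ' : S →+* T')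
  {M : Type u} [AddCommGroup M] [Module Sᵐᵒᵖ M]

/-- The map `1 ⊗ τ : M ⊗_S T → M ⊗_S T'` induced by a homomorphism `τ` of `S`-rings. -/
def mapRight (τ : T →+* T') (h : ∀ s, τ (φ s) = φ' s) :
    RightTensor φ M →+ RightTensor φ' M :=
  lift φ (AddMonoidHom.mk' (fun m => (mk₂ φ' m).comp τ.toAddMonoidHom)
    (fun m m' => by ext t; exact add_tmul φ' m m' (τ t))) (fun m s t => by
      change tmul φ' (op s • m) (τ t) = tmul φ' m (τ (φ s * t))
      rw [tmul_balanced, map_mul, h])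

/-- The right multiplication of `T` on `M ⊗_S T`. -/
def act : Tᵐᵒᵖ →+* AddMonoid.End (RightTensor φ M) where
  toFun a := lift φ (AddMonoidHom.mk' (fun m => (mk₂ φ m).comp (AddMonoidHom.mulRight a.unop))
    (fun m m' => by ext t; exact add_tmul φ m m' _)) (fun m s t => by
      change tmul φ (op s • m) (t * a.unop) = tmul φ m (φ s * t * a.unop)
      rw [tmul_balanced, mul_assoc])
  map_one' := hom_ext φ fun m t => congrArg (tmul φ m) (mul_one t)
  map_mul' a b := hom_ext φ fun m t => congrArg (tmul φ m) (mul_assoc t b.unop a.unop).symm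
  map_zero' := hom_ext φ fun m t => by
    change tmul φ m (t * 0) = 0
    rw [mul_zero, tmul_zero]
  map_add' a b := hom_ext φ fun m t => by
    change tmul φ m (t * (a.unop + b.unop)) = tmul φ m (t * a.unop) + tmul φ m (t * b.unop)
    rw [mul_add, tmul_add]

theorem act_tmul (a : Tᵐᵒᵖ) (m : M) (t : T) : act φ a (tmul φ m t) = tmul φ m (t * a.unop) := rfl

end NC.RightTensor

namespace NCScheme

variable {R : Type u} [CommRing R] {I : Type w} [SemilatticeInf I] (A : NCScheme R I)

/-- The restriction map `A_{i ∧ j} → A_{i ∧ l}` for `l ≤ j`, as an additive map from a right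
`A_j`-module to a right `A_l`-module. -/
def meetRes (i : I) {l j : I} (h : l ≤ j) :
    NC.Restrict (A.φ (inf_le_right : i ⊓ j ≤ j) : A.A j →+* A.A (i ⊓ j)) →+
      NC.Restrict (A.φ (inf_le_right : i ⊓ l ≤ l) : A.A l →+* A.A (i ⊓ l)) :=
  (A.φ (inf_le_inf_left i h) : A.A (i ⊓ j) →+* A.A (i ⊓ l)).toAddMonoidHom

theorem meetRes_smul (i : I) {l j : I} (h : l ≤ j) (a : A.A j)
    (m : NC.Restrict (A.φ (inf_le_right : i ⊓ j ≤ j) : A.A j →+* A.A (i ⊓ j))) :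
    A.meetRes i h (op a • m) = op (A.φ h a) • A.meetRes i h m := by
  change A.φ (inf_le_inf_left i h) ((show A.A (i ⊓ j) from m) * A.φ inf_le_right a) =
    A.φ (inf_le_inf_left i h) (show A.A (i ⊓ j) from m) * A.φ inf_le_right (A.φ h a)
  rw [map_mul, A.φ_comp, A.φ_comp]

/-- The meets of indices behave like intersections: `A_{i ∧ j} ⊗_{A_j} A_l → A_{i ∧ l}` is
bijective for `l ≤ j`. -/
def MeetBaseChange : Prop := ∀ (i : I) {l j : I} (h : l ≤ j), Function.Bijective
  (NC.glue (A.φ h : A.A j →+* A.A l) (A.meetRes i h) (A.meetRes_smul i h))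

section Push

variable (i : I) (N : Type u) [AddCommGroup N] [Module (A.A i)ᵐᵒᵖ N]

/-- The homomorphism `A_i → A_{i ∧ j}`. -/
abbrev meetLeft (j : I) : A.A i →+* A.A (i ⊓ j) := (A.φ (inf_le_left : i ⊓ j ≤ i) : _ →+* _)

/-- The component `N ⊗_{A_i} A_{i ∧ j}` of the direct image of the right `A_i`-module `N`. -/
def PushObj (j : I) : Type u := NC.RightTensor (A.meetLeft i j) N

instance (j : I) : AddCommGroup (A.PushObj i N j) :=
  inferInstanceAs (AddCommGroup (NC.RightTensor (A.meetLeft i j) N))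

instance (j : I) : Module (A.A j)ᵐᵒᵖ (A.PushObj i N j) :=
  Module.compHom (NC.RightTensor (A.meetLeft i j) N)
    ((NC.RightTensor.act (M := N) (A.meetLeft i j)).comp
      (RingHom.op (A.φ (inf_le_right : i ⊓ j ≤ j) : A.A j →+* A.A (i ⊓ j))))

instance (j : I) : Module R (A.PushObj i N j) :=
  Module.compHom (A.PushObj i N j) (algebraMap R (A.A j)ᵐᵒᵖ)

instance (j : I) : IsScalarTower R (A.A j)ᵐᵒᵖ (A.PushObj i N j) where
  smul_assoc r a m := by
    rw [Algebra.smul_def, mul_smul]; rfl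

variable {N}

/-- The pure tensors of `N ⊗_{A_i} A_{i ∧ j}`. -/
def pushTmul (j : I) (n : N) (a : A.A (i ⊓ j)) : A.PushObj i N j :=
  NC.RightTensor.tmul (A.meetLeft i j) n a

theorem op_smul_pushTmul (j : I) (n : N) (a : A.A (i ⊓ j)) (b : A.A j) :
    op b • A.pushTmul i j n a = A.pushTmul i j n (a * A.φ inf_le_right b) := rfl

theorem pushTmul_balanced (j : I) (n : N) (s : A.A i) (a : A.A (i ⊓ j)) :
    A.pushTmul i j (op s • n) a = A.pushTmul i j n (A.φ inf_le_left s * a) :=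
  NC.RightTensor.tmul_balanced _ _ _ _

variable {i} in
theorem push_induction {j : I} {p : A.PushObj i N j → Prop} (x : A.PushObj i N j) (h0 : p 0)
    (ht : ∀ n a, p (A.pushTmul i j n a)) (ha : ∀ x y, p x → p y → p (x + y)) : p x :=
  NC.RightTensor.induction_on _ x h0 ht ha

variable (N)

/-- The map `N ⊗_{A_i} A_{i ∧ j} → N ⊗_{A_i} A_{i ∧ l}` for `l ≤ j`. -/
def pushRes {l j : I} (h : l ≤ j) : A.PushObj i N j →+ A.PushObj i N l :=
  NC.RightTensor.mapRight (A.meetLeft i j) (A.meetLeft i l)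
    (A.φ (inf_le_inf_left i h) : A.A (i ⊓ j) →+* A.A (i ⊓ l)) (fun s => A.φ_comp _ _ s)

variable {N}

theorem pushRes_tmul {l j : I} (h : l ≤ j) (n : N) (a : A.A (i ⊓ j)) :
    A.pushRes i N h (A.pushTmul i j n a) = A.pushTmul i l n (A.φ (inf_le_inf_left i h) a) := rfl

variable (N)

/-- The direct image of a right `A_i`-module `N`, with components `N ⊗_{A_i} A_{i ∧ j}`. -/
@[reducible] def prePush : PreQCoh A where
  M j := A.PushObj i N j
  ρ h := A.pushRes i N h
  ρ_smul {l j} h a m := by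
    induction m using push_induction with
    | h0 => rw [smul_zero, map_zero, smul_zero]
    | ht n b =>
      rw [op_smul_pushTmul, pushRes_tmul, pushRes_tmul, op_smul_pushTmul, map_mul, A.φ_comp,
        A.φ_comp]
    | ha x y hx hy => rw [smul_add, map_add, map_add, smul_add, hx, hy]
  ρ_refl j m := by
    induction m using push_induction with
    | h0 => rw [map_zero]
    | ht n b => exact congrArg (A.pushTmul i j n) (A.φ_refl _ b)
    | ha x y hx hy => rw [map_add, hx, hy]
  ρ_comp h h' m := by
    induction m using push_induction with
    | h0 => rw [map_zero, map_zero, map_zero]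
    | ht n b => exact congrArg (A.pushTmul i _ n) (A.φ_comp _ _ b)
    | ha x y hx hy => rw [map_add, map_add, map_add, hx, hy]

variable {N}

/-- `b ↦ n ⊗ b` as a homomorphism of right `A_j`-modules. -/
def pushMk (j : I) (n : N) :
    NC.Restrict (A.φ (inf_le_right : i ⊓ j ≤ j) : A.A j →+* A.A (i ⊓ j)) →ₗ[(A.A j)ᵐᵒᵖ]
      A.PushObj i N j where
  toFun b := A.pushTmul i j n b
  map_add' _ _ := NC.RightTensor.tmul_add _ _ _ _
  map_smul' _ _ := rfl

/-- The direct image is quasi-coherent: `N ⊗ A_{i ∧ j} ⊗ A_l ≅ N ⊗ A_{i ∧ l}` by base change for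
meets, which is compatible with the left multiplications by `A_i`. -/
theorem prePush_bijective (hA : A.MeetBaseChange) {l j : I} (h : l ≤ j) :
    Function.Bijective (NC.glue (A.φ h : A.A j →+* A.A l) ((A.prePush i N).ρ h)
      ((A.prePush i N).ρ_smul h)) := by
  let u := AddEquiv.ofBijective _ (hA i h)
  let B := NC.Restrict (A.φ (inf_le_right : i ⊓ j ≤ j) : A.A j →+* A.A (i ⊓ j))
  let G := NC.glue (A.φ h : A.A j →+* A.A l) ((A.prePush i N).ρ h) ((A.prePush i N).ρ_smul h)
  let Φ : N →+ (NC.RightTensor (A.φ h : A.A j →+* A.A l) B →+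
      NC.RightTensor (A.φ h : A.A j →+* A.A l) (A.PushObj i N j)) :=
    AddMonoidHom.mk' (fun n => NC.RightTensor.map _ (A.pushMk i j n)) (fun n n' => by
      refine NC.RightTensor.hom_ext _ fun b c => ?_
      rw [AddMonoidHom.add_apply, NC.RightTensor.map_tmul, NC.RightTensor.map_tmul,
        NC.RightTensor.map_tmul, ← NC.RightTensor.add_tmul]
      exact congrArg (fun x : A.PushObj i N j => NC.RightTensor.tmul (A.φ h : A.A j →+* A.A l) x c)
        (NC.RightTensor.add_tmul (A.meetLeft i j) n n' b))
  -- the left multiplication of `A_i` on `A_{i ∧ j} ⊗ A_l`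
  let lam : ∀ a : A.A i, NC.RightTensor (A.φ h : A.A j →+* A.A l) B →+
      NC.RightTensor (A.φ h : A.A j →+* A.A l) B := fun a => NC.RightTensor.map _
    { toFun := fun b : B => ((A.φ inf_le_left a * (show A.A (i ⊓ j) from b) : A.A (i ⊓ j)) : B)
      map_add' := fun b c => mul_add (A.φ inf_le_left a) _ _
      map_smul' := fun s b => (mul_assoc (A.φ inf_le_left a) _ _).symm }
  have hΦ : ∀ a n x, Φ (op a • n) x = Φ n (lam a x) := by
    intro a n
    refine DFunLike.congr_fun (f := Φ (op a • n)) (g := (Φ n).comp (lam a))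
      (NC.RightTensor.hom_ext _ fun b c => ?_)
    exact congrArg (fun x : A.PushObj i N j => NC.RightTensor.tmul (A.φ h : A.A j →+* A.A l) x c)
      (A.pushTmul_balanced i j n a b)
  have hlam : ∀ (a : A.A i) x, u (lam a x) =
      (A.φ (inf_le_left : i ⊓ l ≤ i) a * (show A.A (i ⊓ l) from u x) : A.A (i ⊓ l)) := by
    intro a
    refine DFunLike.congr_fun (f := u.toAddMonoidHom.comp (lam a))
      (g := (AddMonoidHom.mulLeft (A.φ inf_le_left a : A.A (i ⊓ l))).comp u.toAddMonoidHom)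
      (NC.RightTensor.hom_ext _ fun b c => ?_)
    change A.φ (inf_le_inf_left i h) (A.φ inf_le_left a * (show A.A (i ⊓ j) from b)) *
      A.φ inf_le_right c = A.φ inf_le_left a *
        (A.φ (inf_le_inf_left i h) (show A.A (i ⊓ j) from b) * A.φ inf_le_right c)
    rw [map_mul, A.φ_comp, mul_assoc]
  let H : A.PushObj i N l →+ NC.RightTensor (A.φ h : A.A j →+* A.A l) (A.PushObj i N j) :=
    NC.RightTensor.lift (A.meetLeft i l) (AddMonoidHom.mk'
      (fun n => (Φ n).comp u.symm.toAddMonoidHom) (fun n n' => by rw [map_add]; rfl))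
      (fun n a d => by
        change Φ (op a • n) (u.symm d) = Φ n (u.symm (A.φ inf_le_left a * d))
        rw [hΦ]
        congr 1
        rw [AddEquiv.eq_symm_apply]
        exact (hlam a _).trans (congrArg
          (fun x : A.A (i ⊓ l) => A.φ (inf_le_left : i ⊓ l ≤ i) a * x) (u.apply_symm_apply d)))
  have hH : ∀ n d, H (A.pushTmul i l n d) = Φ n (u.symm d) := fun _ _ => rfl
  have h1 : ∀ n x, G (Φ n x) = A.pushTmul i l n (u x) := by
    intro n
    exact DFunLike.congr_fun (f := G.comp (Φ n))
      (g := (NC.RightTensor.mk₂ (A.meetLeft i l) n).comp u.toAddMonoidHom)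
      (NC.RightTensor.hom_ext _ fun _ _ => rfl)
  refine ⟨Function.LeftInverse.injective (g := H) ?_, Function.RightInverse.surjective (g := H) ?_⟩
  · refine DFunLike.congr_fun (f := H.comp G) (g := AddMonoidHom.id _)
      (NC.RightTensor.hom_ext _ fun x c => ?_)
    change H (G (NC.RightTensor.tmul _ x c)) = NC.RightTensor.tmul _ x c
    induction x using push_induction with
    | h0 => simp
    | ht n b =>
      have : NC.RightTensor.tmul (A.φ h : A.A j →+* A.A l) (A.pushTmul i j n b) c =
        Φ n (NC.RightTensor.tmul _ (b : B) c) := rfl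
      rw [this, h1]
      exact (hH n _).trans (congrArg (Φ n) (u.symm_apply_apply _))
    | ha x y hx hy => rw [NC.RightTensor.add_tmul, map_add, map_add, hx, hy]
  · intro x
    induction x using push_induction with
    | h0 => exact (congrArg G (map_zero H)).trans (map_zero G)
    | ht n d =>
      refine (congrArg G (hH n d)).trans ((h1 _ _).trans ?_)
      exact congrArg (A.pushTmul i l n) (u.apply_symm_apply d)
    | ha x y hx hy => exact (congrArg G (map_add H x y)).trans ((map_add G _ _).trans (by
        exact congrArg₂ (· + ·) hx hy))

end Push

end NCScheme

/-! ### Injective quasi-coherent modules -/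

namespace QCoh

variable {R : Type u} [CommRing R] {I : Type w} [SemilatticeInf I] {A : NCScheme R I}

/-- The presheaf of modules underlying a quasi-coherent module. -/
@[reducible] def toPre (M : QCoh A) : PreQCoh A where
  M := M.M
  ρ := M.ρ
  ρ_smul := M.ρ_smul
  ρ_refl := M.ρ_refl
  ρ_comp := M.ρ_comp

/-- A homomorphism of quasi-coherent modules as a homomorphism of presheaves. -/
def homToPre {M N : QCoh A} (f : M ⟶ N) : PreQCoh.Hom M.toPre N.toPre := ⟨f.app, f.comm⟩

/-- A homomorphism of the underlying presheaves as a homomorphism of quasi-coherent modules. -/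
def homOfPre {M N : QCoh A} (f : PreQCoh.Hom M.toPre N.toPre) : M ⟶ N := ⟨f.app, f.comm⟩

theorem ρ_induction (M : QCoh A) {i j : I} (h : i ≤ j) {p : M.M i → Prop} (x : M.M i) (h0 : p 0)
    (ht : ∀ (m : M.M j) (a : A.A i), p (op a • M.ρ h m)) (ha : ∀ x y, p x → p y → p (x + y)) :
    p x := by
  obtain ⟨x, rfl⟩ := (M.bijective h).2 x
  induction x using NC.RightTensor.induction_on with
  | h0 => rw [map_zero]; exact h0
  | ht m t => exact ht m t
  | ha x y hx hy => rw [map_add]; exact ha _ _ hx hy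

section Push

variable (hA : A.MeetBaseChange) (i : I) (N : Type u) [AddCommGroup N] [Module (A.A i)ᵐᵒᵖ N]

/-- The direct image of a right `A_i`-module, as a quasi-coherent module. -/
@[reducible] def push : QCoh A where
  M j := A.PushObj i N j
  ρ h := A.pushRes i N h
  ρ_smul := (A.prePush i N).ρ_smul
  ρ_refl := (A.prePush i N).ρ_refl
  ρ_comp := (A.prePush i N).ρ_comp
  bijective h := A.prePush_bijective i hA h

/-- The map `N ⊗_{A_i} A_{i ∧ i} → N`, `n ⊗ a ↦ n a`. -/
def pushε : A.PushObj i N i →+ N :=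
  NC.RightTensor.lift (A.meetLeft i i) (AddMonoidHom.mk'
    (fun n => AddMonoidHom.mk' (fun a => op (A.φ (le_inf le_rfl le_rfl : i ≤ i ⊓ i) a) • n)
      (fun a b => by rw [map_add, MulOpposite.op_add, add_smul]))
    (fun n n' => by ext a; exact smul_add _ n n')) (fun n s a => by
      change op (A.φ (le_inf le_rfl le_rfl : i ≤ i ⊓ i) a) • op s • n =
        op (A.φ (le_inf le_rfl le_rfl : i ≤ i ⊓ i) (A.φ inf_le_left s * a)) • n
      rw [smul_smul, map_mul, A.φ_comp, A.φ_refl, op_mul])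

variable {N}

theorem pushε_tmul (n : N) (a : A.A (i ⊓ i)) :
    pushε i N (A.pushTmul i i n a) = op (A.φ (le_inf le_rfl le_rfl : i ≤ i ⊓ i) a) • n := rfl

theorem pushTmul_pushε (x : A.PushObj i N i) : A.pushTmul i i (pushε i N x) 1 = x := by
  induction x using NCScheme.push_induction with
  | h0 => rw [map_zero]; exact NC.RightTensor.zero_tmul _ _
  | ht n a => rw [pushε_tmul, A.pushTmul_balanced, A.φ_comp, A.φ_refl, mul_one]
  | ha x y hx hy =>
    rw [map_add]
    exact (NC.RightTensor.add_tmul _ _ _ _).trans (congrArg₂ (· + ·) hx hy)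

theorem pushε_smul (b : A.A i) (x : A.PushObj i N i) :
    pushε i N (op b • x) = op b • pushε i N x := by
  induction x using NCScheme.push_induction with
  | h0 => rw [smul_zero, map_zero, smul_zero]
  | ht n a =>
    rw [A.op_smul_pushTmul, pushε_tmul, pushε_tmul, map_mul, A.φ_comp, A.φ_refl, smul_smul, op_mul]
  | ha x y hx hy => rw [smul_add, map_add, map_add, smul_add, hx, hy]

theorem pushRes_bijective {l j : I} (h : l ≤ j) (h' : i ⊓ j ≤ i ⊓ l) :
    Function.Bijective (A.pushRes i N h) := by
  let g : A.PushObj i N l →+ A.PushObj i N j :=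
    NC.RightTensor.mapRight (A.meetLeft i l) (A.meetLeft i j)
      (A.φ h' : A.A (i ⊓ l) →+* A.A (i ⊓ j)) (fun s => A.φ_comp _ _ s)
  have hg : ∀ n a, g (A.pushTmul i l n a) = A.pushTmul i j n (A.φ h' a) := fun _ _ => rfl
  refine ⟨Function.LeftInverse.injective (g := g) fun x => ?_,
    Function.RightInverse.surjective (g := g) fun x => ?_⟩
  all_goals
    induction x using NCScheme.push_induction with
    | h0 => rw [map_zero, map_zero]
    | ht n a =>
      simp only [hg, A.pushRes_tmul, A.φ_comp]
      rw [A.φ_refl]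
    | ha x y hx hy => rw [map_add, map_add, hx, hy]

/-- Together with `push_hom_ext`: the direct image is right adjoint to `Y ↦ Y_i`, with counit
`pushε`. -/
theorem exists_push_hom {Y : QCoh A} (h : Y.M i →ₗ[(A.A i)ᵐᵒᵖ] N) :
    ∃ g : Y ⟶ push hA i N, ∀ y, pushε i N (g.app i y) = h y := by
  let u : ∀ j, NC.RightTensor (A.meetLeft i j) (Y.M i) ≃+ Y.M (i ⊓ j) := fun j =>
    AddEquiv.ofBijective _ (Y.bijective (inf_le_left : i ⊓ j ≤ i))
  have hu : ∀ j y a, u j (NC.RightTensor.tmul _ y a) = op a • Y.ρ inf_le_left y :=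
    fun _ _ _ => rfl
  let Ψ : ∀ j, Y.M (i ⊓ j) →+ A.PushObj i N j := fun j =>
    (NC.RightTensor.map (A.meetLeft i j) h).comp (u j).symm.toAddMonoidHom
  have hΨ : ∀ j y a, Ψ j (op a • Y.ρ inf_le_left y) = A.pushTmul i j (h y) a := by
    intro j y a
    change NC.RightTensor.map (A.meetLeft i j) h ((u j).symm _) = _
    rw [← hu, AddEquiv.symm_apply_apply]
    exact NC.RightTensor.map_tmul _ _ _ _
  have hsmul : ∀ j (b : A.A j) (z : Y.M (i ⊓ j)),
      Ψ j (op (A.φ (inf_le_right : i ⊓ j ≤ j) b) • z) = op b • Ψ j z := by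
    intro j b z
    induction z using Y.ρ_induction (inf_le_left : i ⊓ j ≤ i) with
    | h0 => rw [smul_zero, map_zero, smul_zero]
    | ht y a => rw [smul_smul, ← op_mul, hΨ, hΨ, A.op_smul_pushTmul]
    | ha x y hx hy => rw [smul_add, map_add, map_add, smul_add, hx, hy]
  have hres : ∀ l j (hl : l ≤ j) z, Ψ l (Y.ρ (inf_le_inf_left i hl) z) =
      A.pushRes i N hl (Ψ j z) := by
    intro l j hl z
    induction z using Y.ρ_induction (inf_le_left : i ⊓ j ≤ i) with
    | h0 => rw [map_zero, map_zero, map_zero, map_zero]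
    | ht y a => rw [Y.ρ_smul, Y.ρ_comp, hΨ, hΨ, A.pushRes_tmul]
    | ha x y hx hy => rw [map_add, map_add, map_add, map_add, hx, hy]
  refine ⟨⟨fun j =>
    { toFun := fun y => Ψ j (Y.ρ inf_le_right y)
      map_add' := fun x y => by rw [map_add, map_add]
      map_smul' := fun b y => by
        have := Y.ρ_smul (inf_le_right : i ⊓ j ≤ j) b.unop y
        rw [op_unop] at this
        rw [RingHom.id_apply, this, hsmul, op_unop] }, fun {l j} hl y => ?_⟩, fun y => ?_⟩
  · change Ψ l (Y.ρ _ (Y.ρ _ y)) = A.pushRes i N hl (Ψ j (Y.ρ _ y))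
    rw [← hres, Y.ρ_comp, Y.ρ_comp]
  · change pushε i N (Ψ i (Y.ρ (inf_le_left : i ⊓ i ≤ i) y)) = h y
    rw [← one_smul (A.A (i ⊓ i))ᵐᵒᵖ (Y.ρ _ y), ← op_one, hΨ, pushε_tmul, map_one, op_one, one_smul]

theorem push_hom_ext {Y : QCoh A} {g g' : Y ⟶ push hA i N}
    (h : ∀ y, pushε i N (g.app i y) = pushε i N (g'.app i y)) : g = g' := by
  have h1 : ∀ y, g.app i y = g'.app i y := fun y => by
    rw [← pushTmul_pushε i (g.app i y), h, pushTmul_pushε]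
  have h2 : ∀ j (z : Y.M (i ⊓ j)), g.app _ z = g'.app _ z := by
    intro j z
    induction z using Y.ρ_induction (inf_le_left : i ⊓ j ≤ i) with
    | h0 => rw [map_zero, map_zero]
    | ht y a => rw [map_smul, map_smul, g.comm, g'.comm, h1]
    | ha x y hx hy => rw [map_add, map_add, hx, hy]
  refine hom_ext fun j y => ?_
  refine (pushRes_bijective i (inf_le_right : i ⊓ j ≤ j) (le_inf inf_le_left le_rfl)).1 ?_
  exact (g.comm inf_le_right y).symm.trans ((h2 j _).trans (g'.comm inf_le_right y))

theorem injective_push (hN : Module.Injective (A.A i)ᵐᵒᵖ N) : Injective (push hA i N) where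
  factors {Y Z} g f _ := by
    let gi : Y.M i →ₗ[(A.A i)ᵐᵒᵖ] N :=
      { toFun := fun y => pushε i N (g.app i y)
        map_add' := fun x y => by rw [map_add, map_add]
        map_smul' := fun b y => by
          rw [map_smul, ← op_unop b, pushε_smul, RingHom.id_apply] }
    obtain ⟨z, hz⟩ := hN.out (f.app i) (injective_of_mono f i) gi
    obtain ⟨t, ht⟩ := exists_push_hom hA i z
    refine ⟨t, push_hom_ext hA i fun y => ?_⟩
    rw [comp_app, ht, hz]
    rfl

end Push

end QCoh

namespace PreQCoh

variable {R : Type u} [CommRing R] {I : Type w} [SemilatticeInf I] {A : NCScheme R I}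
  {ι : Type} {c : ι → I}

/-- If restriction to `c t` is bijective, the component at `t` gives a retraction of `V → J V`. -/
theorem RelInj.of_bijective {V : PreQCoh A} (t : ι)
    (h : ∀ j, Function.Bijective (V.ρ (inf_le_right : c t ⊓ j ≤ j))) : RelInj c V := by
  let s : ∀ j, V.M (c t ⊓ j) → V.M j := fun j => Function.surjInv (h j).2
  have hs : ∀ j x, V.ρ (inf_le_right : c t ⊓ j ≤ j) (s j x) = x := fun j =>
    Function.surjInv_eq (h j).2
  refine ⟨⟨fun j =>
    { toFun := fun m => s j (m t)
      map_add' := fun m n => (h j).1 (by rw [map_add, hs, hs, hs]; rfl)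
      map_smul' := fun a m => (h j).1 (by
        have := V.ρ_smul (inf_le_right : c t ⊓ j ≤ j) a.unop (s j (m t))
        rw [op_unop] at this
        rw [RingHom.id_apply, this, hs, hs]
        rfl) }, fun {i j} hij m => (h i).1 ?_⟩, fun j m => (h j).1 ?_⟩
  · change V.ρ _ (s i ((J c V).ρ hij m t)) = V.ρ _ (V.ρ hij (s j (m t)))
    rw [hs, J_ρ, V.ρ_comp, ← hs j (m t), V.ρ_comp, hs]
  · exact hs j _

/-- A presheaf that is a finite sum of retracts of relatively injective presheaves is relatively
injective. -/
theorem RelInj.of_sum {κ : Type*} [Fintype κ] {V : PreQCoh A} {W : κ → PreQCoh A}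
    (hW : ∀ a, RelInj c (W a)) (p : ∀ a, Hom V (W a)) (q : ∀ a, Hom (W a) V)
    (hpq : ∀ i m, ∑ a, (q a).app i ((p a).app i m) = m) : RelInj c V := by
  choose ξ hξ using hW
  refine ⟨⟨fun i => ∑ a, ((q a).comp ((ξ a).comp (Jmap c (p a)))).app i, fun {i j} h m => ?_⟩,
    fun i m => ?_⟩
  · rw [LinearMap.sum_apply, LinearMap.sum_apply, map_sum]
    exact Finset.sum_congr rfl fun a _ => Hom.comm _ h m
  · rw [LinearMap.sum_apply]
    refine Eq.trans (Finset.sum_congr rfl fun a _ => ?_) (hpq i m)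
    rw [Hom.comp_app, Hom.comp_app, η_natural, hξ]

end PreQCoh

namespace QCoh

variable {R : Type u} [CommRing R] {I : Type w} [SemilatticeInf I] {A : NCScheme R I}
  {ι : Type} {c : ι → I}

theorem sum_app {M N : QCoh A} {κ : Type*} (s : Finset κ) (f : κ → (M ⟶ N)) (i : I) (m : M.M i) :
    (∑ a ∈ s, f a).app i m = ∑ a ∈ s, (f a).app i m := by
  classical
  induction s using Finset.induction_on with
  | empty => rw [Finset.sum_empty, Finset.sum_empty]; rfl
  | insert a s ha ih => rw [Finset.sum_insert ha, Finset.sum_insert ha, ← ih]; rfl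

/-- Every quasi-coherent module embeds in an injective one that is relatively injective for the
functor `J`. -/
theorem exists_embedding [Finite ι] (hA : A.MeetBaseChange) (hc : Function.Surjective c)
    (M : QCoh A) :
    ∃ (E : QCoh A) (f : M ⟶ E), Mono f ∧ Injective E ∧ PreQCoh.RelInj c E.toPre := by
  have := Fintype.ofFinite ι
  let N : ∀ t, ModuleCat.{u} (A.A (c t))ᵐᵒᵖ := fun t =>
    Injective.under (ModuleCat.of (A.A (c t))ᵐᵒᵖ (M.M (c t)))
  let j : ∀ t, M.M (c t) →ₗ[(A.A (c t))ᵐᵒᵖ] N t := fun t =>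
    (Injective.ι (ModuleCat.of (A.A (c t))ᵐᵒᵖ (M.M (c t)))).hom
  have hj : ∀ t, Function.Injective (j t) := fun t =>
    (ModuleCat.mono_iff_injective _).1 inferInstance
  have hN : ∀ t, Module.Injective (A.A (c t))ᵐᵒᵖ (N t) := fun t =>
    Module.injective_module_of_injective_object _ _
      (inj := Injective.injective_under (ModuleCat.of (A.A (c t))ᵐᵒᵖ (M.M (c t))))
  choose g hg using fun t => exists_push_hom hA (c t) (j t)
  have hinj : ∀ t, Injective (push hA (c t) (N t)) := fun t => injective_push hA (c t) (hN t)
  have : Limits.HasFiniteBiproducts (QCoh A) := Abelian.hasFiniteBiproducts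
  refine ⟨⨁ fun t => push hA (c t) (N t), Limits.biproduct.lift g, ?_, inferInstance, ?_⟩
  · refine Preadditive.mono_of_cancel_zero _ fun {Z} h hh => hom_ext fun i z => ?_
    obtain ⟨t, rfl⟩ := hc i
    have h1 : h ≫ g t = 0 := by
      rw [← Limits.biproduct.lift_π g t, ← Category.assoc, hh, Limits.zero_comp]
    refine hj t ?_
    rw [← hg, ← comp_app, h1, zero_app, zero_app, map_zero, map_zero]
  · let G : ι → QCoh A := fun t => push hA (c t) (N t)
    refine PreQCoh.RelInj.of_sum (W := fun t => (G t).toPre)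
      (fun t => PreQCoh.RelInj.of_bijective t fun j =>
        pushRes_bijective (c t) inf_le_right (le_inf inf_le_left le_rfl))
      (fun t => homToPre (Limits.biproduct.π G t)) (fun t => homToPre (Limits.biproduct.ι G t))
      fun i m => ?_
    have := congrArg (fun f : (⨁ G) ⟶ ⨁ G => f.app i m) (Limits.biproduct.total (f := G))
    rw [sum_app] at this
    exact this

theorem shortExact_coker {M E : QCoh A} (f : M ⟶ E) [hf : Mono f] :
    (ShortComplex.mk f (cokerπ f) (comp_cokerπ f)).ShortExact where
  exact := ShortComplex.exact_of_g_is_cokernel _ (isColimitOfExact f (cokerπ f) (comp_cokerπ f)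
    (fun _ => Submodule.mkQ_surjective _) (fun _ _ hx => (Submodule.Quotient.mk_eq_zero _).1 hx))
  mono_f := hf
  epi_g := Limits.epi_of_isColimit_cofork (isColimitOfExact f (cokerπ f) (comp_cokerπ f)
    (fun _ => Submodule.mkQ_surjective _) (fun _ _ hx => (Submodule.Quotient.mk_eq_zero _).1 hx))

theorem toPre_shortExact_coker {M E : QCoh A} (f : M ⟶ E) [Mono f] :
    PreQCoh.ShortExact (homToPre f) (homToPre (cokerπ f)) where
  inj := injective_of_mono f
  surj _ := Submodule.mkQ_surjective _
  zero _ x := (Submodule.Quotient.mk_eq_zero _).2 ⟨x, rfl⟩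
  exact _ _ hx := (Submodule.Quotient.mk_eq_zero _).1 hx

/-- Vanishing of the cohomology computed with `J` gives the vanishing of the `Ext` groups in the
category of quasi-coherent modules. -/
theorem extVanishes_of_acyclic [Finite ι] (hA : A.MeetBaseChange) (hc : Function.Surjective c)
    {r : ℕ} {F : QCoh A} (hF : PreQCoh.Bundle ⊥ r F.toPre) (p : ℕ) (M : QCoh A)
    (hM : PreQCoh.Acyclic c F.toPre M.toPre) : ExtVanishes F M (p + 1) := by
  induction p generalizing M with
  | zero =>
    obtain ⟨E, f, hf, hE, hEc⟩ := exists_embedding hA hc M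
    have hex := toPre_shortExact_coker f
    refine (shortExact_coker f).extVanishes_one F fun t => ?_
    obtain ⟨s, hs⟩ := hex.homSurj hc
      (hF.homSurj_J (PreQCoh.torsion_bot _) _ hex.surj) (hM 0) (homToPre t)
    exact ⟨homOfPre s, hom_ext hs⟩
  | succ p ih =>
    obtain ⟨E, f, hf, hE, hEc⟩ := exists_embedding hA hc M
    have hex := toPre_shortExact_coker f
    exact (shortExact_coker f).extVanishes_left F
      (ih _ (hex.acyclic_right hc hF (PreQCoh.torsion_bot _) hM (hEc.acyclic _)))

end QCoh

/-! ### Lifting bijectivity from the residue field -/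

namespace NC

variable {R : Type u} [CommRing R] [IsLocalRing R] [IsArtinianRing R]
  {P Q : Type u} [AddCommGroup P] [Module R P] [AddCommGroup Q] [Module R Q]

/-- Nakayama's lemma for the nilpotent maximal ideal of an Artinian local ring: no finiteness is
needed. -/
theorem surjective_of_reduction (g : P →ₗ[R] Q)
    (h : ∀ q, ∃ p, q - g p ∈ IsLocalRing.maximalIdeal R • (⊤ : Submodule R Q)) :
    Function.Surjective g := by
  let s : Set (Ideal R) := {𝔞 | ∀ q, ∃ p, q - g p ∈ 𝔞 • (⊤ : Submodule R Q)}
  obtain ⟨𝔞, h𝔞, hmin⟩ := WellFounded.has_min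
    (r := fun a b : Ideal R => a < b) wellFounded_lt s ⟨_, h⟩
  by_cases hb : 𝔞 = ⊥
  · intro q
    obtain ⟨p, hp⟩ := h𝔞 q
    rw [hb, Submodule.bot_smul, Submodule.mem_bot, sub_eq_zero] at hp
    exact ⟨p, hp.symm⟩
  · obtain ⟨𝔟, t, hlt, hs⟩ := exists_isStep hb
    refine absurd hlt (hmin 𝔟 fun q => ?_)
    obtain ⟨p, hp⟩ := h𝔞 q
    obtain ⟨y, hy⟩ := hs.exists_sub_smul_mem hp
    obtain ⟨p', hp'⟩ := h y
    refine ⟨p + t • p', ?_⟩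
    have := add_mem hy (hs.smul_mem hp')
    rw [map_add, map_smul]
    convert this using 1
    rw [smul_sub]
    abel

/-- A homomorphism to a flat module over an Artinian local ring is injective if its reduction modulo
the maximal ideal is. -/
theorem injective_of_reduction [Module.Flat R Q] (g : P →ₗ[R] Q)
    (h : ∀ p, g p ∈ IsLocalRing.maximalIdeal R • (⊤ : Submodule R Q) →
      p ∈ IsLocalRing.maximalIdeal R • (⊤ : Submodule R P)) :
    Function.Injective g := by
  let s : Set (Ideal R) := {𝔞 | ∀ p, g p ∈ 𝔞 • (⊤ : Submodule R Q) → p ∈ 𝔞 • (⊤ : Submodule R P)}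
  obtain ⟨𝔞, h𝔞, hmin⟩ := WellFounded.has_min
    (r := fun a b : Ideal R => a < b) wellFounded_lt s ⟨_, h⟩
  by_cases hb : 𝔞 = ⊥
  · rw [injective_iff_map_eq_zero]
    intro p hp
    have := h𝔞 p (by rw [hp]; exact zero_mem _)
    rwa [hb, Submodule.bot_smul, Submodule.mem_bot] at this
  · obtain ⟨𝔟, t, hlt, hs⟩ := exists_isStep hb
    refine absurd hlt (hmin 𝔟 fun p hp => ?_)
    obtain ⟨y, hy⟩ := hs.exists_sub_smul_mem
      (h𝔞 p (Submodule.smul_mono_left (N := (⊤ : Submodule R Q)) hs.le hp))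
    have h1 := sub_mem hp (map_mem_smul_top g hy)
    rw [map_sub, sub_sub_cancel, map_smul] at h1
    have h2 := add_mem hy (hs.smul_mem (h y (mem_smul_top_of_flat hs.colon h1)))
    rwa [sub_add_cancel] at h2

theorem exists_addHom_desc {G H K : Type*} [AddCommGroup G] [AddCommGroup H] [AddCommGroup K]
    (g : G →+ H) (hg : Function.Surjective g) (f : G →+ K) (h : ∀ x, g x = 0 → f x = 0) :
    ∃ f' : H →+ K, ∀ x, f' (g x) = f x :=
  ⟨g.liftOfSurjective hg ⟨f, h⟩, fun x => g.liftOfRightInverse_comp_apply _ _ ⟨f, h⟩ x⟩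

/-- Descent of a biadditive map along surjections in both arguments. -/
theorem exists_biaddHom_desc {G H K G' H' : Type*} [AddCommGroup G] [AddCommGroup H]
    [AddCommGroup G'] [AddCommGroup H'] [AddCommGroup K]
    (g : G →+ H) (hg : Function.Surjective g) (g' : G' →+ H') (hg' : Function.Surjective g')
    (f : G →+ G' →+ K) (h : ∀ x y, g x = 0 → f x y = 0) (h' : ∀ x y, g' y = 0 → f x y = 0) :
    ∃ f' : H →+ H' →+ K, ∀ x y, f' (g x) (g' y) = f x y := by
  obtain ⟨f₁, hf₁⟩ := exists_addHom_desc g hg f (fun x hx => by ext y; exact h x y hx)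
  obtain ⟨f₂, hf₂⟩ := exists_addHom_desc g' hg' f₁.flip (fun y hy => by
    ext x
    obtain ⟨x, rfl⟩ := hg x
    rw [AddMonoidHom.flip_apply, hf₁, h' x y hy]; rfl)
  refine ⟨f₂.flip, fun x y => ?_⟩
  rw [AddMonoidHom.flip_apply, hf₂, AddMonoidHom.flip_apply, hf₁]

end NC

/-! ### Base change for intersections of affine open subsets -/

theorem CommRingCat.exists_bijective_of_isPushout {S A B C : CommRingCat.{u}} {f : S ⟶ A}
    {g : S ⟶ B} {a : A ⟶ C} {b : B ⟶ C} (H : IsPushout f g a b) :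
    letI := f.hom.toAlgebra
    letI := g.hom.toAlgebra
    ∃ v : A ⊗[S] B →+ C, Function.Bijective v ∧ ∀ x y, v (x ⊗ₜ y) = a x * b y := by
  let := f.hom.toAlgebra
  let := g.hom.toAlgebra
  let e := (CommRingCat.isPushout_tensorProduct S A B).isoIsPushout A B H
  let e' := e.commRingCatIsoToRingEquiv
  refine ⟨(e' : A ⊗[S] B →+* C).toAddMonoidHom, e'.bijective, fun x y => ?_⟩
  have h1 : ∀ x, e' (x ⊗ₜ 1) = a x := fun x => congrArg (fun q : A ⟶ C => q.hom x)
    ((CommRingCat.isPushout_tensorProduct S A B).inl_isoIsPushout_hom A B H)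
  have h2 : ∀ y, e' (1 ⊗ₜ y) = b y := fun y => congrArg (fun q : B ⟶ C => q.hom y)
    ((CommRingCat.isPushout_tensorProduct S A B).inr_isoIsPushout_hom A B H)
  change e' (x ⊗ₜ y) = _
  rw [← h1, ← h2, ← map_mul, Algebra.TensorProduct.tmul_mul_tmul, mul_one, one_mul]

/-- `Γ(U) ⊗_{Γ(W)} Γ(V) ≅ Γ(U ∩ V)` for affine open subsets `U, V ⊆ W`; the intersection is named
`D` so that it may be an open subset that is only propositionally equal to `U ⊓ V`. -/
theorem AlgebraicGeometry.isPushout_inf {X : Scheme.{u}} {U V W D : X.Opens} (hU : U ≤ W)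
    (hV : V ≤ W) (hD : D = U ⊓ V) (aU : IsAffineOpen U) (aV : IsAffineOpen V)
    (aW : IsAffineOpen W) :
    IsPushout (X.presheaf.map (homOfLE hU).op) (X.presheaf.map (homOfLE hV).op)
      (X.presheaf.map (homOfLE (hD.le.trans inf_le_left)).op)
      (X.presheaf.map (homOfLE (hD.le.trans inf_le_right)).op) := by
  subst hD
  have : IsAffine U := aU
  have : IsAffine V := aV
  have : IsAffine W := aW
  refine (isPushout_appTop_of_isPullback (isPullback_opens_inf_le hU hV)).of_iso
    W.topIso U.topIso V.topIso (U ⊓ V).topIso ?_ ?_ ?_ ?_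
  all_goals
    have key : ∀ {V₁ V₂ V₃ V₄ : X.Opensᵒᵖ} (a : V₁ ⟶ V₂) (b : V₂ ⟶ V₃) (a' : V₁ ⟶ V₄)
        (b' : V₄ ⟶ V₃), X.presheaf.map a ≫ X.presheaf.map b =
          X.presheaf.map a' ≫ X.presheaf.map b' := fun a b a' b' => by
      rw [← Functor.map_comp, ← Functor.map_comp]
      exact congrArg _ (Subsingleton.elim _ _)
    rw [Scheme.homOfLE_appTop]
    exact key _ _ _ _

namespace NCDeformation

open AlgebraicGeometry.Scheme.Modules

variable {k : Type u} [Field k] {X : Scheme.{u}} {f : X ⟶ Spec (.of k)}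
  {I : Type w} [SemilatticeInf I] {𝒰 : AffineMeetCover X I}
  {R : Type u} [CommRing R] [IsLocalRing R] [Algebra k R] (D : NCDeformation f 𝒰 R)

/-- Modulo the maximal ideal, this is base change for the intersection of the affine open subsets
`U_{i ∧ j}` and `U_l` of `U_j`; the target is flat over `R`, so the reduction modulo the maximal
ideal decides. -/
theorem meetBaseChange [IsArtinianRing R] : D.MeetBaseChange := by
  intro i l j h
  have hD : 𝒰.U (i ⊓ l) = 𝒰.U (i ⊓ j) ⊓ 𝒰.U l := by
    rw [← 𝒰.inf, inf_assoc, inf_eq_right.2 h]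
  obtain ⟨v, hv, hvt⟩ := CommRingCat.exists_bijective_of_isPushout
    (isPushout_inf (𝒰.mono (inf_le_right : i ⊓ j ≤ j)) (𝒰.mono h) hD (𝒰.isAffine _)
      (𝒰.isAffine _) (𝒰.isAffine _))
  let := (X.presheaf.map (homOfLE (𝒰.mono (inf_le_right : i ⊓ j ≤ j))).op).hom.toAlgebra
  let := (X.presheaf.map (homOfLE (𝒰.mono h)).op).hom.toAlgebra
  let φ : D.A j →+* D.A l := D.φ h
  let B := NC.Restrict (D.φ (inf_le_right : i ⊓ j ≤ j) : D.A j →+* D.A (i ⊓ j))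
  let P := NC.RightTensor φ B
  let : Module R P := Module.compHom P ((NC.RightTensor.act (M := B) φ).comp
    (algebraMap R (D.A l)ᵐᵒᵖ))
  let mk : D.A (i ⊓ j) → D.A l → P := fun b c => NC.RightTensor.tmul φ (M := B) b c
  have hmk : ∀ b (a : D.A j) c, mk (b * D.φ inf_le_right a) c = mk b (D.φ h a * c) :=
    fun b a c => NC.RightTensor.tmul_balanced φ (M := B) b a c
  have hsmul : ∀ (r : R) b c, r • mk b c = mk b (r • c) := fun r b c => by
    refine (NC.RightTensor.act_tmul φ (M := B) _ b c).trans (congrArg (mk b) ?_)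
    rw [MulOpposite.algebraMap_apply, unop_op, ← Algebra.commutes, Algebra.smul_def]
  have hsmul' : ∀ (r : R) b c, mk (r • b) c = r • mk b c := by
    intro r b c
    have h1 : r • b = b * D.φ (inf_le_right : i ⊓ j ≤ j) (algebraMap R (D.A j) r) := by
      rw [AlgHom.commutes, ← Algebra.commutes, Algebra.smul_def]
    rw [hsmul, h1, hmk, AlgHom.commutes, Algebra.smul_def]
  let g₀ : P →+ D.A (i ⊓ l) := NC.glue φ (M := NC.Restrict (D.φ (inf_le_right : i ⊓ l ≤ l) :
    D.A l →+* D.A (i ⊓ l))) (D.meetRes i h) (D.meetRes_smul i h)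
  have hg₀ : ∀ b c, g₀ (mk b c) = D.φ (inf_le_inf_left i h) b * D.φ inf_le_right c :=
    fun _ _ => rfl
  have hlin : ∀ (r : R) b c, g₀ (r • mk b c) = r • g₀ (mk b c) := fun r b c => by
    rw [hsmul, hg₀, hg₀, _root_.map_smul, mul_smul_comm]
  let g : P →ₗ[R] D.A (i ⊓ l) :=
    { g₀ with
      map_smul' := fun r p => by
        change g₀ (r • p) = r • g₀ p
        induction p using NC.RightTensor.induction_on with
        | h0 => rw [smul_zero, map_zero, smul_zero]
        | ht b c => exact hlin r b c
        | ha x y hx hy => rw [smul_add, map_add, map_add, smul_add, hx, hy] }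
  have hγ : ∀ (b : D.A (i ⊓ j)) (c : D.A l), D.γ (i ⊓ l) (g (mk b c)) =
      v (D.γ (i ⊓ j) b ⊗ₜ D.γ l c) := by
    intro b c
    rw [hvt]
    refine (congrArg (D.γ (i ⊓ l)) (hg₀ b c)).trans ?_
    rw [map_mul, γ_φ, γ_φ]
    rfl
  have hbal : ∀ (a : D.A j) (b : D.A (i ⊓ j)), D.γ j a • D.γ (i ⊓ j) b =
      D.γ (i ⊓ j) (b * D.φ inf_le_right a) := by
    intro a b
    rw [map_mul, mul_comm, γ_φ]
    exact Algebra.smul_def _ _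
  have hbal' : ∀ (a : D.A j) (c : D.A l), D.γ j a • D.γ l c = D.γ l (D.φ h a * c) := by
    intro a c
    rw [map_mul, γ_φ]
    exact Algebra.smul_def _ _
  have := D.flat_base
  refine ⟨NC.injective_of_reduction (Q := D.A (i ⊓ l)) g fun p hp => ?_,
    NC.surjective_of_reduction g fun q => ?_⟩
  · let S := IsLocalRing.maximalIdeal R • (⊤ : Submodule R P)
    have hS : ∀ r ∈ IsLocalRing.maximalIdeal R, ∀ p, r • p ∈ S := fun r hr p =>
      Submodule.smul_mem_smul hr trivial
    let f₀ : D.A (i ⊓ j) →+ D.A l →+ P ⧸ S := AddMonoidHom.mk'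
      (fun b => AddMonoidHom.mk' (fun c => S.mkQ (mk b c)) (fun c c' =>
        (congrArg S.mkQ (NC.RightTensor.tmul_add φ (M := B) b c c')).trans (map_add _ _ _)))
      (fun b b' => by
        ext c
        exact (congrArg S.mkQ (NC.RightTensor.add_tmul φ (M := B) b b' c)).trans (map_add _ _ _))
    have hf₀ : ∀ b c, f₀ b c = S.mkQ (mk b c) := fun _ _ => rfl
    obtain ⟨f₁, hf₁⟩ := NC.exists_biaddHom_desc (D.γ (i ⊓ j)).toAddMonoidHom
      (D.γ_surjective (i ⊓ j)) (D.γ l).toAddMonoidHom (D.γ_surjective l) f₀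
      (fun b c hb => by
        refine Submodule.smul_induction_on ((D.γ_eq_zero _ _).1 hb) (fun r hr x _ => ?_)
          (fun x y hx hy => ?_)
        · rw [hf₀, hsmul']
          exact (Submodule.Quotient.mk_eq_zero _).2 (hS r hr _)
        · rw [map_add, AddMonoidHom.add_apply, hx, hy, add_zero])
      (fun b c hc => by
        refine Submodule.smul_induction_on ((D.γ_eq_zero _ _).1 hc) (fun r hr x _ => ?_)
          (fun x y hx hy => ?_)
        · rw [hf₀, ← hsmul]
          exact (Submodule.Quotient.mk_eq_zero _).2 (hS r hr _)
        · rw [map_add, hx, hy, add_zero])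
    have hf₁' : ∀ b c, f₁ (D.γ (i ⊓ j) b) (D.γ l c) = S.mkQ (mk b c) := hf₁
    let s : Γ(X, 𝒰.U (i ⊓ j)) ⊗[Γ(X, 𝒰.U j)] Γ(X, 𝒰.U l) →+ P ⧸ S :=
      TensorProduct.liftAddHom f₁ (fun a b c => by
        obtain ⟨a, rfl⟩ := D.γ_surjective _ a
        obtain ⟨b, rfl⟩ := D.γ_surjective _ b
        obtain ⟨c, rfl⟩ := D.γ_surjective _ c
        rw [hbal, hbal', hf₁', hf₁', hmk])
    let w₀ : D.A (i ⊓ j) →+ D.A l →+ Γ(X, 𝒰.U (i ⊓ j)) ⊗[Γ(X, 𝒰.U j)] Γ(X, 𝒰.U l) :=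
      AddMonoidHom.mk' (fun b => AddMonoidHom.mk' (fun c => D.γ (i ⊓ j) b ⊗ₜ D.γ l c)
        (fun c c' => by rw [map_add, TensorProduct.tmul_add]))
        (fun b b' => by
          ext c
          change D.γ (i ⊓ j) (b + b') ⊗ₜ D.γ l c = _ ⊗ₜ _ + _ ⊗ₜ _
          rw [map_add, TensorProduct.add_tmul])
    let w : P →+ Γ(X, 𝒰.U (i ⊓ j)) ⊗[Γ(X, 𝒰.U j)] Γ(X, 𝒰.U l) :=
      NC.RightTensor.lift φ (M := B) w₀ (fun b a c => by
        have key : ∀ b : D.A (i ⊓ j), D.γ (i ⊓ j) (b * D.φ inf_le_right a) ⊗ₜ D.γ l c =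
            D.γ (i ⊓ j) b ⊗ₜ[Γ(X, 𝒰.U j)] D.γ l (D.φ h a * c) := fun b => by
          rw [← hbal, ← hbal', TensorProduct.smul_tmul]
        exact key b)
    have hvw : ∀ p, v (w p) = D.γ (i ⊓ l) (g p) :=
      DFunLike.congr_fun (f := v.comp w) (g := (D.γ (i ⊓ l)).toAddMonoidHom.comp g.toAddMonoidHom)
        (NC.RightTensor.hom_ext φ (M := B) fun b c => (hγ b c).symm)
    have hsw : ∀ p, s (w p) = S.mkQ p :=
      DFunLike.congr_fun (f := s.comp w) (g := S.mkQ.toAddMonoidHom)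
        (NC.RightTensor.hom_ext φ (M := B) fun b c => hf₁' b c)
    have hw : w p = 0 := hv.1 (by rw [hvw, map_zero, (D.γ_eq_zero _ _).2 hp])
    exact (Submodule.Quotient.mk_eq_zero S).1 ((hsw p).symm.trans (by rw [hw, map_zero]))
  · have key : ∀ x, ∃ p, D.γ (i ⊓ l) (g p) = v x := by
      intro x
      induction x using TensorProduct.induction_on with
      | zero => exact ⟨0, by rw [map_zero, map_zero, map_zero]⟩
      | tmul b c =>
        obtain ⟨b, rfl⟩ := D.γ_surjective _ b
        obtain ⟨c, rfl⟩ := D.γ_surjective _ c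
        exact ⟨mk b c, hγ b c⟩
      | add x y hx hy =>
        obtain ⟨p, hp⟩ := hx
        obtain ⟨p', hp'⟩ := hy
        exact ⟨p + p', by rw [map_add, map_add, map_add, hp, hp']⟩
    obtain ⟨x, hx⟩ := hv.2 (D.γ (i ⊓ l) q)
    obtain ⟨p, hp⟩ := key x
    refine ⟨p, (D.γ_eq_zero _ _).1 ?_⟩
    rw [map_sub, hp, hx, sub_self]

end NCDeformation

/-! ### A flatness criterion over an Artinian local ring -/

/-- A module `E` over an Artinian local ring is flat if, for every step `𝔟 ⊆ 𝔞 = 𝔟 + R t` with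
`𝔞 / 𝔟 ≅ R / 𝔪`, multiplication by `t` induces an injective map `E / 𝔪 E → E / 𝔟 E`. -/
theorem NC.flat_of_isStep {R : Type u} [CommRing R] [IsLocalRing R] [IsArtinianRing R]
    {E : Type*} [AddCommGroup E] [Module R E]
    (h : ∀ 𝔟 𝔞 t, IsStep (IsLocalRing.maximalIdeal R) 𝔟 𝔞 t → ∀ e : E,
      t • e ∈ 𝔟 • (⊤ : Submodule R E) → e ∈ IsLocalRing.maximalIdeal R • (⊤ : Submodule R E)) :
    Module.Flat R E := by
  rw [Module.Flat.iff_rTensor_injective']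
  intro 𝔞
  induction 𝔞 using ideal_induction with
  | h0 =>
    have h0 : ∀ x : (⊥ : Ideal R) ⊗[R] E, x = 0 := by
      intro x
      induction x using TensorProduct.induction_on with
      | zero => rfl
      | tmul b e => rw [Subsingleton.elim b 0, TensorProduct.zero_tmul]
      | add x y hx hy => rw [hx, hy, add_zero]
    intro x y _
    rw [h0 x, h0 y]
  | h1 𝔟 𝔞 t hs ih =>
    let j : 𝔟 →ₗ[R] 𝔞 := Submodule.inclusion hs.le
    have hj : ∀ z, 𝔞.subtype.rTensor E (j.rTensor E z) = 𝔟.subtype.rTensor E z := by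
      intro z
      rw [← LinearMap.comp_apply, ← LinearMap.rTensor_comp]
      rfl
    have hdec : ∀ x : 𝔞 ⊗[R] E, ∃ (z : 𝔟 ⊗[R] E) (e : E),
        x = j.rTensor E z + (⟨t, hs.mem⟩ : 𝔞) ⊗ₜ e := by
      intro x
      induction x using TensorProduct.induction_on with
      | zero => exact ⟨0, 0, by rw [map_zero, TensorProduct.tmul_zero, add_zero]⟩
      | tmul a e =>
        obtain ⟨r, hr⟩ := hs.exists_sub a a.2
        refine ⟨(⟨_, hr⟩ : 𝔟) ⊗ₜ e, r • e, ?_⟩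
        rw [LinearMap.rTensor_tmul, ← TensorProduct.smul_tmul, ← TensorProduct.add_tmul]
        congr 1
        exact Subtype.ext (sub_add_cancel _ _).symm
      | add x y hx hy =>
        obtain ⟨z, e, rfl⟩ := hx
        obtain ⟨z', e', rfl⟩ := hy
        exact ⟨z + z', e + e', by rw [map_add, TensorProduct.tmul_add, add_add_add_comm]⟩
    have hmem : ∀ z : 𝔟 ⊗[R] E, TensorProduct.lid R E (𝔟.subtype.rTensor E z) ∈
        𝔟 • (⊤ : Submodule R E) := by
      intro z
      induction z using TensorProduct.induction_on with
      | zero => rw [map_zero, map_zero]; exact zero_mem _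
      | tmul b e => exact Submodule.smul_mem_smul b.2 trivial
      | add x y hx hy => rw [map_add, map_add]; exact add_mem hx hy
    have hlift : ∀ e ∈ IsLocalRing.maximalIdeal R • (⊤ : Submodule R E),
        ∃ z : 𝔟 ⊗[R] E, j.rTensor E z = (⟨t, hs.mem⟩ : 𝔞) ⊗ₜ e := by
      intro e he
      refine Submodule.smul_induction_on he (fun m hm e _ => ?_) (fun x y hx hy => ?_)
      · refine ⟨(⟨m * t, (hs.colon m).2 hm⟩ : 𝔟) ⊗ₜ e, ?_⟩
        rw [LinearMap.rTensor_tmul, ← TensorProduct.smul_tmul]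
        rfl
      · obtain ⟨z, hz⟩ := hx
        obtain ⟨z', hz'⟩ := hy
        exact ⟨z + z', by rw [map_add, hz, hz', TensorProduct.tmul_add]⟩
    rw [injective_iff_map_eq_zero]
    intro x hx
    obtain ⟨z, e, rfl⟩ := hdec x
    have h1 : t • e ∈ 𝔟 • (⊤ : Submodule R E) := by
      have h2 := congrArg (TensorProduct.lid R E) hx
      rw [map_add, map_add, hj, map_zero] at h2
      have h3 : TensorProduct.lid R E (𝔟.subtype.rTensor E z) + t • e = 0 := h2
      rw [← neg_eq_of_add_eq_zero_right h3]
      exact neg_mem (hmem z)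
    obtain ⟨z', hz'⟩ := hlift e (h 𝔟 𝔞 t hs e h1)
    rw [← hz', ← map_add, hj] at hx
    rw [← hz', ← map_add, (injective_iff_map_eq_zero _).1 ih _ hx, map_zero]

/-! ### Vector bundles as quasi-coherent modules -/

namespace PreQCoh

variable {R : Type u} [CommRing R] {I : Type w} [SemilatticeInf I] {A : NCScheme R I}
  {ι : Type} {c : ι → I}

/-- A vector bundle is quasi-coherent, since its bases restrict to bases. -/
theorem Bundle.glue_bijective {r : ℕ} {P : PreQCoh A} (hP : Bundle ⊥ r P) {i j : I} (h : i ≤ j) :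
    Function.Bijective (NC.glue (A.φ h : A.A j →+* A.A i) (P.ρ h) (P.ρ_smul h)) := by
  obtain ⟨e, he⟩ := hP j
  let G := NC.glue (A.φ h : A.A j →+* A.A i) (P.ρ h) (P.ρ_smul h)
  let φ : A.A j →+* A.A i := A.φ h
  have hG : ∀ t : Fin r → A.A i, G (∑ a, NC.RightTensor.tmul φ (e a) (t a)) =
      NC.combo (fun a => P.ρ h (e a)) t := by
    intro t
    rw [map_sum]
    rfl
  constructor
  · rw [injective_iff_map_eq_zero]
    intro x hx
    have hx' : ∃ t : Fin r → A.A i, x = ∑ a, NC.RightTensor.tmul φ (e a) (t a) := by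
      clear hx
      induction x using NC.RightTensor.induction_on with
      | h0 => exact ⟨0, by simp⟩
      | ht m b =>
        obtain ⟨s, rfl⟩ := (he j le_rfl).surj m
        refine ⟨fun a => φ (s a) * b, ?_⟩
        rw [NC.combo_apply]
        have : NC.RightTensor.tmul φ (∑ a, op (s a) • P.ρ le_rfl (e a)) b =
            ∑ a, NC.RightTensor.tmul φ (op (s a) • P.ρ le_rfl (e a)) b :=
          map_sum ((NC.RightTensor.mk₂ (M := P.M j) φ).flip b) _ _
        refine this.trans (Finset.sum_congr rfl fun a _ => ?_)
        rw [P.ρ_refl, NC.RightTensor.tmul_balanced]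
      | ha x y hx hy =>
        obtain ⟨t, rfl⟩ := hx
        obtain ⟨t', rfl⟩ := hy
        refine ⟨t + t', ?_⟩
        rw [← Finset.sum_add_distrib]
        exact Finset.sum_congr rfl fun a _ => (NC.RightTensor.tmul_add _ _ _ _).symm
    obtain ⟨t, rfl⟩ := hx'
    have ht := ((he i h).ker t).1 ((hG t).symm.trans hx)
    refine Finset.sum_eq_zero fun a _ => ?_
    have := ht a
    rw [Submodule.bot_smul, Submodule.mem_bot] at this
    rw [this, NC.RightTensor.tmul_zero]
  · intro y
    obtain ⟨t, rfl⟩ := (he i h).surj y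
    exact ⟨_, hG t⟩

theorem Bundle.exists_qcoh {r : ℕ} {P : PreQCoh A} (hP : Bundle ⊥ r P) :
    ∃ F : QCoh A, F.toPre = P :=
  ⟨{ M := P.M, ρ := P.ρ, ρ_smul := P.ρ_smul, ρ_refl := P.ρ_refl, ρ_comp := P.ρ_comp,
     bijective := fun h => hP.glue_bijective h }, rfl⟩

theorem Bundle.isLocallyFreeOfRank {r : ℕ} {F : QCoh A} (hF : Bundle ⊥ r F.toPre) :
    F.IsLocallyFreeOfRank r := by
  intro i
  obtain ⟨e, he⟩ := hF i
  refine ⟨(LinearEquiv.ofBijective (NC.combo (S := A.A i) fun a => F.ρ le_rfl (e a))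
    ⟨?_, (he i le_rfl).surj⟩).symm⟩
  rw [← LinearMap.ker_eq_bot, LinearMap.ker_eq_bot']
  intro t ht
  funext a
  have := ((he i le_rfl).ker t).1 ht a
  rwa [Submodule.bot_smul, Submodule.mem_bot] at this

theorem _root_.QCoh.IsLocallyFree.flat (hA : ∀ i, Module.Flat R (A.A i)) {F : QCoh A}
    (hF : F.IsLocallyFree) (i : I) : Module.Flat R (F.M i) := by
  obtain ⟨r, hr⟩ := hF
  obtain ⟨e⟩ := hr i
  have := hA i
  have : Module.Flat R (Fin r → A.A i) :=
    Module.Flat.of_linearEquiv (DirectSum.linearEquivFunOnFintype R (Fin r) fun _ => A.A i).symm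
  have e' : F.M i ≃ₗ[R] (Fin r → A.A i) :=
    { e.toAddEquiv with map_smul' := fun a m => e.toLinearMap.map_smul_of_tower a m }
  exact Module.Flat.of_linearEquiv e'

/-! ### Lifting homomorphisms along reductions -/

variable [IsLocalRing R] [IsArtinianRing R]

/-- `Hom(P, F) → Hom(P, P₀)` is surjective, as the kernel `𝔪 F` of `F → P₀` is acyclic. -/
theorem IsReduction.homSurj (hc : Function.Surjective c) {P F P₀ : PreQCoh A} {r : ℕ}
    (hP : Bundle ⊥ r P) {π : Hom F P₀} (hπ : IsReduction (IsLocalRing.maximalIdeal R) π)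
    (hF : ∀ i, Module.Flat R (F.M i)) (h₀ : Acyclic c P P₀) : HomSurj P π :=
  hπ.shortExact.homSurj hc (hP.homSurj_J (torsion_bot _) _ hπ.surj)
    (hπ.acyclic_idealSub hc hP hF h₀ _ 0)

/-- A homomorphism that is compatible with reductions to the same `P₀` is bijective if its target
is flat. -/
theorem IsReduction.bijective {F F' P₀ : PreQCoh A} {π : Hom F P₀} {π' : Hom F' P₀}
    (hπ : IsReduction (IsLocalRing.maximalIdeal R) π)
    (hπ' : IsReduction (IsLocalRing.maximalIdeal R) π') (hF' : ∀ i, Module.Flat R (F'.M i))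
    (s : Hom F F') (hs : ∀ i x, π'.app i (s.app i x) = π.app i x) (i : I) :
    Function.Bijective (s.app i) := by
  have := hF' i
  refine ⟨NC.injective_of_reduction (s.appBase i) fun x hx => ?_,
    NC.surjective_of_reduction (s.appBase i) fun y => ?_⟩
  · rw [← hπ.ker, ← hs]
    exact (hπ'.ker _ _).2 hx
  · obtain ⟨x, hx⟩ := hπ.surj i (π'.app i y)
    refine ⟨x, (hπ'.ker _ _).1 ?_⟩
    rw [map_sub]
    exact sub_eq_zero.2 (hx.symm.trans (hs i x).symm)

end PreQCoh

/-! ### The endomorphisms of a lift -/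

namespace QCoh

variable {R : Type u} [CommRing R] [IsLocalRing R] [IsArtinianRing R] {I : Type w}
  [SemilatticeInf I] {A : NCScheme R I} {ι : Type} {c : ι → I}

omit [IsLocalRing R] [IsArtinianRing R] in
theorem app_mem_of_mem {F G : QCoh A} {𝔞 : Ideal R} {e : F ⟶ G}
    (he : e ∈ 𝔞 • (⊤ : Submodule R (F ⟶ G))) (i : I) (m : F.M i) :
    e.app i m ∈ 𝔞 • (⊤ : Submodule R (G.M i)) := by
  refine Submodule.smul_induction_on he (fun a ha e _ => ?_) (fun x y hx hy => ?_)
  · exact Submodule.smul_mem_smul ha trivial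
  · exact add_mem hx hy

/-- `Hom(F, 𝔞 F) = 𝔞 Hom(F, F)` for a lift `F` of an acyclic `P₀`. -/
theorem mem_of_app_mem (hc : Function.Surjective c) {F : QCoh A} {P₀ : PreQCoh A} {r : ℕ}
    (hP : PreQCoh.Bundle ⊥ r F.toPre) {π : PreQCoh.Hom F.toPre P₀}
    (hπ : PreQCoh.IsReduction (IsLocalRing.maximalIdeal R) π) (hF : ∀ i, Module.Flat R (F.M i))
    (h₀ : PreQCoh.Acyclic c F.toPre P₀) (𝔞 : Ideal R) (e : F ⟶ F)
    (he : ∀ i m, e.app i m ∈ 𝔞 • (⊤ : Submodule R (F.M i))) :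
    e ∈ 𝔞 • (⊤ : Submodule R (F ⟶ F)) := by
  induction 𝔞 using ideal_induction generalizing e with
  | h0 =>
    have : e = 0 := hom_ext fun i m => by
      have := he i m
      rwa [Submodule.bot_smul, Submodule.mem_bot] at this
    rw [this]; exact zero_mem _
  | h1 𝔟 𝔞 t hs ih =>
    obtain ⟨f, g, hfg, hf, hg⟩ := hπ.exists_shortExact hs hF
    obtain ⟨e', he'⟩ := PreQCoh.exists_lift (F.toPre.idealSubι 𝔞) (fun i => Subtype.val_injective)
      (homToPre e) (fun i m => ⟨⟨e.app i m, he i m⟩, rfl⟩)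
    obtain ⟨s, hs'⟩ := hπ.homSurj hc hP hF h₀ (g.comp e')
    have h1 : e - t • homOfPre s ∈ 𝔟 • (⊤ : Submodule R (F ⟶ F)) := by
      refine ih _ fun i m => ?_
      obtain ⟨y, hy⟩ := hfg.exact i
        (e'.app i m - ⟨t • s.app i m, F.toPre.smul_mem_idealSubmodule hs.mem _⟩) (by
          rw [map_sub, hg, hs', PreQCoh.Hom.comp_app, sub_self])
      have h2 := congrArg Subtype.val hy
      rw [hf] at h2
      have h3 : (y : F.M i) = e.app i m - t • s.app i m :=
        h2.trans (congrArg (· - t • s.app i m) (he' i m))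
      change e.app i m - t • s.app i m ∈ _
      rw [← h3]
      exact y.2
    rw [← sub_add_cancel e (t • homOfPre s)]
    exact add_mem (Submodule.smul_mono_left hs.le h1) (Submodule.smul_mem_smul hs.mem trivial)

/-- The endomorphisms of a lift form a flat module, since `Hom(F, 𝔞 F) = 𝔞 Hom(F, F)` transports the
flatness of `F`. -/
theorem flat_end (hc : Function.Surjective c) {F : QCoh A} {P₀ : PreQCoh A} {r : ℕ}
    (hP : PreQCoh.Bundle ⊥ r F.toPre) {π : PreQCoh.Hom F.toPre P₀}
    (hπ : PreQCoh.IsReduction (IsLocalRing.maximalIdeal R) π) (hF : ∀ i, Module.Flat R (F.M i))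
    (h₀ : PreQCoh.Acyclic c F.toPre P₀) : Module.Flat R (F ⟶ F) := by
  refine NC.flat_of_isStep fun 𝔟 𝔞 t hs e he => mem_of_app_mem hc hP hπ hF h₀ _ e fun i m => ?_
  have := hF i
  exact NC.mem_smul_top_of_flat hs.colon (app_mem_of_mem he i m)

end QCoh

/-! ### Reduction isomorphisms and reduction homomorphisms -/

namespace NCDeformation

variable {k : Type u} [Field k] {X : Scheme.{u}} {f : X ⟶ Spec (.of k)}
  {I : Type w} [SemilatticeInf I] {𝒰 : AffineMeetCover X I}
  {R : Type u} [CommRing R] [IsLocalRing R] [Algebra k R] (D : NCDeformation f 𝒰 R)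

theorem residue_tmul {N : Type*} [AddCommGroup N] [Module R N] (a : R) (n : N) :
    IsLocalRing.residue R a ⊗ₜ[R] n = 1 ⊗ₜ[R] (a • n) := by
  rw [← TensorProduct.smul_tmul, Algebra.smul_def, mul_one]
  rfl

theorem one_tmul_eq_zero_iff {N : Type*} [AddCommGroup N] [Module R N] (n : N) :
    (1 : IsLocalRing.ResidueField R) ⊗ₜ[R] n = 0 ↔
      n ∈ IsLocalRing.maximalIdeal R • (⊤ : Submodule R N) :=
  NC.one_tmul_eq_zero_iff _ n

variable {D} {F : QCoh D.toNCScheme} {F₀ : X.Modules}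

/-- The reduction homomorphism `m ↦ θ(1 ⊗ m)` of an isomorphism `θ : R/𝔪 ⊗ F ≅ F₀`. -/
noncomputable def _root_.ReductionIso.toHom (red : ReductionIso D F F₀) :
    PreQCoh.Hom F.toPre (D.sections F₀) where
  app i :=
    { toFun := fun m => red.θ i (1 ⊗ₜ[R] m)
      map_add' := fun m n => by rw [TensorProduct.tmul_add, map_add]; rfl
      map_smul' := fun a m => by
        have := red.θ_smul i 1 1 m a.unop
        rw [one_mul] at this
        exact this }
  comm h m := red.θ_comm h (1 ⊗ₜ[R] m)

theorem _root_.ReductionIso.isReduction (red : ReductionIso D F F₀) :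
    PreQCoh.IsReduction (IsLocalRing.maximalIdeal R) red.toHom := by
  refine ⟨fun i x => ?_, fun i x => ?_⟩
  · obtain ⟨n, hn⟩ := exists_one_tmul ((red.θ i).symm x)
    exact ⟨n, (congrArg (red.θ i) hn.symm).trans ((red.θ i).apply_symm_apply x)⟩
  · rw [← one_tmul_eq_zero_iff]
    exact (red.θ i).map_eq_zero_iff

/-- Every reduction homomorphism comes from an isomorphism `R/𝔪 ⊗ F ≅ F₀`. -/
theorem exists_reductionIso {π : PreQCoh.Hom F.toPre (D.sections F₀)}
    (hπ : PreQCoh.IsReduction (IsLocalRing.maximalIdeal R) π) :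
    ∃ red : ReductionIso D F F₀, ∀ i m, red.θ i (1 ⊗ₜ[R] m) = π.app i m := by
  have base : ∀ i (r : R) (m : F.M i), π.app i (r • m) =
      (D.α i (IsLocalRing.residue R r ⊗ₜ[R] 1) • (show Γ(F₀, 𝒰.U i) from π.app i m) :
        Γ(F₀, 𝒰.U i)) := by
    intro i r m
    refine (π.app_base i r m).trans ?_
    change (D.γ i (algebraMap R (D.A i) r) • (show Γ(F₀, 𝒰.U i) from π.app i m) :
      Γ(F₀, 𝒰.U i)) = _
    rw [γ_apply, residue_tmul, Algebra.algebraMap_eq_smul_one]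
  let ev : ∀ i, F.M i →+ Γ(F₀, 𝒰.U i) := fun i => (π.app i).toAddMonoidHom
  have hev : ∀ i m, ev i m = π.app i m := fun _ _ => rfl
  let T : ∀ i, (IsLocalRing.ResidueField R ⊗[R] F.M i) →+ Γ(F₀, 𝒰.U i) := fun i =>
    TensorProduct.liftAddHom
      (AddMonoidHom.mk' (fun c => AddMonoidHom.mk' (fun m => D.α i (c ⊗ₜ[R] 1) • ev i m)
          (fun m n => by rw [map_add, smul_add]))
        (fun c d => by
          ext m
          change D.α i ((c + d) ⊗ₜ[R] 1) • ev i m =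
            D.α i (c ⊗ₜ[R] 1) • ev i m + D.α i (d ⊗ₜ[R] 1) • ev i m
          rw [TensorProduct.add_tmul, map_add, add_smul]))
      (fun r c m => by
        change D.α i ((r • c) ⊗ₜ[R] 1) • ev i m = D.α i (c ⊗ₜ[R] 1) • ev i (r • m)
        rw [hev, hev, base, smul_smul, ← map_mul, Algebra.TensorProduct.tmul_mul_tmul, mul_one,
          mul_comm, Algebra.smul_def]
        rfl)
  have hT : ∀ i c m, T i (c ⊗ₜ[R] m) = D.α i (c ⊗ₜ[R] 1) • ev i m := fun _ _ _ => rfl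
  have hT1 : ∀ i m, T i (1 ⊗ₜ[R] m) = ev i m := fun i m => by
    rw [hT, ← Algebra.TensorProduct.one_def, map_one, one_smul]
  have hbij : ∀ i, Function.Bijective (T i) := by
    refine fun i => ⟨(injective_iff_map_eq_zero _).2 fun x hx => ?_, fun y => ?_⟩
    · obtain ⟨n, rfl⟩ := exists_one_tmul x
      rw [hT1] at hx
      exact (one_tmul_eq_zero_iff n).2 ((hπ.ker i n).1 hx)
    · obtain ⟨n, hn⟩ := hπ.surj i y
      exact ⟨1 ⊗ₜ[R] n, (hT1 i n).trans hn⟩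
  refine ⟨⟨fun i => AddEquiv.ofBijective (T i) (hbij i), fun i c d m a => ?_, fun {i j} h x => ?_⟩,
    hT1⟩
  · change T i ((c * d) ⊗ₜ[R] (op a • m)) = D.α i (d ⊗ₜ[R] a) • T i (c ⊗ₜ[R] m)
    have h1 : ev i (op a • m) = D.γ i a • ev i m := (π.app i).map_smul (op a) m
    rw [hT, hT, h1, γ_apply, smul_smul, smul_smul, ← map_mul, ← map_mul,
      Algebra.TensorProduct.tmul_mul_tmul, Algebra.TensorProduct.tmul_mul_tmul, one_mul, mul_one,
      mul_one, mul_comm]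
  · obtain ⟨n, rfl⟩ := exists_one_tmul x
    change T i (1 ⊗ₜ[R] F.ρ h n) = F₀.res (𝒰.mono h) (T j (1 ⊗ₜ[R] n))
    rw [hT1, hT1]
    exact π.comm h n

/-! ### Uniqueness of the lift -/

variable [IsArtinianRing R] {ι : Type} {c : ι → I}

/-- Two flat lifts of `P₀` are isomorphic over `P₀`: lift `F → P₀` along `F' → P₀`. -/
theorem exists_iso_of_isReduction (hc : Function.Surjective c) {F' : QCoh D.toNCScheme}
    {P₀ : PreQCoh D.toNCScheme} {r : ℕ} (hP : PreQCoh.Bundle ⊥ r F.toPre)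
    {π : PreQCoh.Hom F.toPre P₀} {π' : PreQCoh.Hom F'.toPre P₀}
    (hπ : PreQCoh.IsReduction (IsLocalRing.maximalIdeal R) π)
    (hπ' : PreQCoh.IsReduction (IsLocalRing.maximalIdeal R) π')
    (hF' : ∀ i, Module.Flat R (F'.M i)) (h₀ : PreQCoh.Acyclic c F.toPre P₀) :
    ∃ g : F ≅ F', ∀ i m, π'.app i (g.hom.app i m) = π.app i m := by
  obtain ⟨s, hs⟩ := hπ'.homSurj hc hP hF' h₀ π
  have hb := hπ.bijective hπ' hF' s hs
  obtain ⟨t, ht⟩ := PreQCoh.exists_lift s (fun i => (hb i).1) (PreQCoh.Hom.id F'.toPre)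
    fun i x => (hb i).2 _
  exact ⟨⟨QCoh.homOfPre s, QCoh.homOfPre t,
    QCoh.hom_ext fun i m => (hb i).1 (ht i (s.app i m)), QCoh.hom_ext fun i m => ht i m⟩, hs⟩

/-! ### The endomorphism ring modulo the maximal ideal -/

theorem hom_ext_of_sections {M N : X.Modules} {r : ℕ} (h : IsLocallyFreeOn 𝒰 M r) {g g' : M ⟶ N}
    (hg : ∀ i (m : Γ(M, 𝒰.U i)), g.app (𝒰.U i) m = g'.app (𝒰.U i) m) : g = g' := by
  refine Scheme.Modules.hom_ext _ _ fun W => ?_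
  ext m
  have hcov : W ≤ ⨆ i, W ⊓ 𝒰.U i := by rw [← inf_iSup_eq, 𝒰.cover, inf_top_eq]
  refine Scheme.Modules.eq_of_cover N (fun i => (inf_le_left : W ⊓ 𝒰.U i ≤ W)) hcov fun i => ?_
  obtain ⟨e, he⟩ := h.exists_basis i
  refine ((Scheme.Modules.app_res g _ m).symm.trans ?_).trans (Scheme.Modules.app_res g' _ m)
  obtain ⟨c, hc⟩ := (he (W ⊓ 𝒰.U i) inf_le_right).2 (M.res inf_le_left m)
  dsimp only at hc
  rw [← hc]
  refine (map_sum (g.app _).hom _ _).trans (Eq.trans ?_ (map_sum (g'.app _).hom _ _).symm)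
  refine Finset.sum_congr rfl fun a _ => ?_
  refine (Scheme.Modules.Hom.app_smul g _ _).trans
    (Eq.trans ?_ (Scheme.Modules.Hom.app_smul g' _ _).symm)
  refine congrArg _ ?_
  refine (Scheme.Modules.app_res g _ _).trans (Eq.trans ?_ (Scheme.Modules.app_res g' _ _).symm)
  rw [hg]

/-- Reduction of endomorphisms: `R/𝔪 ⊗ End F ≅ End F₀` for a lift `F` of `F₀`. -/
theorem exists_end_ringEquiv (hc : Function.Surjective c) {r : ℕ} (h : IsLocallyFreeOn 𝒰 F₀ r)
    (hP : PreQCoh.Bundle ⊥ r F.toPre) {π : PreQCoh.Hom F.toPre (D.sections F₀)}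
    (hπ : PreQCoh.IsReduction (IsLocalRing.maximalIdeal R) π) (hF : ∀ i, Module.Flat R (F.M i))
    (h₀ : PreQCoh.Acyclic c F.toPre (D.sections F₀)) :
    ∃ Θ : (IsLocalRing.ResidueField R ⊗[R] End F) ≃+* End F₀,
      ∀ (i : I) (e : F ⟶ F) (m : F.M i),
        Scheme.Modules.Hom.app (M := F₀) (N := F₀) (Θ (1 ⊗ₜ[R] End.of e)) (𝒰.U i) (π.app i m) =
          π.app i (e.app i m) := by
  have ex : ∀ e : F ⟶ F, ∃ g : F₀ ⟶ F₀, ∀ i (m : F.M i),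
      g.app (𝒰.U i) (π.app i m) = π.app i (e.app i m) := by
    intro e
    obtain ⟨t, ht⟩ := PreQCoh.exists_desc π hπ.surj (π.comp (QCoh.homToPre e)) fun i x hx =>
      (hπ.ker i _).2 ((QCoh.homToPre e).map_mem_smul_top ((hπ.ker i x).1 hx))
    obtain ⟨g, hg⟩ := D.exists_hom_of_sections h t
    exact ⟨g, fun i m => (hg i _).trans (ht i m)⟩
  choose Φ hΦ using ex
  have uniq : ∀ g g' : F₀ ⟶ F₀, (∀ i (m : F.M i),
      g.app (𝒰.U i) (π.app i m) = g'.app (𝒰.U i) (π.app i m)) → g = g' := by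
    refine fun g g' H => hom_ext_of_sections h fun i m => ?_
    obtain ⟨m, rfl⟩ := hπ.surj i m
    exact H i m
  let Ψ : End F →+* End F₀ :=
    { toFun := Φ
      map_one' := uniq _ _ fun i m => hΦ _ i m
      map_mul' := fun e e' => uniq _ _ fun i m =>
        (hΦ _ i m).trans ((hΦ e i _).symm.trans (congrArg (fun x => (Φ e).app (𝒰.U i) x)
          (hΦ e' i m).symm))
      map_zero' := uniq _ _ fun i m => (hΦ _ i m).trans (map_zero (π.app i))
      map_add' := fun e e' => uniq _ _ fun i m =>
        (hΦ _ i m).trans (((π.app i).map_add _ _).trans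
          (congrArg₂ (fun x y : Γ(F₀, 𝒰.U i) => x + y) (hΦ e i m).symm (hΦ e' i m).symm)) }
  let ρ : End F →+* (IsLocalRing.ResidueField R ⊗[R] End F) :=
    (Algebra.TensorProduct.includeRight : End F →ₐ[R] IsLocalRing.ResidueField R ⊗[R] End F)
  have hρ : ∀ e, ρ e = 1 ⊗ₜ[R] e := fun _ => rfl
  have hρs : Function.Surjective ρ := fun x => by
    obtain ⟨e, he⟩ := exists_one_tmul x
    exact ⟨e, he.symm⟩
  have hΨs : Function.Surjective Ψ := by
    intro g
    obtain ⟨s, hs⟩ := hπ.homSurj hc hP hF h₀ ((D.sectionsMap g).comp π)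
    exact ⟨QCoh.homOfPre s, uniq _ _ fun i m => (hΦ _ i m).trans (hs i m)⟩
  -- both kernels are `𝔪 End F`
  have hker : ∀ e : End F, Ψ e = 0 ↔ ρ e = 0 := by
    intro e
    rw [hρ, one_tmul_eq_zero_iff]
    constructor
    · intro he
      refine QCoh.mem_of_app_mem hc hP hπ hF h₀ _ e fun i m => (hπ.ker i _).1 ?_
      refine (hΦ e i m).symm.trans ?_
      exact congrArg (fun g : F₀ ⟶ F₀ => g.app (𝒰.U i) (π.app i m)) he
    · intro he
      exact uniq _ _ fun i m => (hΦ e i m).trans ((hπ.ker i _).2 (QCoh.app_mem_of_mem he i m))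
  let Θ : (IsLocalRing.ResidueField R ⊗[R] End F) →+* End F₀ :=
    RingHom.liftOfSurjective ρ hρs ⟨Ψ, fun e he => (hker e).2 he⟩
  have hΘ : ∀ e, Θ (ρ e) = Ψ e := fun e => RingHom.liftOfRightInverse_comp_apply ρ _
    (Function.rightInverse_surjInv hρs) ⟨Ψ, fun e he => (hker e).2 he⟩ e
  refine ⟨RingEquiv.ofBijective Θ ⟨(injective_iff_map_eq_zero _).2 fun x hx => ?_, fun g => ?_⟩,
    fun i e m => ?_⟩
  · obtain ⟨e, rfl⟩ := hρs x
    exact (hker e).1 ((hΘ e).symm.trans hx)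
  · obtain ⟨e, rfl⟩ := hΨs g
    exact ⟨_, hΘ e⟩
  · refine Eq.trans ?_ (hΦ e i m)
    exact congrArg (fun g : F₀ ⟶ F₀ => g.app (𝒰.U i) (π.app i m)) (hΘ e)

end NCDeformation

theorem theorem5p2 {k : Type u} [Field k] {X : Scheme.{u}} (f : X ⟶ Spec (.of k))
    [IsIntegral X] [IsSeparated f] [LocallyOfFiniteType f] [QuasiCompact f]
    {I : Type w} [SemilatticeInf I] [Finite I] (𝒰 : AffineMeetCover X I)
    {R : Type u} [CommRing R] [IsLocalRing R] [IsArtinianRing R] [Algebra k R]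
    (hR : Function.Bijective (algebraMap k (IsLocalRing.ResidueField R)))
    (D : NCDeformation f 𝒰 R)
    (r : ℕ) (F₀ : X.Modules) (hF₀ : IsLocallyFreeOn 𝒰 F₀ r)
    (hpre : ∀ p : ℕ, 0 < p → ExtVanishes F₀ F₀ p) :
    ∃ (F : QCoh D.toNCScheme) (red : ReductionIso D F F₀),
      F.IsLocallyFreeOfRank r ∧
      (∀ (F' : QCoh D.toNCScheme) (red' : ReductionIso D F' F₀), F'.IsLocallyFree →
        ∃ g : F ≅ F', ∀ (i : I) (c : IsLocalRing.ResidueField R) (m : F.M i),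
          red'.θ i (c ⊗ₜ[R] g.hom.app i m) = red.θ i (c ⊗ₜ[R] m)) ∧
      Module.Flat R (End F) ∧
      (∃ Θ : (IsLocalRing.ResidueField R ⊗[R] End F) ≃+* End F₀,
        ∀ (i : I) (c d : IsLocalRing.ResidueField R) (h : F ⟶ F) (m : F.M i),
          Scheme.Modules.Hom.app (M := F₀) (N := F₀) (Θ (c ⊗ₜ[R] End.of h)) (𝒰.U i)
            (red.θ i (d ⊗ₜ[R] m)) = red.θ i ((c * d) ⊗ₜ[R] h.app i m)) ∧
      ∀ p : ℕ, 0 < p → ExtVanishes F F p := by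
  -- the index type `Fin n` keeps the products over the covering in the universe `u`
  have hc : Function.Surjective (Finite.equivFin I).symm := Equiv.surjective _
  have hac := D.acyclic_sections hc hF₀ hpre
  obtain ⟨N, π, hP, hπ⟩ := PreQCoh.Bundle.exists_lift D.flat_base hc (D.sections_bundle hF₀) (hac 1)
  obtain ⟨F, rfl⟩ := hP.exists_qcoh
  have hloc : F.IsLocallyFreeOfRank r := hP.isLocallyFreeOfRank
  have hF : ∀ i, Module.Flat R (F.M i) := QCoh.IsLocallyFree.flat D.flat_base ⟨r, hloc⟩
  have h₀ := PreQCoh.Acyclic.of_torsion π hπ.surj (fun i x => (hπ.ker i x).1)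
    (D.sections_torsion F₀) hac
  obtain ⟨red, hred⟩ := NCDeformation.exists_reductionIso hπ
  refine ⟨F, red, hloc, fun F' red' hF' => ?_, QCoh.flat_end hc hP hπ hF h₀, ?_, fun p hp => ?_⟩
  · obtain ⟨g, hg⟩ := NCDeformation.exists_iso_of_isReduction hc hP hπ red'.isReduction
      (hF'.flat D.flat_base) h₀
    refine ⟨g, fun i c m => ?_⟩
    obtain ⟨a, rfl⟩ := IsLocalRing.residue_surjective c
    rw [NCDeformation.residue_tmul, NCDeformation.residue_tmul, hred]
    exact (congrArg (red'.θ i <| 1 ⊗ₜ[R] ·) ((g.hom.app i).map_smul_of_tower a m).symm).trans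
      (hg i (a • m))
  · obtain ⟨Θ, hΘ⟩ := NCDeformation.exists_end_ringEquiv hc hF₀ hP hπ hF h₀
    refine ⟨Θ, fun i c d h m => ?_⟩
    obtain ⟨a, rfl⟩ := IsLocalRing.residue_surjective c
    obtain ⟨b, rfl⟩ := IsLocalRing.residue_surjective d
    rw [← map_mul, NCDeformation.residue_tmul, NCDeformation.residue_tmul,
      NCDeformation.residue_tmul, hred, hred]
    refine (hΘ i (a • h) (b • m)).trans ?_
    rw [QCoh.smul_app, mul_smul]
    exact congrArg (fun x => π.app i (a • x)) ((h.app i).map_smul_of_tower b m)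
  · obtain ⟨p, rfl⟩ := Nat.exists_eq_succ_of_ne_zero hp.ne'
    exact QCoh.extVanishes_of_acyclic D.meetBaseChange hc hP p F (hπ.acyclic hc hP hF h₀)
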